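/- Let $d\ge 2$, let $\Omega\subset\mathbb R^d$ be a bounded open set, $0<T<\infty$, $N\ge 1$, and let $0=\alpha_0<\alpha_1<\dots<\alpha_N$ be real numbers. Put $s=\alpha_N+2$ and $s^*=s/(s-1)$, and let $$W(\mathrm{div};\Omega)=\{\mathbf v\in (L^s(\Omega))^d:\ \nabla\cdot\mathbf v\in L^2(\Omega)\},\qquad \|\mathbf v\|_{W(\mathrm{div};\Omega)}=\|\mathbf v\|_{L^s}+\|\nabla\cdot\mathbf v\|_{L^2},$$ $$R(\Omega)=L^2(\Omega)\cap W^{1,s^*}_0(\Omega),\qquad \|r\|_{R(\Omega)}=\|r\|_{L^2}+\|\nabla r\|_{L^{s^*}},$$ where $W_0^{1,s^*}(\Omega)$ is the closure of $C_c^\infty(\Omega)$ in $W^{1,s^*}(\Omega)$ and $\nabla\cdot$, $\nabla$ are taken in the sense of distributions. Let $(\cdot,\cdot)$ denote the integral over $\Omega$ of the product (scalar product) of two functions. Assume: 1. $\phi:\Omega\to\mathbb R$ is measurable with $0<\underline\phi\le\phi(x)\le\overline\phi<\infty$; 2. $a_i(\cdot,t)\in L^\infty(\Omega)$ for $0\le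 i\le N$, $t\in[0,T]$, with $0\le a_i\le\bar a<\infty$ for all $i$ and $a_0,a_N\ge\underline a>0$; 3. $f\in L^\infty(0,T;L^2(\Omega))$; 4. there is a constant $L$ such that $\|a_i(t_1)-a_i(t_2)\|_{L^\infty}\le L|t_1-t_2|$ for all $i$ and $\|f(t_1)-f(t_2)\|_{L^2}\le L|t_1-t_2|$, for all $t_1,t_2\in[0,T]$; 5. $\rho_0\in R(\Omega)$. Write $F(x,t,z)=\sum_{i=0}^N a_i(x,t)z^{\alpha_i}$ for $z\ge 0$. Then there exists a pair $$(\mathbf m,\rho)\in L^\infty(0,T;W(\mathrm{div};\Omega))\times L^\infty(0,T;R(\Omega))$$ such that $\rho$ has a distributional time derivative $\partial_t\rho\in L^\infty(0,T;L^2(\Omega))$ and $$\int_0^T (F(x,t,|\mathbf m|)\mathbf m,\mathbf v)\,dt-\int_0^T(\nabla\cdot\mathbf v,\rho)\,dt=0\qquad\text{for all }\mathbf v\in L^1(0,T;W(\mathrm{div};\Omega)),$$ $$\int_0^T(\phi\,\partial_t\rho,q)\,dt+\int_0^T(\nabla\cdot\mathbf m,q)\,dt=\int_0^T(f,q)\,dt\qquad\text{for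 all }q\in L^1(0,T;L^2(\Omega)).$$ Moreover, if there is $\mathbf m_0\in W(\mathrm{div};\Omega)$ with $F(x,0,|\mathbf m_0|)\mathbf m_0=-\nabla\rho_0$ a.e. in $\Omega$, then $(\mathbf m,\rho)$ can be chosen so that in addition $\rho(0)=\rho_0$, where $\rho$ is identified with its representative in $C([0,T];L^2(\Omega))$. -/

import Mathlib

open MeasureTheory TopologicalSpace Set Filter
open scoped ENNReal NNReal Topology Distributions Gradient

/-- `ℝ^d` with its Euclidean norm. -/
abbrev Euc (d : ℕ) : Type := EuclideanSpace ℝ (Fin d)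

/-- Lebesgue measure on the open set `Ω`. -/
noncomputable abbrev volOn {d : ℕ} (Ω : Opens (Euc d)) : Measure (Euc d) :=
  volume.restrict (Ω : Set (Euc d))

/-- Lebesgue measure on the time interval `(0,T)`. -/
noncomputable abbrev timeMeas (T : ℝ) : Measure ℝ := volume.restrict (Ioo 0 T)

/-- The exponents `0 = α₀ < α₁ < ⋯ < α_N` of a generalized Forchheimer polynomial, `N ≥ 1`. -/
structure ForchheimerExponents (N : ℕ) where
  α : Fin (N + 1) → ℝ
  one_le : 1 ≤ N
  zero : α 0 = 0
  strictMono : StrictMono α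

namespace ForchheimerExponents

variable {N : ℕ} (e : ForchheimerExponents N)

/-- The exponent `s = α_N + 2`. -/
noncomputable def s : ℝ≥0∞ := ENNReal.ofReal (e.α (Fin.last N) + 2)

/-- The conjugate exponent `s* = s / (s - 1) = (α_N + 2) / (α_N + 1)`. -/
noncomputable def sStar : ℝ≥0∞ :=
  ENNReal.ofReal ((e.α (Fin.last N) + 2) / (e.α (Fin.last N) + 1))

theorem α_last_nonneg : 0 ≤ e.α (Fin.last N) := by
  rw [← e.zero]
  exact e.strictMono.monotone (Fin.zero_le _)

instance : Fact (1 ≤ e.s) := by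
  refine ⟨?_⟩
  rw [s, ENNReal.one_le_ofReal]
  linarith [e.α_last_nonneg]

instance : Fact (1 ≤ e.sStar) := by
  refine ⟨?_⟩
  have h := e.α_last_nonneg
  rw [sStar, ENNReal.one_le_ofReal, one_le_div (by linarith)]
  linarith

/-- The generalized polynomial `F(z) = ∑ i, c i * z ^ α i` with coefficients `c`, for `z ≥ 0`. -/
noncomputable def poly (c : Fin (N + 1) → ℝ) (z : ℝ) : ℝ := ∑ i, c i * z ^ e.α i

end ForchheimerExponents

section Spaces

variable {d : ℕ} (Ω : Opens (Euc d))

/-- `g` is the divergence of `v` in the sense of distributions on `Ω`. -/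
def IsWeakDiv (v : Euc d → Euc d) (g : Euc d → ℝ) : Prop :=
  ∀ ψ : 𝓓(Ω, ℝ), ∫ x in Ω, ψ x * g x = - ∫ x in Ω, inner ℝ (v x) (∇ ψ x)

theorem testFunction_continuous_gradient {Ω : Opens (Euc d)} (ψ : 𝓓(Ω, ℝ)) :
    Continuous (∇ (ψ : Euc d → ℝ)) :=
  (InnerProductSpace.toDual ℝ (Euc d)).symm.continuous.comp
    (ψ.contDiff.continuous_fderiv (by simp))

theorem testFunction_hasCompactSupport_gradient {Ω : Opens (Euc d)} (ψ : 𝓓(Ω, ℝ)) :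
    HasCompactSupport (∇ (ψ : Euc d → ℝ)) :=
  (ψ.hasCompactSupport.fderiv (𝕜 := ℝ)).comp_left (map_zero _)

theorem integrable_testFunction_mul {Ω : Opens (Euc d)} {p : ℝ≥0∞} (hp : 1 ≤ p) (ψ : 𝓓(Ω, ℝ))
    {g : Euc d → ℝ} (hg : MemLp g p (volOn Ω)) :
    Integrable (fun x => ψ x * g x) (volOn Ω) :=
  (hg.locallyIntegrable hp).integrable_smul_left_of_hasCompactSupport ψ.continuous
    ψ.hasCompactSupport

theorem integrable_inner_gradient {Ω : Opens (Euc d)} {p : ℝ≥0∞} (hp : 1 ≤ p) (ψ : 𝓓(Ω, ℝ))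
    {v : Euc d → Euc d} (hv : MemLp v p (volOn Ω)) :
    Integrable (fun x => inner ℝ (v x) (∇ ψ x)) (volOn Ω) := by
  have hc := testFunction_continuous_gradient ψ
  have hn : LocallyIntegrable (fun x => ‖v x‖) (volOn Ω) := hv.norm.locallyIntegrable hp
  have h := hn.integrable_smul_left_of_hasCompactSupport hc.norm
    (testFunction_hasCompactSupport_gradient ψ).norm
  refine h.mono (hv.1.inner hc.aestronglyMeasurable) (ae_of_all _ fun x => ?_)
  rw [norm_smul, norm_norm, norm_norm, mul_comm]
  exact norm_inner_le_norm _ _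

/-- The space `W(div; Ω) = {v ∈ L^p(Ω)^d : div v ∈ L²(Ω)}`; an element is stored as the pair
`(v, div v)`, so that the norm inherited from `L^p × L²` is equivalent to
`‖v‖_{L^p} + ‖div v‖_{L²}`. -/
def Wdiv (p : ℝ≥0∞) [hp : Fact (1 ≤ p)] :
    Submodule ℝ (Lp (Euc d) p (volOn Ω) × Lp ℝ 2 (volOn Ω)) where
  carrier := {w | IsWeakDiv Ω w.1 w.2}
  zero_mem' := by
    intro ψ
    have h1 : (fun x => ψ x * (0 : Lp ℝ 2 (volOn Ω)) x) =ᵐ[volOn Ω] fun _ => 0 := by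
      filter_upwards [Lp.coeFn_zero ℝ 2 (volOn Ω)] with x hx
      rw [hx]; simp
    have h2 : (fun x => inner ℝ ((0 : Lp (Euc d) p (volOn Ω)) x) (∇ ψ x)) =ᵐ[volOn Ω]
        fun _ => (0 : ℝ) := by
      filter_upwards [Lp.coeFn_zero (Euc d) p (volOn Ω)] with x hx
      rw [hx]; simp
    change ∫ x in Ω, ψ x * (0 : Lp ℝ 2 (volOn Ω)) x
      = - ∫ x in Ω, inner ℝ ((0 : Lp (Euc d) p (volOn Ω)) x) (∇ ψ x)
    rw [integral_congr_ae h1, integral_congr_ae h2]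
    simp
  add_mem' := by
    intro w z hw hz ψ
    have h1 : (fun x => ψ x * (w.2 + z.2) x) =ᵐ[volOn Ω]
        fun x => ψ x * w.2 x + ψ x * z.2 x := by
      filter_upwards [Lp.coeFn_add w.2 z.2] with x hx
      rw [hx, Pi.add_apply, mul_add]
    have h2 : (fun x => inner ℝ ((w.1 + z.1) x) (∇ ψ x)) =ᵐ[volOn Ω]
        fun x => inner ℝ (w.1 x) (∇ ψ x) + inner ℝ (z.1 x) (∇ ψ x) := by
      filter_upwards [Lp.coeFn_add w.1 z.1] with x hx
      rw [hx, Pi.add_apply, inner_add_left]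
    change ∫ x in Ω, ψ x * (w.2 + z.2) x = - ∫ x in Ω, inner ℝ ((w.1 + z.1) x) (∇ ψ x)
    rw [integral_congr_ae h1, integral_congr_ae h2,
      integral_add (integrable_testFunction_mul one_le_two ψ (Lp.memLp _))
        (integrable_testFunction_mul one_le_two ψ (Lp.memLp _)),
      integral_add (integrable_inner_gradient hp.out ψ (Lp.memLp _))
        (integrable_inner_gradient hp.out ψ (Lp.memLp _)), hw ψ, hz ψ]
    ring
  smul_mem' := by
    intro c w hw ψ
    have h1 : (fun x => ψ x * (c • w.2) x) =ᵐ[volOn Ω] fun x => c * (ψ x * w.2 x) := by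
      filter_upwards [Lp.coeFn_smul c w.2] with x hx
      rw [hx, Pi.smul_apply, smul_eq_mul]
      ring
    have h2 : (fun x => inner ℝ ((c • w.1) x) (∇ ψ x)) =ᵐ[volOn Ω]
        fun x => c * inner ℝ (w.1 x) (∇ ψ x) := by
      filter_upwards [Lp.coeFn_smul c w.1] with x hx
      rw [hx, Pi.smul_apply, real_inner_smul_left]
    change ∫ x in Ω, ψ x * (c • w.2) x = - ∫ x in Ω, inner ℝ ((c • w.1) x) (∇ ψ x)
    rw [integral_congr_ae h1, integral_congr_ae h2, integral_const_mul, integral_const_mul, hw ψ]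
    ring

/-- `r` belongs to `W₀^{1,p}(Ω)`, the closure of the test functions in `W^{1,p}(Ω)`, and `g` is
its weak gradient. -/
def IsW0 (p : ℝ≥0∞) (r : Euc d → ℝ) (g : Euc d → Euc d) : Prop :=
  ∃ ψ : ℕ → 𝓓(Ω, ℝ),
    Tendsto (fun n => eLpNorm (fun x => ψ n x - r x) p (volOn Ω)) atTop (𝓝 0) ∧
    Tendsto (fun n => eLpNorm (fun x => ∇ (ψ n) x - g x) p (volOn Ω)) atTop (𝓝 0)

theorem tendsto_eLpNorm_add_zero {F : Type*} [NormedAddCommGroup F] {p : ℝ≥0∞} (hp : 1 ≤ p)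
    {Ω : Opens (Euc d)} {u v w : ℕ → Euc d → F}
    (hu : ∀ n, AEStronglyMeasurable (u n) (volOn Ω))
    (hv : ∀ n, AEStronglyMeasurable (v n) (volOn Ω))
    (hw : ∀ n, w n =ᵐ[volOn Ω] u n + v n)
    (h1 : Tendsto (fun n => eLpNorm (u n) p (volOn Ω)) atTop (𝓝 0))
    (h2 : Tendsto (fun n => eLpNorm (v n) p (volOn Ω)) atTop (𝓝 0)) :
    Tendsto (fun n => eLpNorm (w n) p (volOn Ω)) atTop (𝓝 0) := by
  have h := h1.add h2
  rw [add_zero] at h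
  refine tendsto_of_tendsto_of_tendsto_of_le_of_le tendsto_const_nhds h (fun _ => zero_le)
    fun n => ?_
  rw [eLpNorm_congr_ae (hw n)]
  exact eLpNorm_add_le (hu n) (hv n) hp

theorem tendsto_eLpNorm_smul_zero {F : Type*} [NormedAddCommGroup F] [NormedSpace ℝ F]
    {p : ℝ≥0∞} {Ω : Opens (Euc d)} {u w : ℕ → Euc d → F} (c : ℝ)
    (hw : ∀ n, w n =ᵐ[volOn Ω] c • u n)
    (h1 : Tendsto (fun n => eLpNorm (u n) p (volOn Ω)) atTop (𝓝 0)) :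
    Tendsto (fun n => eLpNorm (w n) p (volOn Ω)) atTop (𝓝 0) := by
  have h := ENNReal.Tendsto.const_mul (a := ‖c‖ₑ) h1 (Or.inr enorm_ne_top)
  rw [mul_zero] at h
  refine h.congr fun n => ?_
  rw [eLpNorm_congr_ae (hw n), eLpNorm_const_smul]

theorem gradient_testFunction_add {Ω : Opens (Euc d)} (ψ η : 𝓓(Ω, ℝ)) (x : Euc d) :
    ∇ (ψ + η : 𝓓(Ω, ℝ)) x = ∇ ψ x + ∇ η x := by
  have h1 := (ψ.contDiff.differentiable (by simp)) x
  have h2 := (η.contDiff.differentiable (by simp)) x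
  change ∇ (fun y => ψ y + η y) x = _
  simp only [gradient]
  rw [fderiv_fun_add h1 h2, map_add]

theorem gradient_testFunction_smul {Ω : Opens (Euc d)} (c : ℝ) (ψ : 𝓓(Ω, ℝ)) (x : Euc d) :
    ∇ (c • ψ : 𝓓(Ω, ℝ)) x = c • ∇ ψ x := by
  have h1 := (ψ.contDiff.differentiable (by simp)) x
  change ∇ (fun y => c • ψ y) x = _
  simp only [gradient]
  rw [fderiv_fun_const_smul h1]
  simp

/-- The space `L²(Ω) ∩ W₀^{1,p}(Ω)` of square integrable functions with gradient in `L^p` and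
vanishing trace; an element is stored as the pair `(r, ∇ r)`, so that the norm inherited from
`L² × L^p` is equivalent to `‖r‖_{L²} + ‖∇ r‖_{L^p}`. -/
def L2W0 (p : ℝ≥0∞) [hp : Fact (1 ≤ p)] :
    Submodule ℝ (Lp ℝ 2 (volOn Ω) × Lp (Euc d) p (volOn Ω)) where
  carrier := {w | IsW0 Ω p w.1 w.2}
  zero_mem' := by
    refine ⟨fun _ => 0, ?_, ?_⟩
    · refine tendsto_const_nhds.congr fun n => ?_
      rw [eq_comm, ← eLpNorm_zero (α := Euc d) (ε := ℝ) (p := p) (μ := volOn Ω)]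
      refine eLpNorm_congr_ae ?_
      filter_upwards [Lp.coeFn_zero ℝ 2 (volOn Ω)] with x hx
      change (0 : ℝ) - (0 : Lp ℝ 2 (volOn Ω)) x = 0
      rw [hx]; simp
    · refine tendsto_const_nhds.congr fun n => ?_
      rw [eq_comm, ← eLpNorm_zero (α := Euc d) (ε := Euc d) (p := p) (μ := volOn Ω)]
      refine eLpNorm_congr_ae ?_
      filter_upwards [Lp.coeFn_zero (Euc d) p (volOn Ω)] with x hx
      change ∇ (fun _ => (0 : ℝ)) x - (0 : Lp (Euc d) p (volOn Ω)) x = 0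
      rw [hx]; simp [gradient]
  add_mem' := by
    rintro w z ⟨ψ, h1, h2⟩ ⟨η, h3, h4⟩
    refine ⟨fun n => ψ n + η n, ?_, ?_⟩
    · refine tendsto_eLpNorm_add_zero hp.out
        (fun n => (ψ n).continuous.aestronglyMeasurable.sub (Lp.aestronglyMeasurable w.1))
        (fun n => (η n).continuous.aestronglyMeasurable.sub (Lp.aestronglyMeasurable z.1))
        (fun n => ?_) h1 h3
      filter_upwards [Lp.coeFn_add w.1 z.1] with x hx
      change (ψ n x + η n x) - (w.1 + z.1) x = (ψ n x - w.1 x) + (η n x - z.1 x)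
      rw [hx, Pi.add_apply]
      ring
    · refine tendsto_eLpNorm_add_zero hp.out
        (fun n => (testFunction_continuous_gradient (ψ n)).aestronglyMeasurable.sub
          (Lp.aestronglyMeasurable w.2))
        (fun n => (testFunction_continuous_gradient (η n)).aestronglyMeasurable.sub
          (Lp.aestronglyMeasurable z.2))
        (fun n => ?_) h2 h4
      filter_upwards [Lp.coeFn_add w.2 z.2] with x hx
      change ∇ (ψ n + η n : 𝓓(Ω, ℝ)) x - (w.2 + z.2) x
        = (∇ (ψ n) x - w.2 x) + (∇ (η n) x - z.2 x)
      rw [hx, Pi.add_apply, gradient_testFunction_add]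
      abel
  smul_mem' := by
    rintro c w ⟨ψ, h1, h2⟩
    refine ⟨fun n => c • ψ n, ?_, ?_⟩
    · refine tendsto_eLpNorm_smul_zero c (fun n => ?_) h1
      filter_upwards [Lp.coeFn_smul c w.1] with x hx
      change c • ψ n x - (c • w.1) x = c • (ψ n x - w.1 x)
      rw [hx, Pi.smul_apply, smul_sub]
    · refine tendsto_eLpNorm_smul_zero c (fun n => ?_) h2
      filter_upwards [Lp.coeFn_smul c w.2] with x hx
      change ∇ (c • ψ n : 𝓓(Ω, ℝ)) x - (c • w.2) x = c • (∇ (ψ n) x - w.2 x)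
      rw [hx, Pi.smul_apply, gradient_testFunction_smul, smul_sub]

end Spaces

section Accessors

variable {d : ℕ} {Ω : Opens (Euc d)} {p : ℝ≥0∞} [Fact (1 ≤ p)]

/-- The vector field underlying an element of `W(div; Ω)`. -/
noncomputable def Wdiv.field (w : Wdiv Ω p) : Euc d → Euc d := w.1.1

/-- The divergence of an element of `W(div; Ω)`. -/
noncomputable def Wdiv.div (w : Wdiv Ω p) : Euc d → ℝ := w.1.2

/-- The class in `L²(Ω)` of an element of `L²(Ω) ∩ W₀^{1,p}(Ω)`. -/
def L2W0.toL2 (r : L2W0 Ω p) : Lp ℝ 2 (volOn Ω) := r.1.1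

/-- The weak gradient of an element of `L²(Ω) ∩ W₀^{1,p}(Ω)`. -/
noncomputable def L2W0.grad (r : L2W0 Ω p) : Euc d → Euc d := r.1.2

end Accessors

/-- The open time interval `(0,T)`. -/
def timeInterval (T : ℝ) : Opens ℝ := ⟨Ioo 0 T, isOpen_Ioo⟩

/-- `u'` is the time derivative of `u` in the sense of distributions on `(0,T)` with values
in `X`. -/
def HasWeakTimeDeriv {X : Type*} [NormedAddCommGroup X] [NormedSpace ℝ X] (T : ℝ)
    (u u' : ℝ → X) : Prop :=
  ∀ θ : 𝓓(timeInterval T, ℝ),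
    ∫ t in Ioo 0 T, θ t • u' t = - ∫ t in Ioo 0 T, deriv θ t • u t

/-- `u` has a representative that is continuous on `[0,T]` and takes the value `u₀` at `t = 0`. -/
def HasInitialValue {X : Type*} [NormedAddCommGroup X] (T : ℝ) (u : ℝ → X) (u₀ : X) : Prop :=
  ∃ r : ℝ → X, ContinuousOn r (Icc 0 T) ∧ u =ᵐ[timeMeas T] r ∧ r 0 = u₀

/-!
For fixed `t` the flux `m ↦ F(·, t, |m|) m` is strictly monotone, coercive and continuous from `L^s`
to `L^{s*}`, and it is the gradient of a convex functional. The momentum equation therefore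
determines `m` from `ρ`, and `ρ ↦ div m` is a monotone relation on `L²(Ω)`. Conjugation with the
multiplication `Q` by `φ^{-1/2}`, through `ρ = Q u`, makes it monotone for the unweighted inner
product. Its range condition is proved by minimizing the potential of the flux plus
`‖h - τ Q div m‖² / (2 τ)` over `W(div; Ω)`; the Euler equation, together with an integration by
parts that characterizes `W₀^{1,s*}` by duality, yields the density.

Time enters this relation through the coefficients. Their Lipschitz continuity costs a term
`(t - r)² (b, w)` in the monotonicity inequality, where `b` is the operator value at the state `w`
and time `r`. As this term is quadratic in the lag, the implicit Euler scheme keeps bounded discrete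
velocities, and comparing each step `τ` with two steps `τ / 2` shows that the approximations
converge uniformly, with error `O(√τ)`. Demiclosedness identifies the limit, and uniform
monotonicity of the flux makes `m` strongly continuous in `L^s`, which gives measurability in time.
-/

section InnerProductInequalities

variable {H : Type*} [NormedAddCommGroup H] [InnerProductSpace ℝ H]

theorem norm_le_norm_add_smul_of_inner_nonneg {u a : H} {τ : ℝ} (hτ : 0 ≤ τ)
    (h : 0 ≤ inner ℝ a u) : ‖u‖ ≤ ‖u + τ • a‖ := by
  refine (sq_le_sq₀ (norm_nonneg _) (norm_nonneg _)).1 ?_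
  rw [norm_add_sq_real, real_inner_smul_right, real_inner_comm]
  have := mul_nonneg hτ h
  nlinarith [sq_nonneg ‖τ • a‖]

theorem norm_sq_le_norm_sq_add_two_mul_inner_sub (x y : H) :
    ‖x‖ ^ 2 ≤ ‖y‖ ^ 2 + 2 * inner ℝ (x - y) x := by
  have h := norm_sub_sq_real x (x - y)
  rw [sub_sub_cancel, real_inner_comm] at h
  linarith [sq_nonneg ‖x - y‖]

theorem norm_le_of_tendsto_inner {a : ℕ → H} {a₀ : H} {M : ℝ} (ha : ∀ k, ‖a k‖ ≤ M)
    (h : ∀ w, Tendsto (fun k => inner ℝ (a k) w) atTop (𝓝 (inner ℝ a₀ w))) : ‖a₀‖ ≤ M := by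
  have hself : ‖a₀‖ * ‖a₀‖ ≤ M * ‖a₀‖ := by
    rw [← real_inner_self_eq_norm_mul_norm]
    exact le_of_tendsto' (h a₀) fun k => (real_inner_le_norm _ _).trans
      (mul_le_mul_of_nonneg_right (ha k) (norm_nonneg _))
  rcases (norm_nonneg a₀).eq_or_lt with h0 | h0
  · exact h0 ▸ (norm_nonneg _).trans (ha 0)
  · exact le_of_mul_le_mul_right hself h0

end InnerProductInequalities

section EvolutionInclusion

variable {H : Type*} [NormedAddCommGroup H] [InnerProductSpace ℝ H]

/-- A family `G t`, `t ∈ ℝ`, of maximal monotone relations on a Hilbert space: maximality is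
encoded by the range condition `R(1 + τ G t) = H`, and the dependence on time is controlled
quadratically, as happens for subdifferentials of energies that are Lipschitz in time. -/
structure IsMaximalMonotoneFamily (G : ℝ → H → H → Prop) (K : ℝ≥0) : Prop where
  inner_nonneg : ∀ {t u a}, G t u a → 0 ≤ inner ℝ a u
  mono : ∀ {t r u a w b}, G t u a → G r w b →
    -(K * (t - r) ^ 2 * inner ℝ b w) ≤ inner ℝ (a - b) (u - w)
  range : ∀ (t τ : ℝ) (h : H), 0 < τ → ∃ u a, G t u a ∧ u + τ • a = h

/-- Closedness of the relations under strong convergence in time and in the first variable and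
boundedness in the second, which then converges weakly. -/
def IsDemiclosed (G : ℝ → H → H → Prop) : Prop :=
  ∀ (t : ℕ → ℝ) (u a : ℕ → H) (t₀ : ℝ) (u₀ : H) (M : ℝ), Tendsto t atTop (𝓝 t₀) →
    Tendsto u atTop (𝓝 u₀) → (∀ k, ‖a k‖ ≤ M) → (∀ k, G (t k) (u k) (a k)) →
    ∃ a₀, G t₀ u₀ a₀ ∧ ∀ w, Tendsto (fun k => inner ℝ (a k) w) atTop (𝓝 (inner ℝ a₀ w))

/-- `u` is a strong solution of `u' + G t u ∋ f` on `[0, T]` with bounded selection `a t` of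
`G t (u t)`; the equation `u' = f - a` is stated in weakly integrated form. -/
structure IsStrongSolution (G : ℝ → H → H → Prop) (f : ℝ → H) (T M : ℝ) (u a : ℝ → H) : Prop where
  mem : ∀ t ∈ Icc 0 T, G t (u t) (a t)
  norm_selection_le : ∀ t ∈ Icc 0 T, ‖a t‖ ≤ M
  continuousOn : ContinuousOn u (Icc 0 T)
  inner_sub_eq_integral : ∀ t ∈ Icc 0 T, ∀ w,
    inner ℝ (u t - u 0) w = ∫ r in (0 : ℝ)..t, inner ℝ (f r - a r) w

/-- `(u, a)` is an implicit Euler (Rothe) sequence with step `τ` for `u' + G t u ∋ f`. -/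
structure IsRotheSequence (G : ℝ → H → H → Prop) (f : ℝ → H) (τ : ℝ) (u a : ℕ → H) : Prop where
  mem : ∀ j : ℕ, G (j * τ) (u j) (a j)
  step : ∀ j : ℕ, u (j + 1) - u j = τ • (f ((j + 1 : ℕ) * τ) - a (j + 1))

/-- `M` bounds the states `u`, the selections `a` and the discrete velocities `f - a` of a Rothe
sequence up to time `T`. -/
structure IsRotheBound (f : ℝ → H) (τ T M : ℝ) (u a : ℕ → H) : Prop where
  state : ∀ j : ℕ, j * τ ≤ T → ‖u j‖ ≤ M
  selection : ∀ j : ℕ, j * τ ≤ T → ‖a j‖ ≤ M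
  velocity : ∀ j : ℕ, j * τ ≤ T → ‖f (j * τ) - a j‖ ≤ M

variable {G : ℝ → H → H → Prop} {K L : ℝ≥0} {f : ℝ → H} {τ T M : ℝ}

namespace IsMaximalMonotoneFamily

theorem exists_isRotheSequence (hG : IsMaximalMonotoneFamily G K) (f : ℝ → H) (hτ : 0 < τ)
    {u₀ a₀ : H} (h₀ : G 0 u₀ a₀) :
    ∃ u a : ℕ → H, IsRotheSequence G f τ u a ∧ u 0 = u₀ ∧ a 0 = a₀ := by
  choose U A hUA hsolve using fun (t : ℝ) (h : H) => hG.range t τ h hτ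
  let time : ℕ → ℝ := fun j => (j + 1 : ℕ) * τ
  let z : ℕ → H × H := fun j => Nat.rec (u₀, a₀) (fun j p =>
    (U (time j) (p.1 + τ • f (time j)), A (time j) (p.1 + τ • f (time j)))) j
  refine ⟨fun j => (z j).1, fun j => (z j).2, ⟨fun j => ?_, fun j => ?_⟩, rfl, rfl⟩
  · cases j with
    | zero => simpa [z] using h₀
    | succ j => exact hUA (time j) ((z j).1 + τ • f (time j))
  · change (z (j + 1)).1 - (z j).1 = τ • (f (time j) - (z (j + 1)).2)
    rw [smul_sub, sub_eq_sub_iff_add_eq_add, add_comm (τ • f (time j))]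
    exact hsolve (time j) ((z j).1 + τ • f (time j))

theorem neg_le_inner_sub_of_norm_sub_le (hG : IsMaximalMonotoneFamily G K) {t r δ : ℝ}
    (hδ : t - r = δ) {x a y b z : H} (hxa : G t x a) (hyb : G r y b) (ha : ‖a‖ ≤ M)
    (hy : ‖y‖ ≤ M) (hb : ‖b‖ ≤ M) (hz : ‖z - y‖ ≤ M * δ) :
    -(K * δ ^ 2 * M ^ 2 + 2 * M ^ 2 * δ) ≤ inner ℝ (a - b) (x - z) := by
  have hM : 0 ≤ M := (norm_nonneg _).trans ha
  have hmono := hG.mono hxa hyb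
  have hby : inner ℝ b y ≤ M ^ 2 := by
    rw [sq]
    exact (real_inner_le_norm _ _).trans (mul_le_mul hb hy (norm_nonneg _) hM)
  have hlag : inner ℝ (a - b) (z - y) ≤ (M + M) * (M * δ) :=
    (real_inner_le_norm _ _).trans <| mul_le_mul ((norm_sub_le _ _).trans (add_le_add ha hb)) hz
      (norm_nonneg _) (by positivity)
  have hK : K * δ ^ 2 * inner ℝ b y ≤ K * δ ^ 2 * M ^ 2 := by gcongr
  rw [hδ, ← sub_add_sub_cancel x z y, inner_add_right] at hmono
  linarith

end IsMaximalMonotoneFamily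

theorem max_one_le_of_sq_le {x y F c k : ℝ} (hc : 0 ≤ c) (hk : 0 ≤ k) (hF : 0 ≤ F)
    (h : x ^ 2 ≤ (y + c) * x + k * (F + y)) : max x 1 ≤ max y 1 + (c + k * (F + 1)) := by
  have hpos : 0 ≤ c + k * (F + 1) := by positivity
  have hX1 : 1 ≤ max y 1 := le_max_right _ _
  have hyX : y ≤ max y 1 := le_max_left _ _
  refine max_le ?_ (by linarith)
  by_cases hx : x ≤ max y 1
  · linarith
  push Not at hx
  have hFy : k * (F + y) ≤ k * ((F + 1) * x) := by gcongr; nlinarith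
  have hyx : y * x ≤ max y 1 * x := by gcongr; linarith
  exact le_of_mul_le_mul_right (a := x) (by nlinarith) (by linarith)

namespace IsRotheSequence

variable {u a w b : ℕ → H}

theorem norm_le (h : IsRotheSequence G f τ u a) (hG : IsMaximalMonotoneFamily G K) (hτ : 0 < τ)
    {F : ℝ} (hF : ∀ t, ‖f t‖ ≤ F) (j : ℕ) : ‖u j‖ ≤ ‖u 0‖ + j * τ * F := by
  induction j with
  | zero => simp
  | succ j ih =>
    set g := f ((j + 1 : ℕ) * τ)
    have hsolve : u (j + 1) + τ • a (j + 1) = u j + τ • g := by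
      rw [add_comm (u j), ← sub_eq_sub_iff_add_eq_add, ← smul_sub]
      exact h.step j
    calc ‖u (j + 1)‖ ≤ ‖u (j + 1) + τ • a (j + 1)‖ :=
          norm_le_norm_add_smul_of_inner_nonneg hτ.le (hG.inner_nonneg (h.mem (j + 1)))
      _ ≤ ‖u j‖ + τ * ‖g‖ := by
          rw [hsolve, ← Real.norm_of_nonneg hτ.le, ← norm_smul, Real.norm_of_nonneg hτ.le]
          exact norm_add_le _ _
      _ ≤ (‖u 0‖ + j * τ * F) + τ * F := by gcongr; exact hF _
      _ = ‖u 0‖ + (j + 1 : ℕ) * τ * F := by push_cast; ring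

theorem norm_velocity_sq_le (h : IsRotheSequence G f τ u a) (hG : IsMaximalMonotoneFamily G K)
    (hτ : 0 < τ) {F U : ℝ} (hF : ∀ t, ‖f t‖ ≤ F) (hL : LipschitzWith L f) {j : ℕ}
    (hU : ‖u j‖ ≤ U) :
    ‖f ((j + 1 : ℕ) * τ) - a (j + 1)‖ ^ 2 ≤
      (‖f (j * τ) - a j‖ + L * τ) * ‖f ((j + 1 : ℕ) * τ) - a (j + 1)‖
        + K * U * τ * (F + ‖f (j * τ) - a j‖) := by
  set g := f ((j + 1 : ℕ) * τ) - a (j + 1) with hg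
  set g' := f (j * τ) - a j with hg'
  set δ := f ((j + 1 : ℕ) * τ) - f (j * τ) with hδ
  have hlag : ((j + 1 : ℕ) : ℝ) * τ - j * τ = τ := by push_cast; ring
  have hmono := hG.mono (h.mem (j + 1)) (h.mem j)
  rw [hlag, h.step j, show a (j + 1) - a j = g' + δ - g by rw [hg, hg', hδ]; abel,
    real_inner_smul_right, inner_sub_left, real_inner_self_eq_norm_sq] at hmono
  have hδL : ‖δ‖ ≤ L * τ := by
    simpa only [hlag, Real.norm_of_nonneg hτ.le] using hL.norm_sub_le ((j + 1 : ℕ) * τ) (j * τ)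
  have ha : ‖a j‖ ≤ F + ‖g'‖ := by
    rw [show a j = f (j * τ) - g' by rw [hg', sub_sub_cancel]]
    exact (norm_sub_le _ _).trans (add_le_add_left (hF _) _)
  have hau : inner ℝ (a j) (u j) ≤ (F + ‖g'‖) * U :=
    (real_inner_le_norm _ _).trans
      (mul_le_mul ha hU (norm_nonneg _) ((norm_nonneg _).trans ha))
  have hδg : inner ℝ (g' + δ) g ≤ (‖g'‖ + L * τ) * ‖g‖ :=
    (real_inner_le_norm _ _).trans <| mul_le_mul_of_nonneg_right
      ((norm_add_le _ _).trans (add_le_add_right hδL _)) (norm_nonneg _)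
  have hK : K * τ ^ 2 * inner ℝ (a j) (u j) ≤ K * τ ^ 2 * ((F + ‖g'‖) * U) := by gcongr
  refine le_of_mul_le_mul_left (a := τ) ?_ hτ
  have hτδg := mul_le_mul_of_nonneg_left hδg hτ.le
  linarith

theorem max_norm_velocity_le (h : IsRotheSequence G f τ u a) (hG : IsMaximalMonotoneFamily G K)
    (hτ : 0 < τ) {F : ℝ} (hF : ∀ t, ‖f t‖ ≤ F) (hL : LipschitzWith L f) (j : ℕ) (hj : j * τ ≤ T) :
    max ‖f (j * τ) - a j‖ 1 ≤
      max ‖f 0 - a 0‖ 1 + (L + K * (‖u 0‖ + T * F) * (F + 1)) * (j * τ) := by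
  have hF0 : 0 ≤ F := (norm_nonneg _).trans (hF 0)
  induction j with
  | zero => simp
  | succ j ih =>
    have hj' : (j : ℝ) * τ ≤ T := by push_cast at hj; linarith
    have hT : 0 ≤ T := le_trans (by positivity) hj'
    have hU : ‖u j‖ ≤ ‖u 0‖ + T * F := (h.norm_le hG hτ hF j).trans (by gcongr)
    have hstep := max_one_le_of_sq_le (by positivity) (by positivity) hF0
      (h.norm_velocity_sq_le hG hτ hF hL hU)
    have := ih hj'
    push_cast at hstep ⊢
    linarith

theorem isRotheBound (h : IsRotheSequence G f τ u a) (hG : IsMaximalMonotoneFamily G K)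
    (hτ : 0 < τ) (hT : 0 ≤ T) {F : ℝ} (hF : ∀ t, ‖f t‖ ≤ F) (hL : LipschitzWith L f) :
    IsRotheBound f τ T ((‖u 0‖ + T * F) + (F + (max ‖f 0 - a 0‖ 1 +
      (L + K * (‖u 0‖ + T * F) * (F + 1)) * T))) u a := by
  have hF0 : 0 ≤ F := (norm_nonneg _).trans (hF 0)
  set V := max ‖f 0 - a 0‖ 1 + (L + K * (‖u 0‖ + T * F) * (F + 1)) * T
  have hV0 : 0 ≤ V := by positivity
  have hU0 : 0 ≤ ‖u 0‖ + T * F := by positivity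
  have hvel : ∀ j : ℕ, j * τ ≤ T → ‖f (j * τ) - a j‖ ≤ V := fun j hj =>
    (le_max_left _ _).trans ((h.max_norm_velocity_le hG hτ hF hL j hj).trans
      (by simp only [V]; gcongr))
  refine ⟨fun j hj => ?_, fun j hj => ?_, fun j hj => (hvel j hj).trans (by linarith)⟩
  · have hu : ‖u j‖ ≤ ‖u 0‖ + T * F := (h.norm_le hG hτ hF j).trans (by gcongr)
    linarith
  · have ha : ‖a j‖ ≤ F + V := by
      rw [show a j = f (j * τ) - (f (j * τ) - a j) by rw [sub_sub_cancel]]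
      exact (norm_sub_le _ _).trans (add_le_add (hF _) (hvel j hj))
    linarith

theorem norm_sub_le (h : IsRotheSequence G f τ u a) (hτ : 0 < τ) (hM : IsRotheBound f τ T M u a)
    (i n : ℕ) (hn : (i + n : ℕ) * τ ≤ T) : ‖u (i + n) - u i‖ ≤ M * (n * τ) := by
  induction n with
  | zero => simp
  | succ n ih =>
    have hprev := ih (by push_cast at hn ⊢; linarith)
    have hstep : ‖u (i + n + 1) - u (i + n)‖ ≤ τ * M := by
      rw [h.step, norm_smul, Real.norm_of_nonneg hτ.le]
      exact mul_le_mul_of_nonneg_left (hM.velocity _ hn) hτ.le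
    calc ‖u (i + (n + 1)) - u i‖ = ‖(u (i + n + 1) - u (i + n)) + (u (i + n) - u i)‖ := by
          rw [sub_add_sub_cancel, add_assoc]
      _ ≤ τ * M + M * (n * τ) := (norm_add_le _ _).trans (add_le_add hstep hprev)
      _ = M * ((n + 1 : ℕ) * τ) := by push_cast; ring

theorem sub_step_sub (h : IsRotheSequence G f τ u a) (h' : IsRotheSequence G f (τ / 2) w b)
    (j : ℕ) :
    (u (j + 1) - w (2 * j + 2)) - (u j - w (2 * j)) =
      (τ / 2) • ((f ((j + 1 : ℕ) * τ) - f ((2 * j + 1 : ℕ) * (τ / 2)))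
        - (a (j + 1) - b (2 * j + 1)) - (a (j + 1) - b (2 * j + 2))) := by
  have hfine₁ := h'.step (2 * j)
  have hfine₂ := h'.step (2 * j + 1)
  rw [show ((2 * j + 1 + 1 : ℕ) : ℝ) * (τ / 2) = (j + 1 : ℕ) * τ by push_cast; ring] at hfine₂
  rw [show (u (j + 1) - w (2 * j + 2)) - (u j - w (2 * j)) = (u (j + 1) - u j)
    - (w (2 * j + 1 + 1) - w (2 * j + 1)) - (w (2 * j + 1) - w (2 * j)) by abel, h.step, hfine₁,
    hfine₂]
  module

theorem norm_sub_halving_sq_succ_le (h : IsRotheSequence G f τ u a)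
    (h' : IsRotheSequence G f (τ / 2) w b) (hG : IsMaximalMonotoneFamily G K) (hτ : 0 < τ)
    (hL : LipschitzWith L f) (hM : IsRotheBound f τ T M u a)
    (hM' : IsRotheBound f (τ / 2) T M w b) {j : ℕ} (hj : (j + 1 : ℕ) * τ ≤ T) :
    ‖u (j + 1) - w (2 * j + 2)‖ ^ 2 ≤
      ‖u j - w (2 * j)‖ ^ 2 + (M * L + K * T * M ^ 2 + M ^ 2) * τ ^ 2 := by
  have : 0 ≤ M := (norm_nonneg _).trans (hM.state _ hj)
  have hend : ((2 * j + 2 : ℕ) : ℝ) * (τ / 2) = (j + 1 : ℕ) * τ := by push_cast; ring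
  have hj₂ : ((2 * j + 2 : ℕ) : ℝ) * (τ / 2) ≤ T := hend ▸ hj
  have hj₁ : ((2 * j + 1 : ℕ) : ℝ) * (τ / 2) ≤ T := by push_cast at hj ⊢; linarith
  have hlag : ((j + 1 : ℕ) : ℝ) * τ - (2 * j + 1 : ℕ) * (τ / 2) = τ / 2 := by push_cast; ring
  have hτT : τ ≤ T := by push_cast at hj; nlinarith [(Nat.cast_nonneg j : (0 : ℝ) ≤ j)]
  set ε := u (j + 1) - w (2 * j + 2) with hε
  have hforce : inner ℝ (f ((j + 1 : ℕ) * τ) - f ((2 * j + 1 : ℕ) * (τ / 2))) ε ≤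
      (L * (τ / 2)) * (M + M) := by
    refine (real_inner_le_norm _ _).trans (mul_le_mul ?_ ?_ (norm_nonneg _) (by positivity))
    · simpa only [hlag, Real.norm_of_nonneg (half_pos hτ).le] using
        hL.norm_sub_le ((j + 1 : ℕ) * τ) ((2 * j + 1 : ℕ) * (τ / 2))
    · exact (_root_.norm_sub_le _ _).trans (add_le_add (hM.state _ hj) (hM'.state _ hj₂))
  have hmid : -(K * (τ / 2) ^ 2 * M ^ 2 + 2 * M ^ 2 * (τ / 2)) ≤
      inner ℝ (a (j + 1) - b (2 * j + 1)) ε := by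
    refine hG.neg_le_inner_sub_of_norm_sub_le hlag (h.mem (j + 1)) (h'.mem (2 * j + 1))
      (hM.selection _ hj) (hM'.state _ hj₁) (hM'.selection _ hj₁) ?_
    simpa using h'.norm_sub_le (half_pos hτ) hM' (2 * j + 1) 1 hj₂
  have hfin : 0 ≤ inner ℝ (a (j + 1) - b (2 * j + 2)) ε := by
    have := hG.mono (h.mem (j + 1)) (h'.mem (2 * j + 2))
    rwa [hend, sub_self, zero_pow two_ne_zero, mul_zero, zero_mul, neg_zero] at this
  have hexpand := norm_sq_le_norm_sq_add_two_mul_inner_sub ε (u j - w (2 * j))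
  rw [hε, h.sub_step_sub h' j, ← hε, real_inner_smul_left, inner_sub_left, inner_sub_left]
    at hexpand
  have hsum := mul_le_mul_of_nonneg_left (add_le_add hforce
    (add_le_add (neg_le.1 hmid) (neg_nonpos.2 hfin))) hτ.le
  have hK : K * M ^ 2 * (τ * τ ^ 2 / 4) ≤ K * M ^ 2 * (T * τ ^ 2) := by
    gcongr
    nlinarith [sq_nonneg τ]
  linarith

theorem norm_sub_halving_sq_le (h : IsRotheSequence G f τ u a)
    (h' : IsRotheSequence G f (τ / 2) w b) (hG : IsMaximalMonotoneFamily G K) (hτ : 0 < τ)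
    (hL : LipschitzWith L f) (hM : IsRotheBound f τ T M u a)
    (hM' : IsRotheBound f (τ / 2) T M w b) (h0 : u 0 = w 0) {j : ℕ} (hj : j * τ ≤ T) :
    ‖u j - w (2 * j)‖ ^ 2 ≤ (M * L + K * T * M ^ 2 + M ^ 2) * T * τ := by
  have hgrow : ∀ j : ℕ, j * τ ≤ T →
      ‖u j - w (2 * j)‖ ^ 2 ≤ (M * L + K * T * M ^ 2 + M ^ 2) * (j * τ) * τ := by
    intro j
    induction j with
    | zero => intro _; simp [h0]
    | succ j ih =>
      intro hj
      have hstep := h.norm_sub_halving_sq_succ_le h' hG hτ hL hM hM' hj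
      have hprev := ih (by push_cast at hj; linarith)
      rw [mul_add_one]
      push_cast
      linarith
  have hT : 0 ≤ T := le_trans (by positivity) hj
  have hM0 : 0 ≤ M := (norm_nonneg _).trans (hM.state j hj)
  exact (hgrow j hj).trans (by gcongr)

end IsRotheSequence

end EvolutionInclusion

section Grid

/-- The index `j` of the grid interval `((j - 1) τ, j τ]` that contains `t`; it is `0` for
`t ≤ 0`. -/
noncomputable def gridIndex (τ t : ℝ) : ℕ := ⌈t / τ⌉₊

variable {τ t T : ℝ}

@[simp]
theorem gridIndex_zero (τ : ℝ) : gridIndex τ 0 = 0 := by simp [gridIndex]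

theorem gridIndex_le_iff (hτ : 0 < τ) {n : ℕ} : gridIndex τ t ≤ n ↔ t ≤ n * τ := by
  rw [gridIndex, Nat.ceil_le, div_le_iff₀ hτ]

theorem gridIndex_mono (hτ : 0 < τ) {r : ℝ} (hrt : r ≤ t) : gridIndex τ r ≤ gridIndex τ t :=
  Nat.ceil_le_ceil (div_le_div_of_nonneg_right hrt hτ.le)

theorem le_gridIndex_mul (hτ : 0 < τ) : t ≤ gridIndex τ t * τ :=
  (gridIndex_le_iff hτ).1 le_rfl

theorem gridIndex_mul_le (hτ : 0 < τ) (ht : 0 ≤ t) : gridIndex τ t * τ ≤ t + τ := by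
  rw [← le_div_iff₀ hτ, add_div, div_self hτ.ne']
  exact (Nat.ceil_lt_add_one (div_nonneg ht hτ.le)).le

theorem gridIndex_eq_succ (hτ : 0 < τ) {j : ℕ} (ht : t ∈ Ioc (j * τ) ((j + 1 : ℕ) * τ)) :
    gridIndex τ t = j + 1 :=
  le_antisymm ((gridIndex_le_iff hτ).2 ht.2)
    (not_le.1 fun h => ht.1.not_ge ((gridIndex_le_iff hτ).1 h))

theorem exists_two_mul_gridIndex_eq (hτ : 0 < τ) (t : ℝ) :
    ∃ n ≤ 1, 2 * gridIndex τ t = gridIndex (τ / 2) t + n := by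
  have hle : gridIndex (τ / 2) t ≤ 2 * gridIndex τ t := by
    rw [gridIndex_le_iff (half_pos hτ)]
    push_cast
    linarith [le_gridIndex_mul hτ (t := t)]
  have hlt : gridIndex τ t ≤ (gridIndex (τ / 2) t + 1) / 2 := by
    rw [gridIndex_le_iff hτ]
    have hdiv : gridIndex (τ / 2) t ≤ 2 * ((gridIndex (τ / 2) t + 1) / 2) := by omega
    have := (gridIndex_le_iff (half_pos hτ)).1 hdiv
    push_cast at this ⊢
    linarith
  exact ⟨2 * gridIndex τ t - gridIndex (τ / 2) t, by omega, by omega⟩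

theorem gridIndex_mul_le_of_mem_Icc (hT : 0 < T) (k : ℕ) (ht : t ∈ Icc 0 T) :
    gridIndex (T / 2 ^ k) t * (T / 2 ^ k) ≤ T := by
  have hτ : 0 < T / 2 ^ k := by positivity
  have hend : ((2 ^ k : ℕ) : ℝ) * (T / 2 ^ k) = T := by push_cast; field_simp
  have hidx : gridIndex (T / 2 ^ k) t ≤ 2 ^ k := (gridIndex_le_iff hτ).2 (hend.symm ▸ ht.2)
  calc gridIndex (T / 2 ^ k) t * (T / 2 ^ k) ≤ (2 ^ k : ℕ) * (T / 2 ^ k) := by gcongr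
    _ = T := hend

theorem tendsto_div_two_pow (T : ℝ) : Tendsto (fun k : ℕ => T / 2 ^ k) atTop (𝓝 0) :=
  tendsto_const_nhds.div_atTop (tendsto_pow_atTop_atTop_of_one_lt one_lt_two)

theorem tendsto_gridIndex_mul (hT : 0 < T) (ht : 0 ≤ t) :
    Tendsto (fun k : ℕ => gridIndex (T / 2 ^ k) t * (T / 2 ^ k)) atTop (𝓝 t) := by
  have hτ : ∀ k : ℕ, 0 < T / 2 ^ k := fun k => by positivity
  exact tendsto_of_tendsto_of_tendsto_of_le_of_le tendsto_const_nhds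
    (by simpa using (tendsto_div_two_pow T).const_add t) (fun k => le_gridIndex_mul (hτ k))
    (fun k => gridIndex_mul_le (hτ k) ht)

theorem measurable_comp_gridIndex {β : Type*} [MeasurableSpace β] (γ : ℕ → β) (τ : ℝ) :
    Measurable fun r => γ (gridIndex τ r) :=
  measurable_from_nat.comp (Nat.measurable_ceil.comp (measurable_id.div_const τ))

variable {E : Type*} [NormedAddCommGroup E] [NormedSpace ℝ E] [CompleteSpace E] {S γ : ℕ → E}

theorem integral_comp_gridIndex (hτ : 0 < τ) (hS : ∀ j, S (j + 1) - S j = τ • γ (j + 1)) (j : ℕ) :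
    IntervalIntegrable (fun r => γ (gridIndex τ r)) volume 0 (j * τ) ∧
      ∫ r in (0 : ℝ)..(j * τ), γ (gridIndex τ r) = S j - S 0 := by
  induction j with
  | zero => simp
  | succ j ih =>
    have hle : (j : ℝ) * τ ≤ (j + 1 : ℕ) * τ := by gcongr; simp
    have hconst : ∀ r ∈ uIoc ((j : ℝ) * τ) ((j + 1 : ℕ) * τ), γ (j + 1) = γ (gridIndex τ r) :=
      fun r hr => by rw [gridIndex_eq_succ hτ (uIoc_of_le hle ▸ hr)]
    have hcell : IntervalIntegrable (fun r => γ (gridIndex τ r)) volume (j * τ) ((j + 1 : ℕ) * τ) :=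
      (intervalIntegrable_const (c := γ (j + 1))).congr hconst
    refine ⟨ih.1.trans hcell, ?_⟩
    rw [← intervalIntegral.integral_add_adjacent_intervals ih.1 hcell, ih.2,
      ← intervalIntegral.integral_congr_ae (ae_of_all _ hconst), intervalIntegral.integral_const,
      show ((j + 1 : ℕ) : ℝ) * τ - j * τ = τ by push_cast; ring, ← hS]
    abel

theorem norm_sub_integral_comp_gridIndex_le (hτ : 0 < τ)
    (hS : ∀ j, S (j + 1) - S j = τ • γ (j + 1)) (ht : 0 ≤ t) :
    ‖(S (gridIndex τ t) - S 0) - ∫ r in (0 : ℝ)..t, γ (gridIndex τ r)‖ ≤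
      ‖γ (gridIndex τ t)‖ * τ := by
  have htn := le_gridIndex_mul hτ (t := t)
  obtain ⟨hinteg, hI⟩ := integral_comp_gridIndex hτ hS (gridIndex τ t)
  have hinteg' : IntervalIntegrable (fun r => γ (gridIndex τ r)) volume 0 t :=
    hinteg.mono_set (uIcc_subset_uIcc_left (uIcc_of_le (ht.trans htn) ▸ ⟨ht, htn⟩))
  have hconst : ∀ r ∈ uIoc t (gridIndex τ t * τ), ‖γ (gridIndex τ r)‖ ≤ ‖γ (gridIndex τ t)‖ := by
    intro r hr
    rw [uIoc_of_le htn] at hr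
    rw [le_antisymm ((gridIndex_le_iff hτ).2 hr.2) (gridIndex_mono hτ hr.1.le)]
  rw [← hI, intervalIntegral.integral_interval_sub_left hinteg hinteg']
  refine (intervalIntegral.norm_integral_le_of_norm_le_const hconst).trans ?_
  rw [abs_of_nonneg (sub_nonneg.2 htn)]
  gcongr
  linarith [gridIndex_mul_le hτ ht]

end Grid

section RotheLimit

variable {H : Type*} [NormedAddCommGroup H] [InnerProductSpace ℝ H]

/-- Rothe sequences with the dyadic steps `T / 2 ^ k`, a common initial value and a common
bound. -/
structure IsDyadicRothe (G : ℝ → H → H → Prop) (f : ℝ → H) (T M : ℝ) (u₀ : H)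
    (u a : ℕ → ℕ → H) : Prop where
  rothe : ∀ k, IsRotheSequence G f (T / 2 ^ k) (u k) (a k)
  initial : ∀ k, u k 0 = u₀
  bound : ∀ k, IsRotheBound f (T / 2 ^ k) T M (u k) (a k)

variable {G : ℝ → H → H → Prop} {K L : ℝ≥0} {f : ℝ → H} {T M : ℝ} {u₀ : H}

theorem IsMaximalMonotoneFamily.exists_isDyadicRothe (hG : IsMaximalMonotoneFamily G K)
    (hT : 0 < T) {F : ℝ} (hF : ∀ t, ‖f t‖ ≤ F) (hL : LipschitzWith L f) {a₀ : H}
    (h₀ : G 0 u₀ a₀) : ∃ M u a, IsDyadicRothe G f T M u₀ u a := by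
  have hτ : ∀ k : ℕ, 0 < T / 2 ^ k := fun k => by positivity
  choose u a hrothe hu ha using fun k => hG.exists_isRotheSequence f (hτ k) h₀
  have hbound := fun k => (hrothe k).isRotheBound hG (hτ k) hT.le hF hL
  simp only [hu, ha] at hbound
  exact ⟨_, u, a, hrothe, hu, hbound⟩

namespace IsDyadicRothe

variable {u a : ℕ → ℕ → H}

theorem norm_interpolant_sub_succ_le (h : IsDyadicRothe G f T M u₀ u a)
    (hG : IsMaximalMonotoneFamily G K) (hL : LipschitzWith L f) (hT : 0 < T) {t : ℝ}
    (ht : t ∈ Icc 0 T) (k : ℕ) :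
    ‖u k (gridIndex (T / 2 ^ k) t) - u (k + 1) (gridIndex (T / 2 ^ (k + 1)) t)‖ ≤
      √((M * L + K * T * M ^ 2 + M ^ 2) * T * (T / 2 ^ k)) + M * (T / 2 ^ k) := by
  have hτ : 0 < T / 2 ^ k := by positivity
  have hhalf : T / 2 ^ (k + 1) = T / 2 ^ k / 2 := by rw [pow_succ, div_mul_eq_div_div]
  have hfine := h.rothe (k + 1)
  have hbound := h.bound (k + 1)
  have hM : 0 ≤ M := (norm_nonneg _).trans ((h.bound k).state 0 (by simpa using hT.le))
  rw [hhalf] at hfine hbound ⊢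
  obtain ⟨n, hn, hidx⟩ := exists_two_mul_gridIndex_eq hτ t
  have hend := gridIndex_mul_le_of_mem_Icc hT k ht
  set j := gridIndex (T / 2 ^ k) t
  set i := gridIndex (T / 2 ^ k / 2) t
  have hcompare : ‖u k j - u (k + 1) (2 * j)‖ ≤
      √((M * L + K * T * M ^ 2 + M ^ 2) * T * (T / 2 ^ k)) :=
    Real.le_sqrt_of_sq_le ((h.rothe k).norm_sub_halving_sq_le hfine hG hτ hL (h.bound k) hbound
      (by rw [h.initial, h.initial]) hend)
  have hlag : ‖u (k + 1) (2 * j) - u (k + 1) i‖ ≤ M * (T / 2 ^ k) := by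
    rw [hidx]
    refine (hfine.norm_sub_le (half_pos hτ) hbound i n ?_).trans ?_
    · rw [← hidx]
      push_cast
      linarith
    · have : (n : ℝ) ≤ 1 := mod_cast hn
      gcongr
      nlinarith
  rw [← sub_add_sub_cancel _ (u (k + 1) (2 * j))]
  exact (norm_add_le _ _).trans (add_le_add hcompare hlag)

theorem cauchySeq_interpolant (h : IsDyadicRothe G f T M u₀ u a)
    (hG : IsMaximalMonotoneFamily G K) (hL : LipschitzWith L f) (hT : 0 < T) {t : ℝ}
    (ht : t ∈ Icc 0 T) : CauchySeq fun k => u k (gridIndex (T / 2 ^ k) t) := by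
  have hM : 0 ≤ M := (norm_nonneg _).trans ((h.bound 0).state 0 (by simpa using hT.le))
  set C := M * L + K * T * M ^ 2 + M ^ 2
  have hC : 0 ≤ C := by positivity
  set q := √(1 / 2 : ℝ)
  have hq : q ^ 2 = 1 / 2 := Real.sq_sqrt (by norm_num)
  have hq0 : 0 ≤ q := Real.sqrt_nonneg _
  have hq1 : q < 1 := by nlinarith
  have hstep : ∀ k : ℕ, T / 2 ^ k = T * (q ^ k) ^ 2 := fun k => by
    rw [pow_right_comm, hq, div_pow, one_pow, mul_one_div]
  refine cauchySeq_of_le_geometric q (√C * T + M * T) hq1 fun k => ?_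
  rw [dist_eq_norm]
  refine (h.norm_interpolant_sub_succ_le hG hL hT ht k).trans ?_
  rw [hstep, show C * T * (T * (q ^ k) ^ 2) = C * (T * q ^ k) ^ 2 by ring, Real.sqrt_mul hC,
    Real.sqrt_sq (by positivity), add_mul, mul_assoc, mul_assoc]
  gcongr
  exact pow_le_of_le_one (by positivity) (pow_le_one₀ hq0 hq1.le) two_ne_zero

theorem norm_interpolant_sub_le (h : IsDyadicRothe G f T M u₀ u a) (hT : 0 < T) {r t : ℝ}
    (ht : t ∈ Icc 0 T) (hrt : r ≤ t) (k : ℕ) :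
    ‖u k (gridIndex (T / 2 ^ k) t) - u k (gridIndex (T / 2 ^ k) r)‖ ≤
      M * (t - r + T / 2 ^ k) := by
  have hτ : 0 < T / 2 ^ k := by positivity
  have hM : 0 ≤ M := (norm_nonneg _).trans ((h.bound k).state 0 (by simpa using hT.le))
  obtain ⟨n, hn⟩ := Nat.exists_eq_add_of_le (gridIndex_mono hτ hrt)
  have hend := gridIndex_mul_le_of_mem_Icc hT k ht
  have hupper := gridIndex_mul_le hτ ht.1
  rw [hn] at hend hupper ⊢
  refine ((h.rothe k).norm_sub_le hτ (h.bound k) _ n hend).trans ?_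
  gcongr
  push_cast at hupper
  linarith [le_gridIndex_mul hτ (t := r)]

/-- Pointwise limits of the piecewise constant interpolants of a dyadic Rothe scheme. -/
structure IsLimit (u a : ℕ → ℕ → H) (T : ℝ) (v b : ℝ → H) : Prop where
  tendsto : ∀ t ∈ Icc 0 T, Tendsto (fun k => u k (gridIndex (T / 2 ^ k) t)) atTop (𝓝 (v t))
  tendsto_inner : ∀ t ∈ Icc 0 T, ∀ w,
    Tendsto (fun k => inner ℝ (a k (gridIndex (T / 2 ^ k) t)) w) atTop (𝓝 (inner ℝ (b t) w))

theorem exists_isLimit [CompleteSpace H] (h : IsDyadicRothe G f T M u₀ u a)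
    (hG : IsMaximalMonotoneFamily G K) (hcl : IsDemiclosed G) (hL : LipschitzWith L f)
    (hT : 0 < T) : ∃ v b, IsLimit u a T v b ∧ ∀ t ∈ Icc 0 T, G t (v t) (b t) := by
  have hlimit : ∀ t ∈ Icc 0 T, ∃ x b,
      Tendsto (fun k => u k (gridIndex (T / 2 ^ k) t)) atTop (𝓝 x) ∧ G t x b ∧
        ∀ w, Tendsto (fun k => inner ℝ (a k (gridIndex (T / 2 ^ k) t)) w) atTop
          (𝓝 (inner ℝ b w)) := by
    intro t ht
    obtain ⟨x, hx⟩ := cauchySeq_tendsto_of_complete (h.cauchySeq_interpolant hG hL hT ht)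
    obtain ⟨b, hb⟩ := hcl _ _ _ t x M (tendsto_gridIndex_mul hT ht.1) hx
      (fun k => (h.bound k).selection _ (gridIndex_mul_le_of_mem_Icc hT k ht))
      (fun k => (h.rothe k).mem _)
    exact ⟨x, b, hx, hb⟩
  choose! v b hv hG' hb using hlimit
  exact ⟨v, b, ⟨hv, hb⟩, hG'⟩

variable {v b : ℝ → H}

theorem IsLimit.norm_sub_le (hlim : IsLimit u a T v b) (h : IsDyadicRothe G f T M u₀ u a)
    (hT : 0 < T) {r t : ℝ} (hr : r ∈ Icc 0 T) (ht : t ∈ Icc 0 T) (hrt : r ≤ t) :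
    ‖v t - v r‖ ≤ M * (t - r) := by
  have hbound : Tendsto (fun k : ℕ => M * (t - r + T / 2 ^ k)) atTop (𝓝 (M * (t - r))) := by
    simpa using ((tendsto_div_two_pow T).const_add (t - r)).const_mul M
  exact le_of_tendsto_of_tendsto' ((hlim.tendsto t ht).sub (hlim.tendsto r hr)).norm hbound
    (h.norm_interpolant_sub_le hT ht hrt)

theorem IsLimit.continuousOn (hlim : IsLimit u a T v b) (h : IsDyadicRothe G f T M u₀ u a)
    (hT : 0 < T) : ContinuousOn v (Icc 0 T) := by
  have hM : 0 ≤ M := (norm_nonneg _).trans ((h.bound 0).state 0 (by simpa using hT.le))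
  refine (LipschitzOnWith.of_dist_le_mul (K := M.toNNReal) fun t ht r hr => ?_).continuousOn
  rw [Real.coe_toNNReal M hM, dist_eq_norm, Real.dist_eq]
  rcases le_total r t with hrt | htr
  · rw [abs_of_nonneg (sub_nonneg.2 hrt)]
    exact hlim.norm_sub_le h hT hr ht hrt
  · rw [norm_sub_rev, abs_sub_comm, abs_of_nonneg (sub_nonneg.2 htr)]
    exact hlim.norm_sub_le h hT ht hr htr

theorem IsLimit.tendsto_integral (hlim : IsLimit u a T v b) (h : IsDyadicRothe G f T M u₀ u a)
    (hT : 0 < T) (hf : Continuous f) {t : ℝ} (ht : t ∈ Icc 0 T) (w : H) :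
    Tendsto (fun k => ∫ r in (0 : ℝ)..t, inner ℝ (f (gridIndex (T / 2 ^ k) r * (T / 2 ^ k))
      - a k (gridIndex (T / 2 ^ k) r)) w) atTop (𝓝 (∫ r in (0 : ℝ)..t, inner ℝ (f r - b r) w)) := by
  have hsub : ∀ r ∈ uIoc 0 t, r ∈ Icc 0 T := fun r hr =>
    have hr' : r ∈ Ioc 0 t := uIoc_of_le ht.1 ▸ hr
    ⟨hr'.1.le, hr'.2.trans ht.2⟩
  refine intervalIntegral.tendsto_integral_filter_of_dominated_convergence
    (fun _ => M * ‖w‖) (Eventually.of_forall fun k => ?_) (Eventually.of_forall fun k => ?_)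
    intervalIntegrable_const (ae_of_all _ fun r hr => ?_)
  · exact (measurable_comp_gridIndex (fun j : ℕ => inner ℝ (f (j * (T / 2 ^ k)) - a k j) w)
      (T / 2 ^ k)).aestronglyMeasurable
  · refine ae_of_all _ fun r hr => (norm_inner_le_norm _ _).trans ?_
    gcongr
    exact (h.bound k).velocity _ (gridIndex_mul_le_of_mem_Icc hT k (hsub r hr))
  · simp only [inner_sub_left]
    exact (((hf.tendsto r).comp (tendsto_gridIndex_mul hT (hsub r hr).1)).inner
      tendsto_const_nhds).sub (hlim.tendsto_inner r (hsub r hr) w)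

theorem IsLimit.inner_sub_eq_integral (hlim : IsLimit u a T v b)
    (h : IsDyadicRothe G f T M u₀ u a) (hT : 0 < T) (hf : Continuous f) {t : ℝ}
    (ht : t ∈ Icc 0 T) (w : H) :
    inner ℝ (v t - u₀) w = ∫ r in (0 : ℝ)..t, inner ℝ (f r - b r) w := by
  have herror : Tendsto (fun k => inner ℝ (u k (gridIndex (T / 2 ^ k) t) - u₀) w
      - ∫ r in (0 : ℝ)..t, inner ℝ (f (gridIndex (T / 2 ^ k) r * (T / 2 ^ k))
        - a k (gridIndex (T / 2 ^ k) r)) w) atTop (𝓝 0) := by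
    refine squeeze_zero_norm (a := fun k : ℕ => (M * ‖w‖) * (T / 2 ^ k)) (fun k => ?_)
      (by simpa using (tendsto_div_two_pow T).const_mul (M * ‖w‖))
    have hτ : 0 < T / 2 ^ k := by positivity
    have hdist := norm_sub_integral_comp_gridIndex_le hτ (S := fun j => inner ℝ (u k j) w)
      (γ := fun j : ℕ => inner ℝ (f (j * (T / 2 ^ k)) - a k j) w)
      (fun j => by rw [← inner_sub_left, (h.rothe k).step, real_inner_smul_left, smul_eq_mul]) ht.1
    rw [h.initial, ← inner_sub_left] at hdist
    refine hdist.trans (mul_le_mul_of_nonneg_right ((norm_inner_le_norm _ _).trans ?_) hτ.le)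
    gcongr
    exact (h.bound k).velocity _ (gridIndex_mul_le_of_mem_Icc hT k ht)
  have hdiff := ((((hlim.tendsto t ht).sub_const u₀).inner (tendsto_const_nhds (x := w))).sub
    (hlim.tendsto_integral h hT hf ht w))
  exact sub_eq_zero.1 (tendsto_nhds_unique hdiff herror)

end IsDyadicRothe

theorem IsMaximalMonotoneFamily.exists_isStrongSolution [CompleteSpace H]
    (hG : IsMaximalMonotoneFamily G K) (hcl : IsDemiclosed G) (hT : 0 < T) {F : ℝ}
    (hF : ∀ t, ‖f t‖ ≤ F) (hL : LipschitzWith L f) {a₀ : H} (h₀ : G 0 u₀ a₀) :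
    ∃ v b M, v 0 = u₀ ∧ IsStrongSolution G f T M v b := by
  obtain ⟨M, u, a, h⟩ := hG.exists_isDyadicRothe hT hF hL h₀
  obtain ⟨v, b, hlim, hmem⟩ := h.exists_isLimit hG hcl hL hT
  have hv₀ : v 0 = u₀ := by
    refine tendsto_nhds_unique (hlim.tendsto 0 ⟨le_rfl, hT.le⟩) ?_
    simp [h.initial]
  refine ⟨v, b, M, hv₀, hmem, fun t ht => ?_, hlim.continuousOn h hT, fun t ht w => ?_⟩
  · exact norm_le_of_tendsto_inner
      (fun k => (h.bound k).selection _ (gridIndex_mul_le_of_mem_Icc hT k ht))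
      (hlim.tendsto_inner t ht)
  · exact hv₀.symm ▸ hlim.inner_sub_eq_integral h hT hL.continuous ht w

end RotheLimit

section PowerInequalities

variable {E : Type*} [NormedAddCommGroup E] [InnerProductSpace ℝ E] {β : ℝ}

theorem half_mul_norm_sub_sq_le_inner_rpow_smul_sub (hβ : 0 ≤ β) (ξ η : E) :
    (‖ξ‖ ^ β + ‖η‖ ^ β) / 2 * ‖ξ - η‖ ^ 2 ≤
      inner ℝ (‖ξ‖ ^ β • ξ - ‖η‖ ^ β • η) (ξ - η) := by
  have hmono : 0 ≤ (‖ξ‖ ^ β - ‖η‖ ^ β) * (‖ξ‖ ^ 2 - ‖η‖ ^ 2) := by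
    rcases le_total ‖ξ‖ ‖η‖ with h | h
    · exact mul_nonneg_of_nonpos_of_nonpos
        (sub_nonpos.2 (Real.rpow_le_rpow (norm_nonneg _) h hβ)) (sub_nonpos.2 (by gcongr))
    · exact mul_nonneg
        (sub_nonneg.2 (Real.rpow_le_rpow (norm_nonneg _) h hβ)) (sub_nonneg.2 (by gcongr))
  rw [inner_sub_left, inner_sub_right, inner_sub_right, real_inner_smul_left, real_inner_smul_left,
    real_inner_smul_left, real_inner_smul_left, real_inner_self_eq_norm_sq,
    real_inner_self_eq_norm_sq, real_inner_comm ξ η, norm_sub_sq_real]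
  linarith

theorem rpow_sub_rpow_mul_le {x y : ℝ} (hβ : 0 ≤ β) (hy : 0 ≤ y) (hxy : y ≤ x) :
    (x ^ β - y ^ β) * y ≤ (β + 1) * x ^ β * (x - y) := by
  rcases hy.eq_or_lt with rfl | hy
  · simp only [mul_zero, sub_zero]
    have := Real.rpow_nonneg hxy β
    positivity
  have hx : 0 < x := hy.trans_le hxy
  have hxβ : 0 < x ^ β * x := mul_pos (Real.rpow_pos_of_pos hx β) hx
  have hbernoulli : 1 + (β + 1) * (y / x - 1) ≤ (y ^ β * y) / (x ^ β * x) := by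
    have := one_add_mul_self_le_rpow_one_add (s := y / x - 1) (p := β + 1)
      (by linarith [div_pos hy hx]) (by linarith)
    rwa [add_sub_cancel, Real.div_rpow hy.le hx.le, Real.rpow_add_one hx.ne',
      Real.rpow_add_one hy.ne'] at this
  have hmul : (1 + (β + 1) * (y / x - 1)) * (x ^ β * x) =
      x ^ β * x + (β + 1) * (y - x) * x ^ β := by
    field_simp
  rw [le_div_iff₀ hxβ, hmul] at hbernoulli
  nlinarith

theorem norm_rpow_smul_sub_le_of_le (hβ : 0 ≤ β) {ξ η : E} (h : ‖η‖ ≤ ‖ξ‖) :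
    ‖‖ξ‖ ^ β • ξ - ‖η‖ ^ β • η‖ ≤ (β + 2) * ‖ξ‖ ^ β * ‖ξ - η‖ := by
  have hsplit : ‖ξ‖ ^ β • ξ - ‖η‖ ^ β • η = ‖ξ‖ ^ β • (ξ - η) + (‖ξ‖ ^ β - ‖η‖ ^ β) • η := by
    module
  have hξ := Real.rpow_nonneg (norm_nonneg ξ) β
  calc ‖‖ξ‖ ^ β • ξ - ‖η‖ ^ β • η‖
      ≤ ‖ξ‖ ^ β * ‖ξ - η‖ + (‖ξ‖ ^ β - ‖η‖ ^ β) * ‖η‖ := by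
        rw [hsplit]
        refine (norm_add_le _ _).trans ?_
        rw [norm_smul, norm_smul, Real.norm_of_nonneg hξ, Real.norm_of_nonneg
          (sub_nonneg.2 (Real.rpow_le_rpow (norm_nonneg _) h hβ))]
    _ ≤ ‖ξ‖ ^ β * ‖ξ - η‖ + (β + 1) * ‖ξ‖ ^ β * ‖ξ - η‖ := by
        refine add_le_add le_rfl ((rpow_sub_rpow_mul_le hβ (norm_nonneg η) h).trans ?_)
        gcongr
        exact norm_sub_norm_le _ _
    _ = (β + 2) * ‖ξ‖ ^ β * ‖ξ - η‖ := by ring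

theorem norm_rpow_smul_sub_le (hβ : 0 ≤ β) (ξ η : E) :
    ‖‖ξ‖ ^ β • ξ - ‖η‖ ^ β • η‖ ≤ (β + 2) * (‖ξ‖ ^ β + ‖η‖ ^ β) * ‖ξ - η‖ := by
  have hξ := Real.rpow_nonneg (norm_nonneg ξ) β
  have hη := Real.rpow_nonneg (norm_nonneg η) β
  rcases le_total ‖η‖ ‖ξ‖ with h | h
  · refine (norm_rpow_smul_sub_le_of_le hβ h).trans ?_
    gcongr
    linarith
  · rw [norm_sub_rev, norm_sub_rev ξ]
    refine (norm_rpow_smul_sub_le_of_le hβ h).trans ?_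
    gcongr
    linarith

theorem rpow_norm_add_inner_le (hβ : 0 ≤ β) (ξ η : E) :
    ‖ξ‖ ^ (β + 2) / (β + 2) + inner ℝ (‖ξ‖ ^ β • ξ) (η - ξ) ≤ ‖η‖ ^ (β + 2) / (β + 2) := by
  have hconj : Real.HolderConjugate ((β + 2) / (β + 1)) (β + 2) := by
    rw [Real.holderConjugate_iff, one_lt_div (by linarith)]
    refine ⟨by linarith, ?_⟩
    field_simp
    ring
  have hyoung : ‖ξ‖ ^ (β + 1) * ‖η‖ ≤
      (‖ξ‖ ^ (β + 2) - ‖ξ‖ ^ (β + 2) / (β + 2)) + ‖η‖ ^ (β + 2) / (β + 2) := by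
    have := Real.young_inequality_of_nonneg (Real.rpow_nonneg (norm_nonneg ξ) (β + 1))
      (norm_nonneg η) hconj
    rw [← Real.rpow_mul (norm_nonneg _), mul_div_cancel₀ _ (by linarith : β + 1 ≠ 0)] at this
    convert this using 2
    field_simp
    ring
  have hsq : ‖ξ‖ ^ (β + 2) = ‖ξ‖ ^ β * ‖ξ‖ ^ 2 := by
    rw [Real.rpow_add_of_nonneg (norm_nonneg _) hβ zero_le_two, Real.rpow_ofNat]
  have hinner : inner ℝ (‖ξ‖ ^ β • ξ) η ≤ ‖ξ‖ ^ (β + 1) * ‖η‖ := by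
    rw [real_inner_smul_left, Real.rpow_add_of_nonneg (norm_nonneg _) hβ zero_le_one,
      Real.rpow_one, mul_assoc]
    gcongr
    exact real_inner_le_norm _ _
  rw [inner_sub_right, real_inner_smul_left _ ξ, real_inner_self_eq_norm_sq, ← hsq]
  linarith

theorem clarkson_norm_rpow {p : ℝ} (hp : 2 ≤ p) (ξ η : E) :
    ‖(1 / 2 : ℝ) • (ξ + η)‖ ^ p + ‖(1 / 2 : ℝ) • (ξ - η)‖ ^ p ≤ (‖ξ‖ ^ p + ‖η‖ ^ p) / 2 := by
  have hpow : ∀ x : ℝ, 0 ≤ x → (x ^ 2) ^ (p / 2) = x ^ p := fun x hx => by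
    rw [← Real.rpow_natCast_mul hx, Nat.cast_ofNat, mul_div_cancel₀ _ two_ne_zero]
  have hparallelogram : ‖(1 / 2 : ℝ) • (ξ + η)‖ ^ 2 + ‖(1 / 2 : ℝ) • (ξ - η)‖ ^ 2 =
      (1 / 2) * ‖ξ‖ ^ 2 + (1 / 2) * ‖η‖ ^ 2 := by
    have := parallelogram_law_with_norm ℝ ξ η
    rw [norm_smul, norm_smul, Real.norm_of_nonneg (by norm_num)]
    linarith
  have hp2 : 1 ≤ p / 2 := by linarith
  have hsuper := Real.add_rpow_le_rpow_add (sq_nonneg ‖(1 / 2 : ℝ) • (ξ + η)‖)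
    (sq_nonneg ‖(1 / 2 : ℝ) • (ξ - η)‖) hp2
  have hconvex := (convexOn_rpow hp2).2 (mem_Ici.2 (sq_nonneg ‖ξ‖)) (mem_Ici.2 (sq_nonneg ‖η‖))
    one_half_pos.le one_half_pos.le (add_halves 1)
  simp only [smul_eq_mul] at hconvex
  rw [hparallelogram] at hsuper
  rw [hpow _ (norm_nonneg _), hpow _ (norm_nonneg _)] at hsuper hconvex
  linarith

theorem norm_sub_half_rpow_le {V : Type*} [SeminormedAddCommGroup V] (hβ : 0 ≤ β) (ξ η : V) :
    (‖ξ - η‖ / 2) ^ β ≤ ‖ξ‖ ^ β + ‖η‖ ^ β := by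
  have hξ := Real.rpow_nonneg (norm_nonneg ξ) β
  have hη := Real.rpow_nonneg (norm_nonneg η) β
  have htri := norm_sub_le ξ η
  rcases le_total ‖η‖ ‖ξ‖ with h | h
  · have := Real.rpow_le_rpow (by positivity) (by linarith : ‖ξ - η‖ / 2 ≤ ‖ξ‖) hβ
    linarith
  · have := Real.rpow_le_rpow (by positivity) (by linarith : ‖ξ - η‖ / 2 ≤ ‖η‖) hβ
    linarith

theorem rpow_le_one_add_rpow {x γ : ℝ} (hx : 0 ≤ x) (hβ : 0 ≤ β) (h : β ≤ γ) :
    x ^ β ≤ 1 + x ^ γ := by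
  rcases le_total x 1 with hx1 | hx1
  · linarith [Real.rpow_le_one hx hx1 hβ, Real.rpow_nonneg hx γ]
  · linarith [Real.rpow_le_rpow_of_exponent_le hx1 h]

end PowerInequalities

namespace ForchheimerExponents

variable {N : ℕ} (e : ForchheimerExponents N) {E : Type*} [NormedAddCommGroup E]
  [InnerProductSpace ℝ E]

/-- The largest exponent `α_N`. -/
noncomputable def top : ℝ := e.α (Fin.last N)

theorem top_pos : 0 < e.top := by
  rw [top, ← e.zero]
  exact e.strictMono (Fin.lt_def.2 e.one_le)

theorem zero_ne_last (e : ForchheimerExponents N) : (0 : Fin (N + 1)) ≠ Fin.last N :=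
  (Fin.lt_def.2 e.one_le : (0 : Fin (N + 1)) < Fin.last N).ne

theorem α_nonneg (i : Fin (N + 1)) : 0 ≤ e.α i :=
  e.zero ▸ e.strictMono.monotone (Fin.zero_le i)

theorem α_le_top (i : Fin (N + 1)) : e.α i ≤ e.top := e.strictMono.monotone (Fin.le_last i)

/-- The flux `F(|ξ|) ξ` of the polynomial `F` with coefficients `c`. -/
noncomputable def flux (c : Fin (N + 1) → ℝ) (ξ : E) : E := e.poly c ‖ξ‖ • ξ

/-- The convex function whose gradient is the flux. -/
noncomputable def potential {V : Type*} [NormedAddCommGroup V] (c : Fin (N + 1) → ℝ) (ξ : V) : ℝ :=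
  ∑ i, c i * (‖ξ‖ ^ (e.α i + 2) / (e.α i + 2))

theorem flux_eq_sum (c : Fin (N + 1) → ℝ) (ξ : E) :
    e.flux c ξ = ∑ i, c i • (‖ξ‖ ^ e.α i • ξ) := by
  simp only [flux, poly, Finset.sum_smul, smul_smul]

theorem flux_sub_flux (c : Fin (N + 1) → ℝ) (ξ η : E) :
    e.flux c ξ - e.flux c η = ∑ i, c i • (‖ξ‖ ^ e.α i • ξ - ‖η‖ ^ e.α i • η) := by
  simp only [flux_eq_sum, ← Finset.sum_sub_distrib, smul_sub]

/-- Values of the coefficients `a_i` that respect the bounds of the problem: all of them lie in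
`[0, up]` and the first and last are at least `lo`. -/
structure Admissible (lo up : ℝ) (c : Fin (N + 1) → ℝ) : Prop where
  nonneg : ∀ i, 0 ≤ c i
  le : ∀ i, c i ≤ up
  zero : lo ≤ c 0
  last : lo ≤ c (Fin.last N)

variable {lo up δ : ℝ} {c c' : Fin (N + 1) → ℝ}

theorem lo_mul_add_le_sum (e : ForchheimerExponents N) (hc : Admissible lo up c)
    {x : Fin (N + 1) → ℝ} (hx : ∀ i, 0 ≤ x i) :
    lo * x 0 + lo * x (Fin.last N) ≤ ∑ i, c i * x i := by
  calc lo * x 0 + lo * x (Fin.last N) ≤ c 0 * x 0 + c (Fin.last N) * x (Fin.last N) :=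
        add_le_add (mul_le_mul_of_nonneg_right hc.zero (hx _))
          (mul_le_mul_of_nonneg_right hc.last (hx _))
    _ = ∑ i ∈ {0, Fin.last N}, c i * x i :=
      (Finset.sum_pair (f := fun i => c i * x i) e.zero_ne_last).symm
    _ ≤ ∑ i, c i * x i := Finset.sum_le_sum_of_subset_of_nonneg (Finset.subset_univ _)
      fun i _ _ => mul_nonneg (hc.nonneg i) (hx i)

theorem inner_flux_self (ξ : E) :
    inner ℝ (e.flux c ξ) ξ = ∑ i, c i * (‖ξ‖ ^ e.α i * ‖ξ‖ ^ 2) := by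
  simp only [flux_eq_sum, sum_inner, real_inner_smul_left, real_inner_self_eq_norm_sq]

theorem lo_mul_le_inner_flux_self (hc : Admissible lo up c) (ξ : E) :
    lo * ((1 + ‖ξ‖ ^ e.top) * ‖ξ‖ ^ 2) ≤ inner ℝ (e.flux c ξ) ξ := by
  have hends := e.lo_mul_add_le_sum hc (x := fun i => ‖ξ‖ ^ e.α i * ‖ξ‖ ^ 2)
    fun i => by positivity
  simp only [e.zero, Real.rpow_zero] at hends
  rw [inner_flux_self, top]
  linarith

theorem inner_flux_self_nonneg (hlo : 0 < lo) (hc : Admissible lo up c) (ξ : E) :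
    0 ≤ inner ℝ (e.flux c ξ) ξ :=
  le_trans (by positivity) (e.lo_mul_le_inner_flux_self hc ξ)

theorem norm_sum_smul_le {y : ℝ} {x : Fin (N + 1) → E} (hc : ∀ i, |c i| ≤ δ)
    (hx : ∀ i, ‖x i‖ ≤ y) : ‖∑ i, c i • x i‖ ≤ δ * (N + 1) * y := by
  have hδ : 0 ≤ δ := (abs_nonneg _).trans (hc 0)
  calc ‖∑ i, c i • x i‖ ≤ ∑ _i : Fin (N + 1), δ * y := norm_sum_le_of_le _ fun i _ => by
        rw [norm_smul]
        exact mul_le_mul (hc i) (hx i) (norm_nonneg _) hδ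
    _ = δ * (N + 1) * y := by
        rw [Finset.sum_const, Finset.card_univ, Fintype.card_fin, nsmul_eq_mul]
        push_cast
        ring

theorem norm_flux_sub_coeff_le (hδ : ∀ i, |c i - c' i| ≤ δ) (η : E) :
    ‖e.flux c η - e.flux c' η‖ ≤ δ * (N + 1) * ((1 + ‖η‖ ^ e.top) * ‖η‖) := by
  simp only [flux_eq_sum, ← Finset.sum_sub_distrib, ← sub_smul]
  refine norm_sum_smul_le hδ fun i => ?_
  rw [norm_smul, Real.norm_of_nonneg (Real.rpow_nonneg (norm_nonneg _) _)]
  gcongr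
  exact rpow_le_one_add_rpow (norm_nonneg _) (e.α_nonneg i) (e.α_le_top i)

theorem norm_flux_le (hc : Admissible lo up c) (ξ : E) :
    ‖e.flux c ξ‖ ≤ up * (N + 1) * ((1 + ‖ξ‖ ^ e.top) * ‖ξ‖) := by
  have hzero : e.flux 0 ξ = 0 := by simp [flux, poly]
  have h := e.norm_flux_sub_coeff_le (c := c) (c' := 0) (δ := up) (fun i => by
    simpa [abs_of_nonneg (hc.nonneg i)] using hc.le i) ξ
  rwa [hzero, sub_zero] at h

theorem norm_flux_sub_le (hc : Admissible lo up c) (ξ η : E) :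
    ‖e.flux c ξ - e.flux c η‖ ≤ up * (N + 1) *
      ((e.top + 2) * (2 * (1 + ‖ξ‖ ^ e.top + ‖η‖ ^ e.top)) * ‖ξ - η‖) := by
  rw [flux_sub_flux]
  refine norm_sum_smul_le (fun i => (abs_of_nonneg (hc.nonneg i)).trans_le (hc.le i)) fun i => ?_
  have htop := e.top_pos
  have hξ := rpow_le_one_add_rpow (norm_nonneg ξ) (e.α_nonneg i) (e.α_le_top i)
  have hη := rpow_le_one_add_rpow (norm_nonneg η) (e.α_nonneg i) (e.α_le_top i)
  have hξ0 := Real.rpow_nonneg (norm_nonneg ξ) e.top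
  have hη0 := Real.rpow_nonneg (norm_nonneg η) e.top
  refine (norm_rpow_smul_sub_le (e.α_nonneg i) ξ η).trans ?_
  gcongr
  · exact e.α_le_top i
  · linarith

theorem lo_mul_le_inner_flux_sub_self (hc : Admissible lo up c) (ξ η : E) :
    lo * ((1 + (‖ξ‖ ^ e.top + ‖η‖ ^ e.top) / 2) * ‖ξ - η‖ ^ 2) ≤
      inner ℝ (e.flux c ξ - e.flux c η) (ξ - η) := by
  have hends := e.lo_mul_add_le_sum hc
    (x := fun i => (‖ξ‖ ^ e.α i + ‖η‖ ^ e.α i) / 2 * ‖ξ - η‖ ^ 2) fun i => by positivity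
  simp only [e.zero, Real.rpow_zero] at hends
  have hterms : ∑ i, c i * ((‖ξ‖ ^ e.α i + ‖η‖ ^ e.α i) / 2 * ‖ξ - η‖ ^ 2) ≤
      inner ℝ (e.flux c ξ - e.flux c η) (ξ - η) := by
    simp only [flux_sub_flux, sum_inner, real_inner_smul_left]
    exact Finset.sum_le_sum fun i _ => mul_le_mul_of_nonneg_left
      (half_mul_norm_sub_sq_le_inner_rpow_smul_sub (e.α_nonneg i) ξ η) (hc.nonneg i)
  rw [top]
  linarith

theorem neg_le_inner_flux_sub_coeff (hlo : 0 < lo) (hc' : Admissible lo up c')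
    (hδ : ∀ i, |c i - c' i| ≤ δ) (η w : E) :
    -(lo / 4 * (1 + ‖η‖ ^ e.top) * ‖w‖ ^ 2
      + ((N + 1) / lo) ^ 2 * δ ^ 2 * inner ℝ (e.flux c' η) η) ≤
        inner ℝ (e.flux c η - e.flux c' η) w := by
  set Y := ‖η‖ ^ e.top
  have hY : 0 ≤ Y := Real.rpow_nonneg (norm_nonneg _) _
  have hcauchy : |inner ℝ (e.flux c η - e.flux c' η) w| ≤ δ * (N + 1) * ((1 + Y) * ‖η‖) * ‖w‖ :=
    (abs_real_inner_le_norm _ _).trans (by gcongr; exact e.norm_flux_sub_coeff_le hδ η)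
  have hyoung : δ * (N + 1) * ((1 + Y) * ‖η‖) * ‖w‖ ≤
      lo / 4 * (1 + Y) * ‖w‖ ^ 2 + (N + 1) ^ 2 / lo * δ ^ 2 * ((1 + Y) * ‖η‖ ^ 2) := by
    have hsq : (1 + Y) * (lo * (‖w‖ / 2 - (N + 1) * δ / lo * ‖η‖) ^ 2) =
        lo / 4 * (1 + Y) * ‖w‖ ^ 2 + (N + 1) ^ 2 / lo * δ ^ 2 * ((1 + Y) * ‖η‖ ^ 2)
          - δ * (N + 1) * ((1 + Y) * ‖η‖) * ‖w‖ := by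
      field_simp
      ring
    rw [← sub_nonneg, ← hsq]
    positivity
  have hcoercive : (N + 1) ^ 2 / lo * δ ^ 2 * ((1 + Y) * ‖η‖ ^ 2) ≤
      ((N + 1) / lo) ^ 2 * δ ^ 2 * inner ℝ (e.flux c' η) η := by
    have hdiv : (1 + Y) * ‖η‖ ^ 2 ≤ inner ℝ (e.flux c' η) η / lo := by
      rw [le_div_iff₀ hlo, mul_comm]
      exact e.lo_mul_le_inner_flux_self hc' η
    calc (N + 1) ^ 2 / lo * δ ^ 2 * ((1 + Y) * ‖η‖ ^ 2)
        ≤ (N + 1) ^ 2 / lo * δ ^ 2 * (inner ℝ (e.flux c' η) η / lo) := by gcongr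
      _ = ((N + 1) / lo) ^ 2 * δ ^ 2 * inner ℝ (e.flux c' η) η := by field_simp
  linarith [(abs_le.1 hcauchy).1]

theorem rpow_norm_sub_le_inner_flux_sub (hlo : 0 < lo) (hc : Admissible lo up c)
    (hc' : Admissible lo up c') (hδ : ∀ i, |c i - c' i| ≤ δ) (ξ η : E) :
    lo / 4 * (1 / 2) ^ e.top * ‖ξ - η‖ ^ (e.top + 2)
        - ((N + 1) / lo) ^ 2 * δ ^ 2 * inner ℝ (e.flux c' η) η ≤
      inner ℝ (e.flux c ξ - e.flux c' η) (ξ - η) := by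
  have hsame := e.lo_mul_le_inner_flux_sub_self hc ξ η
  have hcoeff := e.neg_le_inner_flux_sub_coeff hlo hc' hδ η (ξ - η)
  have hpow : lo / 4 * (1 / 2) ^ e.top * ‖ξ - η‖ ^ (e.top + 2) ≤
      lo / 4 * (‖ξ‖ ^ e.top + ‖η‖ ^ e.top) * ‖ξ - η‖ ^ 2 := by
    have hhalf := norm_sub_half_rpow_le e.top_pos.le ξ η
    rw [div_eq_mul_one_div, Real.mul_rpow (norm_nonneg _) one_half_pos.le] at hhalf
    calc lo / 4 * (1 / 2) ^ e.top * ‖ξ - η‖ ^ (e.top + 2)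
        = lo / 4 * (‖ξ - η‖ ^ e.top * (1 / 2) ^ e.top) * ‖ξ - η‖ ^ 2 := by
          rw [Real.rpow_add_of_nonneg (norm_nonneg _) e.top_pos.le zero_le_two, Real.rpow_ofNat]
          ring
      _ ≤ lo / 4 * (‖ξ‖ ^ e.top + ‖η‖ ^ e.top) * ‖ξ - η‖ ^ 2 := by gcongr
  have hslack : 0 ≤ lo * ‖ξ - η‖ ^ 2 * (3 / 4 + ‖ξ‖ ^ e.top / 4) := by positivity
  rw [← sub_add_sub_cancel (e.flux c ξ) (e.flux c η), inner_add_left]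
  linarith

theorem potential_add_inner_le (hc : Admissible lo up c) (ξ η : E) :
    e.potential c ξ + inner ℝ (e.flux c ξ) (η - ξ) ≤ e.potential c η := by
  rw [flux_eq_sum, sum_inner, potential, potential, ← Finset.sum_add_distrib]
  refine Finset.sum_le_sum fun i _ => ?_
  rw [real_inner_smul_left, ← mul_add]
  exact mul_le_mul_of_nonneg_left (rpow_norm_add_inner_le (e.α_nonneg i) ξ η) (hc.nonneg i)

theorem potential_nonneg {V : Type*} [NormedAddCommGroup V] (hc : Admissible lo up c) (ξ : V) :
    0 ≤ e.potential c ξ :=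
  Finset.sum_nonneg fun i _ => by
    have := e.α_nonneg i
    have := hc.nonneg i
    positivity

theorem potential_zero {V : Type*} [NormedAddCommGroup V] : e.potential c (0 : V) = 0 :=
  Finset.sum_eq_zero fun i _ => by
    rw [norm_zero, Real.zero_rpow (by linarith [e.α_nonneg i]), zero_div, mul_zero]

theorem potential_le_inner_flux (hc : Admissible lo up c) (ξ : E) :
    e.potential c ξ ≤ inner ℝ (e.flux c ξ) ξ := by
  have h := e.potential_add_inner_le hc ξ 0
  rw [potential_zero, zero_sub, inner_neg_right] at h
  linarith

theorem potential_midpoint_le (hlo : 0 < lo) (hc : Admissible lo up c) (ξ η : E) :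
    e.potential c ((1 / 2 : ℝ) • (ξ + η))
        + lo / (e.top + 2) * ‖(1 / 2 : ℝ) • (ξ - η)‖ ^ (e.top + 2) ≤
      (e.potential c ξ + e.potential c η) / 2 := by
  have hterms : e.potential c ((1 / 2 : ℝ) • (ξ + η)) + e.potential c ((1 / 2 : ℝ) • (ξ - η)) ≤
      (e.potential c ξ + e.potential c η) / 2 := by
    simp only [potential, ← Finset.sum_add_distrib, Finset.sum_div]
    refine Finset.sum_le_sum fun i _ => ?_
    have hα := e.α_nonneg i
    rw [← mul_add, ← mul_add, mul_div_assoc, ← add_div, ← add_div, div_right_comm]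
    refine mul_le_mul_of_nonneg_left ?_ (hc.nonneg i)
    gcongr
    exact clarkson_norm_rpow (by linarith) ξ η
  have hends := e.lo_mul_add_le_sum hc
    (x := fun i => ‖(1 / 2 : ℝ) • (ξ - η)‖ ^ (e.α i + 2) / (e.α i + 2)) fun i => by
      have := e.α_nonneg i
      positivity
  have hfirst : 0 ≤ lo * (‖(1 / 2 : ℝ) • (ξ - η)‖ ^ (e.α 0 + 2) / (e.α 0 + 2)) := by
    have := e.α_nonneg 0
    positivity
  have hlast : lo / (e.top + 2) * ‖(1 / 2 : ℝ) • (ξ - η)‖ ^ (e.top + 2) =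
      lo * (‖(1 / 2 : ℝ) • (ξ - η)‖ ^ (e.α (Fin.last N) + 2) / (e.α (Fin.last N) + 2)) := by
    rw [top, div_mul_eq_mul_div, mul_div_assoc]
  rw [potential.eq_def _ _ ((1 / 2 : ℝ) • (ξ - η))] at hterms
  linarith

end ForchheimerExponents

section LpDuality

variable {X E : Type*} [MeasurableSpace X] {μ : Measure X} [NormedAddCommGroup E]
  [InnerProductSpace ℝ E]

/-- The inclusion of `L^q` into `L^p` for `p ≤ q` over a finite measure. -/
noncomputable def lpInclusion [IsFiniteMeasure μ] (p q : ℝ≥0∞) [Fact (1 ≤ p)] [Fact (1 ≤ q)]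
    (hpq : p ≤ q) : Lp E q μ →L[ℝ] Lp E p μ :=
  LinearMap.mkContinuous
    { toFun := fun u => ((Lp.memLp u).mono_exponent hpq).toLp u
      map_add' := fun u v => by
        rw [← MemLp.toLp_add, MemLp.toLp_eq_toLp_iff]
        exact Lp.coeFn_add u v
      map_smul' := fun c u => by
        rw [RingHom.id_apply, ← MemLp.toLp_const_smul, MemLp.toLp_eq_toLp_iff]
        exact Lp.coeFn_smul c u }
    (μ univ ^ (1 / p.toReal - 1 / q.toReal)).toReal fun u => by
      have hp : 1 ≤ p := Fact.out
      have hexp : 0 ≤ 1 / p.toReal - 1 / q.toReal := by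
        rcases eq_or_ne q ∞ with rfl | hq
        · simp
        · have hp0 : 0 < p.toReal :=
            ENNReal.toReal_pos (by positivity) (ne_top_of_le_ne_top hq hpq)
          exact sub_nonneg.2 (one_div_le_one_div_of_le hp0 (ENNReal.toReal_mono hq hpq))
      change ‖((Lp.memLp u).mono_exponent hpq).toLp u‖ ≤ _
      rw [Lp.norm_toLp, Lp.norm_def, mul_comm, ← ENNReal.toReal_mul]
      exact ENNReal.toReal_mono (ENNReal.mul_ne_top (Lp.eLpNorm_ne_top u)
        (ENNReal.rpow_ne_top_of_nonneg hexp (measure_ne_top _ _)))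
        (eLpNorm_le_eLpNorm_mul_rpow_measure_univ hpq (Lp.aestronglyMeasurable u))

theorem coeFn_lpInclusion [IsFiniteMeasure μ] {p q : ℝ≥0∞} [Fact (1 ≤ p)] [Fact (1 ≤ q)]
    (hpq : p ≤ q) (u : Lp E q μ) : lpInclusion p q hpq u =ᵐ[μ] u :=
  ((Lp.memLp u).mono_exponent hpq).coeFn_toLp

/-- The pairing of `L^p` and `L^q` given by the integral of the inner product. -/
noncomputable def innerPairing (μ : Measure X) (E : Type*) [NormedAddCommGroup E]
    [InnerProductSpace ℝ E] (p q : ℝ≥0∞) [Fact (1 ≤ p)] [Fact (1 ≤ q)]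
    [ENNReal.HolderConjugate p q] : Lp E p μ →L[ℝ] Lp E q μ →L[ℝ] ℝ :=
  (innerSL ℝ).lpPairing μ p q

theorem innerPairing_eq_integral {p q : ℝ≥0∞} [Fact (1 ≤ p)] [Fact (1 ≤ q)]
    [ENNReal.HolderConjugate p q] (u : Lp E p μ) (v : Lp E q μ) :
    innerPairing μ E p q u v = ∫ x, inner ℝ (u x) (v x) ∂μ :=
  (innerSL ℝ).lpPairing_eq_integral u v

theorem integrable_inner_lp {p q : ℝ≥0∞} [ENNReal.HolderConjugate p q] (u : Lp E p μ)
    (v : Lp E q μ) : Integrable (fun x => inner ℝ (u x) (v x)) μ :=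
  memLp_one_iff_integrable.1 ((innerSL ℝ).memLp_of_bilin 1 (Lp.memLp u) (Lp.memLp v))

theorem norm_rpow_sub_two_smul {r : ℝ} (hr : 1 < r) (ξ : E) :
    ‖‖ξ‖ ^ (r - 2) • ξ‖ = ‖ξ‖ ^ (r - 1) := by
  rw [norm_smul, Real.norm_of_nonneg (Real.rpow_nonneg (norm_nonneg _) _)]
  rcases eq_or_ne ‖ξ‖ 0 with h0 | h0
  · rw [h0, mul_zero, Real.zero_rpow (by linarith)]
  · rw [← Real.rpow_add_one h0]
    ring_nf

theorem inner_norm_rpow_sub_two_smul {r : ℝ} (hr : 1 < r) (ξ : E) :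
    inner ℝ ξ (‖ξ‖ ^ (r - 2) • ξ) = ‖ξ‖ ^ r := by
  rw [real_inner_smul_right, real_inner_self_eq_norm_sq]
  rcases eq_or_ne ‖ξ‖ 0 with h0 | h0
  · rw [h0, zero_pow two_ne_zero, mul_zero, Real.zero_rpow (by linarith)]
  · rw [← Real.rpow_natCast, ← Real.rpow_add ((norm_nonneg ξ).lt_of_ne' h0)]
    push_cast
    ring_nf

section ConverseHolder

variable {p q : ℝ≥0∞} [ENNReal.HolderConjugate p q]

theorem eLpNorm_norm_rpow_sub_two_smul (hp : p ≠ ∞) (hq : q ≠ ∞) (w : X → E) :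
    eLpNorm (fun x => ‖w x‖ ^ (q.toReal - 2) • w x) p μ = eLpNorm w q μ ^ (q.toReal - 1) := by
  have hconj := ENNReal.HolderConjugate.toReal_of_ne_top (p := p) (q := q) hp hq
  have hexp : p * ENNReal.ofReal (q.toReal - 1) = q := by
    rw [← ENNReal.ofReal_toReal hp, ← ENNReal.ofReal_mul ENNReal.toReal_nonneg, mul_comm,
      hconj.symm.sub_one_mul_conj, ENNReal.ofReal_toReal hq]
  calc eLpNorm (fun x => ‖w x‖ ^ (q.toReal - 2) • w x) p μ
      = eLpNorm (fun x => ‖w x‖ ^ (q.toReal - 1)) p μ :=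
        eLpNorm_congr_norm_ae (ae_of_all _ fun x => by
          rw [norm_rpow_sub_two_smul hconj.symm.lt,
            Real.norm_of_nonneg (Real.rpow_nonneg (norm_nonneg _) _)])
    _ = eLpNorm w q μ ^ (q.toReal - 1) := by
        rw [eLpNorm_norm_rpow _ (by linarith [hconj.symm.lt]), hexp]

theorem eLpNorm_le_of_integral_rpow_le (hp : p ≠ ∞) (hq : q ≠ ∞) {w : X → E} (hw : MemLp w q μ)
    {C : ℝ} (hC0 : 0 ≤ C)
    (hC : ∫ x, ‖w x‖ ^ q.toReal ∂μ ≤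
      C * (eLpNorm (fun x => ‖w x‖ ^ (q.toReal - 2) • w x) p μ).toReal) :
    eLpNorm w q μ ≤ ENNReal.ofReal C := by
  have hr : 1 < q.toReal := (ENNReal.HolderConjugate.toReal_of_ne_top (p := p) hp hq).symm.lt
  have hq0 : q ≠ 0 := by
    rintro rfl
    exact absurd hr (by simp)
  set J := (eLpNorm w q μ).toReal with hJ
  have hJ0 : 0 ≤ J := ENNReal.toReal_nonneg
  have hJr : ∫ x, ‖w x‖ ^ q.toReal ∂μ = J ^ q.toReal := by
    rw [hJ, hw.eLpNorm_eq_integral_rpow_norm hq0 hq, ENNReal.toReal_ofReal (by positivity),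
      ← Real.rpow_mul (by positivity), inv_mul_cancel₀ (by linarith), Real.rpow_one]
  rw [eLpNorm_norm_rpow_sub_two_smul hp hq, hJr, ← ENNReal.toReal_rpow, ← hJ] at hC
  rw [ENNReal.le_ofReal_iff_toReal_le hw.2.ne hC0, ← hJ]
  rcases hJ0.eq_or_lt with h0 | hJpos
  · rwa [← h0]
  · rw [show q.toReal = 1 + (q.toReal - 1) by ring, Real.rpow_add hJpos, Real.rpow_one,
      add_sub_cancel] at hC
    exact le_of_mul_le_mul_right hC (Real.rpow_pos_of_pos hJpos _)

variable [IsFiniteMeasure μ]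

theorem eLpNorm_le_of_bounded_of_integral_inner_le (hp : p ≠ ∞) (hq : q ≠ ∞) {v : X → E}
    (hv : StronglyMeasurable v) {C : ℝ} (hC0 : 0 ≤ C)
    (hC : ∀ u : X → E, MemLp u ∞ μ → ∫ x, inner ℝ (v x) (u x) ∂μ ≤ C * (eLpNorm u p μ).toReal)
    (n : ℕ) : eLpNorm ({x | ‖v x‖ ≤ n}.indicator v) q μ ≤ ENNReal.ofReal C := by
  have hr : 1 < q.toReal := (ENNReal.HolderConjugate.toReal_of_ne_top (p := p) hp hq).symm.lt
  set S := {x | ‖v x‖ ≤ n}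
  set w := S.indicator v with hw
  have hwm : StronglyMeasurable w := hv.indicator (hv.norm.measurable measurableSet_Iic)
  have hwn : ∀ x, ‖w x‖ ≤ n := fun x => by
    by_cases hx : x ∈ S
    · rw [hw, indicator_of_mem hx]
      exact hx
    · simp [hw, hx]
  have hdual : MemLp (fun x => ‖w x‖ ^ (q.toReal - 2) • w x) ∞ μ := by
    refine MemLp.of_bound (((hwm.norm.measurable.pow_const _).stronglyMeasurable.smul
      hwm).aestronglyMeasurable) ((n : ℝ) ^ (q.toReal - 1)) (ae_of_all _ fun x => ?_)
    rw [norm_rpow_sub_two_smul hr]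
    exact Real.rpow_le_rpow (norm_nonneg _) (hwn x) (by linarith)
  have hinner : ∀ x, inner ℝ (v x) (‖w x‖ ^ (q.toReal - 2) • w x) = ‖w x‖ ^ q.toReal := fun x => by
    by_cases hx : x ∈ S
    · rw [hw, indicator_of_mem hx, inner_norm_rpow_sub_two_smul hr]
    · rw [hw, indicator_of_notMem hx, smul_zero, inner_zero_right, norm_zero,
        Real.zero_rpow (by linarith)]
  refine eLpNorm_le_of_integral_rpow_le (p := p) hp hq
    (MemLp.of_bound hwm.aestronglyMeasurable n (ae_of_all _ hwn)) hC0 ?_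
  simpa only [hinner] using hC _ hdual

theorem eLpNorm_le_of_integral_inner_le (hp : p ≠ ∞) (hq : q ≠ ∞) {v : X → E}
    (hv : StronglyMeasurable v) {C : ℝ} (hC0 : 0 ≤ C)
    (hC : ∀ u : X → E, MemLp u ∞ μ → ∫ x, inner ℝ (v x) (u x) ∂μ ≤ C * (eLpNorm u p μ).toReal) :
    eLpNorm v q μ ≤ ENNReal.ofReal C := by
  have hlim : ∀ x, Tendsto (fun n : ℕ => {x | ‖v x‖ ≤ n}.indicator v x) atTop (𝓝 (v x)) :=
    fun x => tendsto_const_nhds.congr' <| by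
      filter_upwards [eventually_ge_atTop ⌈‖v x‖⌉₊] with n hn
      exact (indicator_of_mem (s := {x | ‖v x‖ ≤ n})
        ((Nat.le_ceil _).trans (Nat.cast_le.2 hn)) v).symm
  refine (Lp.eLpNorm_lim_le_liminf_eLpNorm (fun n : ℕ =>
    (hv.indicator (hv.norm.measurable measurableSet_Iic)).aestronglyMeasurable) v
    (ae_of_all _ hlim)).trans ?_
  exact liminf_le_of_le (by isBoundedDefault) fun b hb => hb.exists.choose_spec.trans
    (eLpNorm_le_of_bounded_of_integral_inner_le hp hq hv hC0 hC _)

end ConverseHolder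

variable [IsFiniteMeasure μ] {p q : ℝ≥0∞} [Fact (1 ≤ p)] [Fact (1 ≤ q)]
  [ENNReal.HolderConjugate p q]

theorem eq_innerPairing_of_lpInclusion (hp2 : p ≤ 2) {ℓ : Lp E p μ →L[ℝ] ℝ} {v : Lp E q μ}
    (h : ∀ u : Lp E 2 μ, ℓ (lpInclusion p 2 hp2 u) = ∫ x, inner ℝ (v x) (u x) ∂μ) :
    ℓ = innerPairing μ E q p v := by
  ext u
  induction u using Lp.induction (ne_top_of_le_ne_top ENNReal.ofNat_ne_top hp2) with
  | indicatorConst c hs hμs =>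
    have hincl : lpInclusion p 2 hp2 (indicatorConstLp 2 hs hμs.ne c) =
        (Lp.simpleFunc.indicatorConst p hs hμs.ne c : Lp E p μ) := by
      rw [Lp.simpleFunc.coe_indicatorConst]
      exact Lp.ext ((coeFn_lpInclusion hp2 _).trans
        (indicatorConstLp_coeFn.trans indicatorConstLp_coeFn.symm))
    rw [← hincl, h, innerPairing_eq_integral]
    refine integral_congr_ae ?_
    filter_upwards [coeFn_lpInclusion hp2 (indicatorConstLp 2 hs hμs.ne c)] with x hx
    rw [hx]
  | add hf hg _ h1 h2 => rw [map_add, map_add, h1, h2]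
  | isClosed => exact isClosed_eq ℓ.continuous (ContinuousLinearMap.continuous _)

theorem exists_innerPairing_eq [CompleteSpace E] (hp2 : p ≤ 2) (hq : q ≠ ∞)
    (ℓ : Lp E p μ →L[ℝ] ℝ) : ∃ v : Lp E q μ, ℓ = innerPairing μ E q p v := by
  set v := (InnerProductSpace.toDual ℝ (Lp E 2 μ)).symm (ℓ ∘L lpInclusion p 2 hp2) with hv
  have hrep : ∀ u : Lp E 2 μ, ℓ (lpInclusion p 2 hp2 u) = ∫ x, inner ℝ (v x) (u x) ∂μ := fun u => by
    rw [← L2.inner_def, hv, InnerProductSpace.toDual_symm_apply]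
    rfl
  have hbound : ∀ u : X → E, MemLp u ∞ μ →
      ∫ x, inner ℝ (v x) (u x) ∂μ ≤ ‖ℓ‖ * (eLpNorm u p μ).toReal := fun u hu => by
    have hu2 : MemLp u 2 μ := hu.mono_exponent le_top
    calc ∫ x, inner ℝ (v x) (u x) ∂μ = ∫ x, inner ℝ (v x) (hu2.toLp u x) ∂μ := by
          refine integral_congr_ae ?_
          filter_upwards [hu2.coeFn_toLp] with x hx
          rw [hx]
      _ = ℓ (lpInclusion p 2 hp2 (hu2.toLp u)) := (hrep _).symm
      _ ≤ ‖ℓ‖ * ‖lpInclusion p 2 hp2 (hu2.toLp u)‖ :=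
        (le_abs_self _).trans (ℓ.le_opNorm _)
      _ = ‖ℓ‖ * (eLpNorm u p μ).toReal := by
        rw [Lp.norm_def, eLpNorm_congr_ae ((coeFn_lpInclusion hp2 _).trans hu2.coeFn_toLp)]
  have hvq : MemLp v q μ := ⟨Lp.aestronglyMeasurable v,
    (eLpNorm_le_of_integral_inner_le (ne_top_of_le_ne_top ENNReal.ofNat_ne_top hp2) hq
      (Lp.stronglyMeasurable v) (norm_nonneg ℓ) hbound).trans_lt ENNReal.ofReal_lt_top⟩
  refine ⟨hvq.toLp v, eq_innerPairing_of_lpInclusion hp2 fun u => (hrep u).trans ?_⟩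
  refine integral_congr_ae ?_
  filter_upwards [hvq.coeFn_toLp] with x hx
  rw [hx]

end LpDuality

section WeakLimits

variable {H : Type*} [NormedAddCommGroup H] [InnerProductSpace ℝ H] {a : ℕ → H} {M : ℝ} {D : Set H}

theorem cauchySeq_inner_of_dense (ha : ∀ k, ‖a k‖ ≤ M) (hD : Dense D)
    (hc : ∀ h ∈ D, CauchySeq fun k => (inner ℝ (a k) h : ℝ)) (h : H) :
    CauchySeq fun k => (inner ℝ (a k) h : ℝ) := by
  have hM : 0 ≤ M := (norm_nonneg _).trans (ha 0)
  refine Metric.cauchySeq_iff.2 fun ε hε => ?_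
  obtain ⟨d, hd, hhd⟩ := Metric.dense_iff.1 hD h (ε / (2 * (2 * M + 1))) (by positivity)
  obtain ⟨n, hn⟩ := Metric.cauchySeq_iff.1 (hc _ hhd) (ε / 2) (by positivity)
  refine ⟨n, fun i hi j hj => ?_⟩
  have hij := hn i hi j hj
  rw [Metric.mem_ball, dist_comm, dist_eq_norm, lt_div_iff₀ (by positivity)] at hd
  rw [Real.dist_eq, ← inner_sub_left] at hij ⊢
  have hrest : |inner ℝ (a i - a j) (h - d)| ≤ 2 * M * ‖h - d‖ := by
    refine (abs_real_inner_le_norm _ _).trans ?_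
    gcongr
    exact (norm_sub_le _ _).trans (by linarith [ha i, ha j])
  calc |inner ℝ (a i - a j) h|
      = |inner ℝ (a i - a j) d + inner ℝ (a i - a j) (h - d)| := by
        rw [← inner_add_right, add_sub_cancel]
    _ ≤ |inner ℝ (a i - a j) d| + |inner ℝ (a i - a j) (h - d)| := abs_add_le _ _
    _ < ε := by linarith [norm_nonneg (h - d)]

theorem exists_weak_limit_of_dense [CompleteSpace H] (ha : ∀ k, ‖a k‖ ≤ M) (hD : Dense D)
    (hc : ∀ h ∈ D, CauchySeq fun k => (inner ℝ (a k) h : ℝ)) :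
    ∃ a₀ : H, ∀ h, Tendsto (fun k => inner ℝ (a k) h) atTop (𝓝 (inner ℝ a₀ h)) := by
  choose l hl using fun h =>
    cauchySeq_tendsto_of_complete (cauchySeq_inner_of_dense ha hD hc h)
  let ℓ : H →L[ℝ] ℝ :=
    continuousLinearMapOfTendsto (fun k => innerSL ℝ (a k)) (tendsto_pi_nhds.2 hl)
  refine ⟨(InnerProductSpace.toDual ℝ H).symm ℓ, fun h => ?_⟩
  rw [InnerProductSpace.toDual_symm_apply]
  exact hl h

end WeakLimits

section TestFunctions

variable {d : ℕ} {Ω : Opens (Euc d)}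

theorem memLp_testFunction (ψ : 𝓓(Ω, ℝ)) (p : ℝ≥0∞) : MemLp ψ p (volOn Ω) :=
  ψ.continuous.memLp_of_hasCompactSupport ψ.hasCompactSupport

theorem memLp_gradient_testFunction (ψ : 𝓓(Ω, ℝ)) (p : ℝ≥0∞) :
    MemLp (∇ (ψ : Euc d → ℝ)) p (volOn Ω) :=
  (testFunction_continuous_gradient ψ).memLp_of_hasCompactSupport
    (testFunction_hasCompactSupport_gradient ψ)

variable (Ω) in
/-- The class of a test function in `L²`. -/
noncomputable def testClass : 𝓓(Ω, ℝ) →ₗ[ℝ] Lp ℝ 2 (volOn Ω) where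
  toFun ψ := (memLp_testFunction ψ 2).toLp ψ
  map_add' ψ η := MemLp.toLp_add (memLp_testFunction ψ 2) (memLp_testFunction η 2)
  map_smul' c ψ := MemLp.toLp_const_smul c (memLp_testFunction ψ 2)

variable (Ω) in
/-- The class in `L^p` of the gradient of a test function. -/
noncomputable def testGradient (p : ℝ≥0∞) : 𝓓(Ω, ℝ) →ₗ[ℝ] Lp (Euc d) p (volOn Ω) where
  toFun ψ := (memLp_gradient_testFunction ψ p).toLp (∇ ψ)
  map_add' ψ η := by
    rw [← MemLp.toLp_add, MemLp.toLp_eq_toLp_iff]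
    exact ae_of_all _ fun x => gradient_testFunction_add ψ η x
  map_smul' c ψ := by
    rw [RingHom.id_apply, ← MemLp.toLp_const_smul, MemLp.toLp_eq_toLp_iff]
    exact ae_of_all _ fun x => gradient_testFunction_smul c ψ x

theorem coeFn_testClass (ψ : 𝓓(Ω, ℝ)) : testClass Ω ψ =ᵐ[volOn Ω] ψ :=
  (memLp_testFunction ψ 2).coeFn_toLp

theorem coeFn_testGradient (p : ℝ≥0∞) (ψ : 𝓓(Ω, ℝ)) :
    testGradient Ω p ψ =ᵐ[volOn Ω] ∇ (ψ : Euc d → ℝ) :=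
  (memLp_gradient_testFunction ψ p).coeFn_toLp

theorem inner_testClass (g : Lp ℝ 2 (volOn Ω)) (ψ : 𝓓(Ω, ℝ)) :
    inner ℝ g (testClass Ω ψ) = ∫ x in Ω, ψ x * g x := by
  rw [L2.inner_def]
  refine integral_congr_ae ?_
  filter_upwards [coeFn_testClass ψ] with x hx
  rw [hx, RCLike.inner_apply, conj_trivial]

theorem eq_zero_of_forall_inner_testClass_eq_zero {g : Lp ℝ 2 (volOn Ω)}
    (hg : ∀ ψ, inner ℝ g (testClass Ω ψ) = 0) : g = 0 := by
  have hloc : LocallyIntegrableOn g (Ω : Set (Euc d)) volume :=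
    locallyIntegrableOn_of_locallyIntegrable_restrict ((Lp.memLp g).locallyIntegrable one_le_two)
  have hae := Ω.isOpen.ae_eq_zero_of_integral_contDiff_smul_eq_zero hloc fun η hη hcpt hsupp => by
    let ψ : 𝓓(Ω, ℝ) := ⟨η, by exact_mod_cast hη, hcpt, hsupp⟩
    rw [← setIntegral_eq_integral_of_forall_compl_eq_zero (s := (Ω : Set (Euc d))) fun x hx => by
      rw [image_eq_zero_of_notMem_tsupport fun h => hx (hsupp h), zero_smul]]
    exact (inner_testClass g ψ).symm.trans (hg ψ)
  have hzero : g =ᵐ[volOn Ω] 0 := (ae_restrict_iff' Ω.isOpen.measurableSet).2 hae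
  exact Lp.ext (hzero.trans (Lp.coeFn_zero _ _ _).symm)

theorem dense_range_testClass : Dense (range (testClass Ω)) := by
  have horth : (testClass Ω).rangeᗮ = ⊥ := (Submodule.eq_bot_iff _).2 fun g hg =>
    eq_zero_of_forall_inner_testClass_eq_zero fun ψ =>
      (Submodule.mem_orthogonal' _ g).1 hg _ (LinearMap.mem_range_self _ ψ)
  rw [← LinearMap.coe_range, Submodule.dense_iff_topologicalClosure_eq_top,
    Submodule.topologicalClosure_eq_top_iff, horth]

end TestFunctions

section DivergenceSpace

variable {d : ℕ} {Ω : Opens (Euc d)} {q : ℝ≥0∞} [Fact (1 ≤ q)]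

theorem Wdiv.ext_field {m n : Wdiv Ω q} (h : m.1.1 = n.1.1) : m = n := by
  have hdiv : m.1.2 = n.1.2 := dense_range_testClass.eq_of_inner_left ℝ <| by
    rintro _ ⟨ψ, rfl⟩
    rw [inner_testClass, inner_testClass, m.2 ψ, n.2 ψ, h]
  exact Subtype.ext (Prod.ext h hdiv)

variable (p : ℝ≥0∞) [Fact (1 ≤ p)] [ENNReal.HolderConjugate p q]

theorem mem_Wdiv_iff {w : Lp (Euc d) q (volOn Ω) × Lp ℝ 2 (volOn Ω)} :
    w ∈ Wdiv Ω q ↔ ∀ ψ, inner ℝ w.2 (testClass Ω ψ) =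
      - innerPairing (volOn Ω) (Euc d) q p w.1 (testGradient Ω p ψ) := by
  refine forall_congr' fun ψ => ?_
  have hgrad : ∫ x in Ω, inner ℝ (w.1 x) (testGradient Ω p ψ x) =
      ∫ x in Ω, inner ℝ (w.1 x) (∇ ψ x) := by
    refine integral_congr_ae ?_
    filter_upwards [coeFn_testGradient p ψ] with x hx
    rw [hx]
  rw [inner_testClass, innerPairing_eq_integral, hgrad]

theorem continuous_innerPairing_left (g : Lp (Euc d) p (volOn Ω)) :
    Continuous fun v => innerPairing (volOn Ω) (Euc d) q p v g :=
  ((innerPairing (volOn Ω) (Euc d) q p).flip g).continuous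

include p in
theorem isClosed_Wdiv :
    IsClosed (Wdiv Ω q : Set (Lp (Euc d) q (volOn Ω) × Lp ℝ 2 (volOn Ω))) := by
  have hcoe : (Wdiv Ω q : Set (Lp (Euc d) q (volOn Ω) × Lp ℝ 2 (volOn Ω))) =
      ⋂ ψ, {w | inner ℝ w.2 (testClass Ω ψ) =
        - innerPairing (volOn Ω) (Euc d) q p w.1 (testGradient Ω p ψ)} := by
    ext w
    rw [SetLike.mem_coe, mem_Wdiv_iff p, mem_iInter]
    rfl
  rw [hcoe]
  exact isClosed_iInter fun ψ => isClosed_eq (continuous_snd.inner continuous_const)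
    ((continuous_innerPairing_left p _).comp continuous_fst).neg

include p in
theorem exists_weak_limit_div {w : ℕ → Wdiv Ω q} {v : Lp (Euc d) q (volOn Ω)} {M : ℝ}
    (hv : Tendsto (fun k => (w k).1.1) atTop (𝓝 v)) (hM : ∀ k, ‖(w k).1.2‖ ≤ M) :
    ∃ m : Wdiv Ω q, m.1.1 = v ∧
      ∀ h, Tendsto (fun k => inner ℝ (w k).1.2 h) atTop (𝓝 (inner ℝ m.1.2 h)) := by
  have hlim : ∀ ψ, Tendsto (fun k => inner ℝ (w k).1.2 (testClass Ω ψ)) atTop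
      (𝓝 (- innerPairing (volOn Ω) (Euc d) q p v (testGradient Ω p ψ))) := fun ψ =>
    ((((continuous_innerPairing_left p _).tendsto v).comp hv).neg).congr fun k =>
      ((mem_Wdiv_iff p).1 (w k).2 ψ).symm
  obtain ⟨a, ha⟩ := exists_weak_limit_of_dense hM dense_range_testClass
    (forall_mem_range.2 fun ψ => (hlim ψ).cauchySeq)
  exact ⟨⟨(v, a), (mem_Wdiv_iff p).2 fun ψ => tendsto_nhds_unique (ha _) (hlim ψ)⟩, rfl, ha⟩

end DivergenceSpace

section BoundedMultipliers

variable {X : Type*} [MeasurableSpace X] {μ : Measure X} {c : ℕ → X → ℝ} {c₀ : X → ℝ} {C : ℝ}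

theorem tendsto_integral_mul_of_bounded (hcm : ∀ n, AEStronglyMeasurable (c n) μ)
    (hc : ∀ n x, |c n x| ≤ C) (hlim : ∀ᵐ x ∂μ, Tendsto (fun n => c n x) atTop (𝓝 (c₀ x)))
    {f : X → ℝ} (hf : Integrable f μ) :
    Tendsto (fun n => ∫ x, c n x * f x ∂μ) atTop (𝓝 (∫ x, c₀ x * f x ∂μ)) := by
  refine tendsto_integral_of_dominated_convergence (fun x => C * ‖f x‖)
    (fun n => (hcm n).mul hf.1) (hf.norm.const_mul C) (fun n => ae_of_all _ fun x => ?_)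
    (hlim.mono fun x hx => hx.mul_const _)
  rw [norm_mul]
  exact mul_le_mul_of_nonneg_right (hc n x) (norm_nonneg _)

theorem tendsto_integral_mul_of_tendsto_L1 (hcm : ∀ n, AEStronglyMeasurable (c n) μ)
    (hc : ∀ n x, |c n x| ≤ C) (hlim : ∀ᵐ x ∂μ, Tendsto (fun n => c n x) atTop (𝓝 (c₀ x)))
    {f : ℕ → Lp ℝ 1 μ} {f₀ : Lp ℝ 1 μ} (hf : Tendsto f atTop (𝓝 f₀)) :
    Tendsto (fun n => ∫ x, c n x * f n x ∂μ) atTop (𝓝 (∫ x, c₀ x * f₀ x ∂μ)) := by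
  have hinteg : ∀ n (g : Lp ℝ 1 μ), Integrable (fun x => c n x * g x) μ := fun n g =>
    (L1.integrable_coeFn g).bdd_mul (hcm n) (ae_of_all _ (hc n))
  have hdist : ∀ n, dist (∫ x, c n x * f₀ x ∂μ) (∫ x, c n x * f n x ∂μ) ≤ C * ‖f₀ - f n‖ := by
    intro n
    rw [dist_eq_norm, ← integral_sub (hinteg n _) (hinteg n _), L1.norm_eq_integral_norm,
      ← integral_const_mul]
    refine norm_integral_le_of_norm_le ((L1.integrable_coeFn _).norm.const_mul C) ?_
    filter_upwards [Lp.coeFn_sub f₀ (f n)] with x hx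
    rw [hx, Pi.sub_apply, ← mul_sub, norm_mul]
    exact mul_le_mul_of_nonneg_right (hc n x) (norm_nonneg _)
  refine (tendsto_integral_mul_of_bounded hcm hc hlim (L1.integrable_coeFn f₀)).congr_dist
    (squeeze_zero (fun _ => dist_nonneg) hdist ?_)
  simpa using (((tendsto_const_nhds (x := f₀)).sub hf).norm).const_mul C

theorem tendsto_integral_comp_div_mul {φ : ℝ → ℝ} (hφ : Continuous φ) (hb : ∀ y, |φ y| ≤ C)
    {u f : X → ℝ} (hu : AEStronglyMeasurable u μ) (hf : Integrable f μ) :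
    Tendsto (fun n : ℕ => ∫ x, φ (u x / (n + 1)) * f x ∂μ) atTop
      (𝓝 (∫ x, φ 0 * f x ∂μ)) := by
  refine tendsto_integral_mul_of_bounded
    (fun n => hφ.comp_aestronglyMeasurable (hu.mul_const ((n : ℝ) + 1)⁻¹)) (fun n x => hb _)
    (ae_of_all _ fun x => (hφ.tendsto 0).comp ?_) hf
  exact tendsto_const_nhds.div_atTop (tendsto_natCast_atTop_atTop.atTop_add tendsto_const_nhds)

end BoundedMultipliers

theorem mem_topologicalClosure_of_forall_dual {E : Type*} [NormedAddCommGroup E]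
    [NormedSpace ℝ E] {S : Submodule ℝ E} {x : E}
    (h : ∀ f : E →L[ℝ] ℝ, (∀ y ∈ S, f y = 0) → f x = 0) : x ∈ S.topologicalClosure := by
  by_contra hx
  have := S.isClosed_topologicalClosure
  obtain ⟨g, hg⟩ := SeparatingDual.exists_ne_zero (R := ℝ)
    (mt (Submodule.Quotient.mk_eq_zero S.topologicalClosure).1 hx)
  refine hg (h (g ∘L S.topologicalClosure.mkQL) fun y hy => ?_)
  change g (Submodule.Quotient.mk y) = 0
  rw [(Submodule.Quotient.mk_eq_zero _).2 (S.le_topologicalClosure hy), map_zero]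

section Traces

variable {d : ℕ} {Ω : Opens (Euc d)} {p q : ℝ≥0∞} [Fact (1 ≤ p)]

theorem mem_L2W0_of_mem_topologicalClosure [IsFiniteMeasure (volOn Ω)] (hp2 : p ≤ 2)
    {r : Lp ℝ 2 (volOn Ω) × Lp (Euc d) p (volOn Ω)}
    (hr : r ∈ ((testClass Ω).prod (testGradient Ω p)).range.topologicalClosure) :
    r ∈ L2W0 Ω p := by
  obtain ⟨x, hx, hlim⟩ := mem_closure_iff_seq_limit.1 hr
  choose ψ hψ using hx
  obtain rfl : (fun n => (testClass Ω (ψ n), testGradient Ω p (ψ n))) = x := funext hψ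
  rw [Prod.tendsto_iff] at hlim
  have hval := ((lpInclusion p 2 hp2).continuous.tendsto _).comp hlim.1
  have hgrad := hlim.2
  rw [Lp.tendsto_Lp_iff_tendsto_eLpNorm'] at hval hgrad
  refine ⟨ψ, hval.congr fun n => eLpNorm_congr_ae ?_, hgrad.congr fun n => eLpNorm_congr_ae ?_⟩
  · filter_upwards [coeFn_testClass (ψ n), coeFn_lpInclusion hp2 (testClass Ω (ψ n)),
      coeFn_lpInclusion hp2 r.1] with x h h' hr
    rw [Pi.sub_apply, Function.comp_apply, h', hr, h]
  · filter_upwards [coeFn_testGradient p (ψ n)] with x h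
    rw [Pi.sub_apply, h]

variable [Fact (1 ≤ q)] [ENNReal.HolderConjugate p q]

theorem exists_eq_inner_add_innerPairing [IsFiniteMeasure (volOn Ω)] (hp2 : p ≤ 2) (hq : q ≠ ∞)
    (f : Lp ℝ 2 (volOn Ω) × Lp (Euc d) p (volOn Ω) →L[ℝ] ℝ) :
    ∃ (v : Lp (Euc d) q (volOn Ω)) (g : Lp ℝ 2 (volOn Ω)), ∀ r,
      f r = inner ℝ g r.1 + innerPairing (volOn Ω) (Euc d) q p v r.2 := by
  obtain ⟨v, hv⟩ := exists_innerPairing_eq hp2 hq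
    (f ∘L ContinuousLinearMap.inr ℝ (Lp ℝ 2 (volOn Ω)) (Lp (Euc d) p (volOn Ω)))
  refine ⟨v, (InnerProductSpace.toDual ℝ (Lp ℝ 2 (volOn Ω))).symm
    (f ∘L ContinuousLinearMap.inl ℝ (Lp ℝ 2 (volOn Ω)) (Lp (Euc d) p (volOn Ω))), fun r => ?_⟩
  rw [← hv, InnerProductSpace.toDual_symm_apply]
  simp [← map_add]

theorem mem_L2W0_of_forall_Wdiv [IsFiniteMeasure (volOn Ω)] (hp2 : p ≤ 2) (hq : q ≠ ∞)
    {r : Lp ℝ 2 (volOn Ω) × Lp (Euc d) p (volOn Ω)}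
    (hr : ∀ w : Wdiv Ω q, inner ℝ w.1.2 r.1 +
      innerPairing (volOn Ω) (Euc d) q p w.1.1 r.2 = 0) : r ∈ L2W0 Ω p := by
  refine mem_L2W0_of_mem_topologicalClosure hp2 (mem_topologicalClosure_of_forall_dual
    fun f hf => ?_)
  obtain ⟨v, g, hfr⟩ := exists_eq_inner_add_innerPairing hp2 hq f
  have hmem : (v, g) ∈ Wdiv Ω q := (mem_Wdiv_iff p).2 fun ψ =>
    eq_neg_of_add_eq_zero_left ((hfr _).symm.trans (hf _ ⟨ψ, rfl⟩))
  rw [hfr]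
  exact hr ⟨(v, g), hmem⟩

/-- The test function `k sin (ψ / k)`: a smooth truncation of `ψ` at height `k`, which stays a test
function because `sin` vanishes at the origin. -/
noncomputable def sinTrunc (k : ℝ) (ψ : 𝓓(Ω, ℝ)) : 𝓓(Ω, ℝ) where
  toFun x := k * Real.sin (ψ x / k)
  contDiff' := contDiff_const.mul (Real.contDiff_sin.comp (ψ.contDiff.div_const k))
  hasCompactSupport' := ψ.hasCompactSupport.comp_left (g := fun y => k * Real.sin (y / k)) (by simp)
  tsupport_subset' := (tsupport_comp_subset (g := fun y => k * Real.sin (y / k)) (by simp) ψ).trans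
    ψ.tsupport_subset

theorem gradient_sinTrunc {k : ℝ} (hk : k ≠ 0) (ψ : 𝓓(Ω, ℝ)) (x : Euc d) :
    ∇ (sinTrunc k ψ) x = Real.cos (ψ x / k) • ∇ ψ x := by
  have hψ : HasGradientAt ψ (∇ ψ x) x :=
    ((ψ.contDiff.differentiable (by simp)) x).hasGradientAt
  have hsin : HasDerivAt (fun y => k * Real.sin (y / k)) (Real.cos (ψ x / k)) (ψ x) := by
    refine ((((hasDerivAt_id (ψ x)).div_const k).sin).const_mul k).congr_deriv ?_
    rw [id, one_div, mul_left_comm, mul_inv_cancel₀ hk, mul_one]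
  have hcomp : HasGradientAt (sinTrunc k ψ) (Real.cos (ψ x / k) • ∇ ψ x) x := by
    rw [hasGradientAt_iff_hasFDerivAt] at hψ ⊢
    rw [map_smul]
    exact hsin.comp_hasFDerivAt x hψ
  exact hcomp.gradient

theorem exists_testFunction_seq (r : L2W0 Ω p) :
    ∃ ψ : ℕ → 𝓓(Ω, ℝ), (∀ᵐ x ∂volOn Ω, Tendsto (fun n => ψ n x) atTop (𝓝 (r.1.1 x))) ∧
      Tendsto (fun n => testGradient Ω p (ψ n)) atTop (𝓝 r.1.2) := by
  obtain ⟨ψ, hval, hgrad⟩ := r.2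
  have hp0 : p ≠ 0 := (zero_lt_one.trans_le (Fact.out (p := 1 ≤ p))).ne'
  obtain ⟨ns, hns, hae⟩ := (tendstoInMeasure_of_tendsto_eLpNorm hp0
    (fun n => (ψ n).continuous.aestronglyMeasurable) (Lp.aestronglyMeasurable r.1.1)
    hval).exists_seq_tendsto_ae
  refine ⟨fun n => ψ (ns n), hae, (Lp.tendsto_Lp_iff_tendsto_eLpNorm' _ _).2 ?_⟩
  refine (hgrad.comp hns.tendsto_atTop).congr fun n => eLpNorm_congr_ae ?_
  filter_upwards [coeFn_testGradient p (ψ (ns n))] with x hx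
  rw [Pi.sub_apply, hx]

theorem integral_mul_sin_div_mul (r : L2W0 Ω p) (w : Wdiv Ω q) {k : ℝ} (hk : k ≠ 0)
    (hw : Integrable w.1.2 (volOn Ω)) :
    ∫ x in Ω, k * Real.sin (r.1.1 x / k) * w.1.2 x =
      - ∫ x in Ω, Real.cos (r.1.1 x / k) * inner ℝ (w.1.1 x) (r.1.2 x) := by
  obtain ⟨ψ, hval, hgrad⟩ := exists_testFunction_seq r
  let B := (innerSL ℝ (E := Euc d)).holderL (volOn Ω) q p 1 w.1.1
  have hB : ∀ v, B v =ᵐ[volOn Ω] fun x => inner ℝ (w.1.1 x) (v x) :=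
    (innerSL ℝ).coeFn_holder w.1.1
  have hleft : Tendsto (fun n => ∫ x in Ω, sinTrunc k (ψ n) x * w.1.2 x) atTop
      (𝓝 (∫ x in Ω, k * Real.sin (r.1.1 x / k) * w.1.2 x)) := by
    refine tendsto_integral_mul_of_bounded (C := |k|)
      (fun n => (sinTrunc k (ψ n)).continuous.aestronglyMeasurable) (fun n x => ?_) ?_ hw
    · exact (abs_mul _ _).trans_le
        (mul_le_of_le_one_right (abs_nonneg _) (Real.abs_sin_le_one _))
    · exact hval.mono fun x hx =>
        ((Real.continuous_sin.tendsto _).comp (hx.div_const k)).const_mul k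
  have hright : Tendsto (fun n => ∫ x in Ω, Real.cos (ψ n x / k) * B (testGradient Ω p (ψ n)) x)
      atTop (𝓝 (∫ x in Ω, Real.cos (r.1.1 x / k) * B r.1.2 x)) :=
    tendsto_integral_mul_of_tendsto_L1
      (fun n => (Real.continuous_cos.comp ((ψ n).continuous.div_const k)).aestronglyMeasurable)
      (fun n x => Real.abs_cos_le_one _)
      (hval.mono fun x hx => (Real.continuous_cos.tendsto _).comp (hx.div_const k))
      ((B.continuous.tendsto _).comp hgrad)
  have hparts : ∀ n, - ∫ x in Ω, Real.cos (ψ n x / k) * B (testGradient Ω p (ψ n)) x =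
      ∫ x in Ω, sinTrunc k (ψ n) x * w.1.2 x := fun n => by
    rw [w.2 (sinTrunc k (ψ n)), neg_inj]
    refine integral_congr_ae ?_
    filter_upwards [hB (testGradient Ω p (ψ n)), coeFn_testGradient p (ψ n)] with x hx hψ
    rw [hx, hψ, gradient_sinTrunc hk, real_inner_smul_right]
  rw [tendsto_nhds_unique hleft (hright.neg.congr hparts), neg_inj]
  exact integral_congr_ae ((hB r.1.2).mono fun x hx => congrArg _ hx)

-- A function of `L² ∩ W₀^{1,p}` need not be an `L²` limit of the test functions that approximate
-- it in `W^{1,p}`, so `r` is first truncated by `k sin (· / k) = sinc (· / k) ·`, and `k → ∞`.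
theorem inner_div_add_innerPairing_grad [IsFiniteMeasure (volOn Ω)] (r : L2W0 Ω p)
    (w : Wdiv Ω q) :
    inner ℝ w.1.2 r.1.1 + innerPairing (volOn Ω) (Euc d) q p w.1.1 r.1.2 = 0 := by
  have hr := Lp.aestronglyMeasurable r.1.1
  have hleft := tendsto_integral_comp_div_mul Real.continuous_sinc Real.abs_sinc_le_one hr
    (L2.integrable_inner w.1.2 r.1.1)
  have hright := tendsto_integral_comp_div_mul Real.continuous_cos Real.abs_cos_le_one hr
    (integrable_inner_lp w.1.1 r.1.2)
  simp only [Real.sinc_zero, Real.cos_zero, one_mul] at hleft hright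
  rw [L2.inner_def, innerPairing_eq_integral, add_eq_zero_iff_eq_neg]
  refine tendsto_nhds_unique hleft (hright.neg.congr fun n => ?_)
  have hn : (n : ℝ) + 1 ≠ 0 := by positivity
  rw [← integral_mul_sin_div_mul r w hn ((Lp.memLp w.1.2).integrable one_le_two)]
  refine integral_congr_ae (ae_of_all _ fun x => ?_)
  have hsinc : (n + 1) * Real.sin (r.1.1 x / (n + 1)) =
      Real.sinc (r.1.1 x / (n + 1)) * r.1.1 x := by
    rcases eq_or_ne (r.1.1 x) 0 with h | h
    · simp [h]
    · rw [Real.sinc_of_ne_zero (div_ne_zero h hn)]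
      field_simp
  simp only [hsinc, RCLike.inner_apply, conj_trivial, mul_assoc]

end Traces

namespace ForchheimerExponents

section Exponents

variable {N : ℕ} (e : ForchheimerExponents N)

theorem s_eq : e.s = ENNReal.ofReal (e.top + 2) := rfl

theorem sStar_eq : e.sStar = ENNReal.ofReal ((e.top + 2) / (e.top + 1)) := rfl

theorem s_ne_top : e.s ≠ ∞ := ENNReal.ofReal_ne_top

theorem s_ne_zero : e.s ≠ 0 := (zero_lt_one.trans_le (Fact.out (p := 1 ≤ e.s))).ne'

theorem toReal_s : e.s.toReal = e.top + 2 :=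
  ENNReal.toReal_ofReal (by linarith [e.α_last_nonneg])

theorem sStar_le_two : e.sStar ≤ 2 := by
  have h := e.top_pos
  rw [sStar_eq, ← ENNReal.ofReal_ofNat 2]
  refine ENNReal.ofReal_le_ofReal ?_
  rw [div_le_iff₀ (by linarith)]
  linarith

instance holderConjugate_sStar_s : ENNReal.HolderConjugate e.sStar e.s := by
  have h := e.top_pos
  refine Real.HolderConjugate.ennrealOfReal (Real.holderConjugate_iff.2 ?_)
  change 1 < (e.top + 2) / (e.top + 1) ∧ ((e.top + 2) / (e.top + 1))⁻¹ + (e.top + 2)⁻¹ = 1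
  refine ⟨(one_lt_div (by linarith)).2 (by linarith), ?_⟩
  field_simp
  ring

/-- The exponent `s / α_N` of the weight `|m| ^ α_N`. -/
noncomputable def sWeight : ℝ≥0∞ := ENNReal.ofReal ((e.top + 2) / e.top)

instance : Fact (1 ≤ e.sWeight) := by
  have h := e.top_pos
  refine ⟨?_⟩
  rw [sWeight, ENNReal.one_le_ofReal, one_le_div h]
  linarith

theorem sWeight_mul_top : e.sWeight * ENNReal.ofReal e.top = e.s := by
  have h := e.top_pos
  rw [sWeight, ← ENNReal.ofReal_mul (by positivity), div_mul_cancel₀ _ h.ne', s_eq]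

instance holderTriple_sWeight : ENNReal.HolderTriple e.sWeight e.s e.sStar := by
  have h := e.top_pos
  refine ⟨?_⟩
  rw [sWeight, s_eq, sStar_eq, ← ENNReal.ofReal_inv_of_pos (by positivity),
    ← ENNReal.ofReal_inv_of_pos (by positivity), ← ENNReal.ofReal_inv_of_pos (by positivity),
    ← ENNReal.ofReal_add (by positivity) (by positivity)]
  congr 1
  field_simp

end Exponents

section Nemytskii

variable {N : ℕ} (e : ForchheimerExponents N) {X E V : Type*} [MeasurableSpace X] {μ : Measure X}
  [NormedAddCommGroup E] [InnerProductSpace ℝ E] [NormedAddCommGroup V]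

/-- Measurable coefficient fields within the bounds of the problem. -/
structure AdmissibleField (lo up : ℝ) (μ : Measure X) (A : Fin (N + 1) → X → ℝ) : Prop where
  lo_pos : 0 < lo
  up_nonneg : 0 ≤ up
  aestronglyMeasurable : ∀ i, AEStronglyMeasurable (A i) μ
  admissible : ∀ᵐ x ∂μ, Admissible lo up fun i => A i x

variable {lo up δ : ℝ} {A B : Fin (N + 1) → X → ℝ}

theorem memLp_norm_rpow_top (m : Lp V e.s μ) : MemLp (fun x => ‖m x‖ ^ e.top) e.sWeight μ := by
  refine ⟨((Lp.aestronglyMeasurable m).norm.aemeasurable.pow_const _).aestronglyMeasurable, ?_⟩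
  rw [eLpNorm_norm_rpow _ e.top_pos, sWeight_mul_top]
  exact ENNReal.rpow_lt_top_of_nonneg e.top_pos.le (Lp.memLp m).2.ne

/-- The weight `|m| ^ α_N` of a field `m` in `L^s`, as an element of `L^{s / α_N}`. -/
noncomputable def weight (m : Lp V e.s μ) : Lp ℝ e.sWeight μ :=
  (e.memLp_norm_rpow_top m).toLp _

theorem coeFn_weight (m : Lp V e.s μ) : e.weight m =ᵐ[μ] fun x => ‖m x‖ ^ e.top :=
  MemLp.coeFn_toLp _

theorem norm_weight (m : Lp V e.s μ) : ‖e.weight m‖ = ‖m‖ ^ e.top := by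
  rw [weight, Lp.norm_toLp, eLpNorm_norm_rpow _ e.top_pos, sWeight_mul_top, Lp.norm_def,
    ENNReal.toReal_rpow]

theorem norm_lp_rpow (m : Lp V e.s μ) : ‖m‖ ^ (e.top + 2) = ∫ x, ‖m x‖ ^ (e.top + 2) ∂μ := by
  have h := e.top_pos
  rw [Lp.norm_def, (Lp.memLp m).eLpNorm_eq_integral_rpow_norm e.s_ne_zero e.s_ne_top, toReal_s,
    ENNReal.toReal_ofReal (by positivity), ← Real.rpow_mul (by positivity),
    inv_mul_cancel₀ (by linarith), Real.rpow_one]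

theorem integrable_norm_rpow (m : Lp V e.s μ) :
    Integrable (fun x => ‖m x‖ ^ (e.top + 2)) μ := by
  have := (Lp.memLp m).integrable_norm_rpow e.s_ne_zero e.s_ne_top
  rwa [toReal_s] at this

/-- The energy `∑ i, ∫ a_i |m| ^ (α_i + 2) / (α_i + 2)`, whose derivative is `fluxLp`. -/
noncomputable def energy (A : Fin (N + 1) → X → ℝ) (m : Lp V e.s μ) : ℝ :=
  ∫ x, e.potential (fun i => A i x) (m x) ∂μ

theorem energy_nonneg (hA : AdmissibleField lo up μ A) (m : Lp V e.s μ) : 0 ≤ e.energy A m :=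
  integral_nonneg_of_ae (hA.admissible.mono fun _ hx => e.potential_nonneg hx _)

variable [IsFiniteMeasure μ]

variable (μ) in
/-- The constant function `1` in the space of weights. -/
noncomputable def weightOne : Lp ℝ e.sWeight μ := Lp.const e.sWeight μ 1

theorem coeFn_one_add_weight_add_weight_smul (m n z : Lp E e.s μ) :
    ((e.weightOne μ + e.weight m + e.weight n) • z : Lp E e.sStar μ) =ᵐ[μ]
      fun x => (1 + ‖m x‖ ^ e.top + ‖n x‖ ^ e.top) • z x := by
  filter_upwards [Lp.coeFn_lpSMul (r := e.sStar) (e.weightOne μ + e.weight m + e.weight n) z,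
    Lp.coeFn_add (e.weightOne μ + e.weight m) (e.weight n),
    Lp.coeFn_add (e.weightOne μ) (e.weight m), Lp.coeFn_const e.sWeight μ (1 : ℝ),
    e.coeFn_weight m, e.coeFn_weight n] with x hz hadd hadd' hone hm hn
  rw [hz, Pi.smul_apply', hadd, Pi.add_apply, hadd', Pi.add_apply, weightOne, hone, hm, hn,
    Function.const_apply]

theorem norm_one_add_weight_add_weight_smul_le (m n z : Lp E e.s μ) :
    ‖((e.weightOne μ + e.weight m + e.weight n) • z : Lp E e.sStar μ)‖ ≤
      (‖e.weightOne μ‖ + ‖m‖ ^ e.top + ‖n‖ ^ e.top) * ‖z‖ := by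
  refine (Lp.norm_smul_le _ _).trans (mul_le_mul_of_nonneg_right ?_ (norm_nonneg _))
  rw [← norm_weight, ← norm_weight]
  exact norm_add₃_le

namespace AdmissibleField

variable (hA : AdmissibleField lo up μ A)
include hA

omit [IsFiniteMeasure μ] in
theorem aestronglyMeasurable_flux {m : X → E} (hm : AEStronglyMeasurable m μ) :
    AEStronglyMeasurable (fun x => e.flux (fun i => A i x) (m x)) μ := by
  unfold flux poly
  refine AEStronglyMeasurable.smul (Finset.aestronglyMeasurable_fun_sum _ fun i _ => ?_) hm
  exact (hA.aestronglyMeasurable i).mul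
    (hm.norm.aemeasurable.pow_const _).aestronglyMeasurable

theorem memLp_flux (m : Lp E e.s μ) :
    MemLp (fun x => e.flux (fun i => A i x) (m x)) e.sStar μ := by
  refine (Lp.memLp ((e.weightOne μ + e.weight m + e.weight (0 : Lp E e.s μ)) • m :
    Lp E e.sStar μ)).of_le_mul (c := up * (N + 1))
    (hA.aestronglyMeasurable_flux e (Lp.aestronglyMeasurable m)) ?_
  filter_upwards [hA.admissible, e.coeFn_one_add_weight_add_weight_smul m 0 m,
    Lp.coeFn_zero E e.s μ] with x hx hw hzero
  rw [hw, hzero, Pi.zero_apply, norm_zero, Real.zero_rpow e.top_pos.ne', add_zero, norm_smul,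
    Real.norm_of_nonneg (by positivity)]
  exact e.norm_flux_le hx (m x)

theorem integrable_potential (m : Lp E e.s μ) :
    Integrable (fun x => e.potential (fun i => A i x) (m x)) μ := by
  refine (integrable_inner_lp ((hA.memLp_flux e m).toLp _) m).mono ?_ ?_
  · unfold potential
    refine Finset.aestronglyMeasurable_fun_sum _ fun i _ => (hA.aestronglyMeasurable i).mul ?_
    exact (((Lp.aestronglyMeasurable m).norm.aemeasurable.pow_const _).div_const
      _).aestronglyMeasurable
  · filter_upwards [hA.admissible, (hA.memLp_flux e m).coeFn_toLp] with x hx hflux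
    rw [hflux, Real.norm_of_nonneg (e.potential_nonneg hx _)]
    exact (e.potential_le_inner_flux hx _).trans (le_abs_self _)

end AdmissibleField

/-- The superposition operator `m ↦ F(x, |m|) m` from `L^s` to `L^{s*}`. -/
noncomputable def fluxLp (hA : AdmissibleField lo up μ A) (m : Lp E e.s μ) : Lp E e.sStar μ :=
  (hA.memLp_flux e m).toLp _

theorem coeFn_fluxLp (hA : AdmissibleField lo up μ A) (m : Lp E e.s μ) :
    e.fluxLp hA m =ᵐ[μ] fun x => e.flux (fun i => A i x) (m x) :=
  MemLp.coeFn_toLp _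

theorem norm_fluxLp_sub_le (hA : AdmissibleField lo up μ A) (m n : Lp E e.s μ) :
    ‖e.fluxLp hA m - e.fluxLp hA n‖ ≤ up * (N + 1) * (e.top + 2) * 2 *
      ((‖e.weightOne μ‖ + ‖m‖ ^ e.top + ‖n‖ ^ e.top) * ‖m - n‖) := by
  have hup := hA.up_nonneg
  have htop := e.top_pos
  refine (Lp.norm_le_mul_norm_of_ae_le_mul (c := up * (N + 1) * (e.top + 2) * 2)
    (g := (e.weightOne μ + e.weight m + e.weight n) • (m - n)) ?_).trans
    (mul_le_mul_of_nonneg_left (e.norm_one_add_weight_add_weight_smul_le m n _) (by positivity))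
  filter_upwards [hA.admissible, e.coeFn_fluxLp hA m, e.coeFn_fluxLp hA n,
    e.coeFn_one_add_weight_add_weight_smul m n (m - n), Lp.coeFn_sub m n,
    Lp.coeFn_sub (e.fluxLp hA m) (e.fluxLp hA n)] with x hx hm hn hw hsub hflux
  rw [hflux, Pi.sub_apply, hm, hn, hw, hsub, Pi.sub_apply, norm_smul,
    Real.norm_of_nonneg (by positivity)]
  exact (e.norm_flux_sub_le hx _ _).trans_eq (by ring)

theorem norm_fluxLp_sub_coeff_le (hA : AdmissibleField lo up μ A) (hB : AdmissibleField lo up μ B)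
    (hδ0 : 0 ≤ δ) (hδ : ∀ᵐ x ∂μ, ∀ i, |A i x - B i x| ≤ δ) (n : Lp E e.s μ) :
    ‖e.fluxLp hA n - e.fluxLp hB n‖ ≤ δ * (N + 1) *
      ((‖e.weightOne μ‖ + ‖n‖ ^ e.top) * ‖n‖) := by
  have hbound := e.norm_one_add_weight_add_weight_smul_le n 0 n
  rw [norm_zero, Real.zero_rpow e.top_pos.ne', add_zero] at hbound
  refine (Lp.norm_le_mul_norm_of_ae_le_mul (c := δ * (N + 1))
    (g := (e.weightOne μ + e.weight n + e.weight (0 : Lp E e.s μ)) • n) ?_).trans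
    (mul_le_mul_of_nonneg_left hbound (by positivity))
  filter_upwards [hδ, e.coeFn_fluxLp hA n, e.coeFn_fluxLp hB n,
    e.coeFn_one_add_weight_add_weight_smul n 0 n, Lp.coeFn_zero E e.s μ,
    Lp.coeFn_sub (e.fluxLp hA n) (e.fluxLp hB n)] with x hx hnA hnB hw hzero hflux
  rw [hflux, Pi.sub_apply, hnA, hnB, hw, hzero, Pi.zero_apply, norm_zero,
    Real.zero_rpow e.top_pos.ne', add_zero, norm_smul, Real.norm_of_nonneg (by positivity)]
  exact e.norm_flux_sub_coeff_le hx _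

theorem tendsto_fluxLp {ι : Type*} {l : Filter ι} {C : ι → Fin (N + 1) → X → ℝ}
    (hC : ∀ k, AdmissibleField lo up μ (C k)) (hA : AdmissibleField lo up μ A) {δ : ι → ℝ}
    (hδ0 : ∀ k, 0 ≤ δ k) (hδ : ∀ k, ∀ᵐ x ∂μ, ∀ i, |C k i x - A i x| ≤ δ k)
    (hδlim : Tendsto δ l (𝓝 0)) {m : ι → Lp E e.s μ} {m₀ : Lp E e.s μ} (hm : Tendsto m l (𝓝 m₀)) :
    Tendsto (fun k => e.fluxLp (hC k) (m k)) l (𝓝 (e.fluxLp hA m₀)) := by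
  have hpow : Tendsto (fun k => ‖m k‖ ^ e.top) l (𝓝 (‖m₀‖ ^ e.top)) :=
    hm.norm.rpow_const (Or.inr e.top_pos.le)
  have hbound := ((((hpow.const_add ‖e.weightOne μ‖).add_const (‖m₀‖ ^ e.top)).mul
    (tendsto_iff_norm_sub_tendsto_zero.1 hm)).const_mul (up * (N + 1) * (e.top + 2) * 2)).add
    ((hδlim.mul_const (N + 1 : ℝ)).mul_const ((‖e.weightOne μ‖ + ‖m₀‖ ^ e.top) * ‖m₀‖))
  simp only [mul_zero, zero_mul, add_zero] at hbound
  refine tendsto_iff_norm_sub_tendsto_zero.2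
    (squeeze_zero (fun k => norm_nonneg _) (fun k => ?_) hbound)
  exact (norm_sub_le_norm_sub_add_norm_sub _ (e.fluxLp (hC k) m₀) _).trans
    (add_le_add (e.norm_fluxLp_sub_le (hC k) _ _)
      (e.norm_fluxLp_sub_coeff_le (hC k) hA (hδ0 k) (hδ k) _))

theorem continuous_fluxLp (hA : AdmissibleField lo up μ A) :
    Continuous (e.fluxLp hA : Lp E e.s μ → Lp E e.sStar μ) :=
  continuous_iff_continuousAt.2 fun _ => e.tendsto_fluxLp (fun _ => hA) hA (fun _ => le_rfl)
    (fun _ => ae_of_all _ fun x i => (congrArg _ (sub_self (A i x))).trans_le abs_zero.le)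
    tendsto_const_nhds tendsto_id

theorem rpow_norm_sub_le_innerPairing_fluxLp_sub (hA : AdmissibleField lo up μ A)
    (hB : AdmissibleField lo up μ B) (hδ : ∀ᵐ x ∂μ, ∀ i, |A i x - B i x| ≤ δ)
    (m n : Lp E e.s μ) :
    lo / 4 * (1 / 2) ^ e.top * ‖m - n‖ ^ (e.top + 2)
        - ((N + 1) / lo) ^ 2 * δ ^ 2 * innerPairing μ E e.sStar e.s (e.fluxLp hB n) n ≤
      innerPairing μ E e.sStar e.s (e.fluxLp hA m - e.fluxLp hB n) (m - n) := by
  have hpow := (e.integrable_norm_rpow (m - n)).const_mul (lo / 4 * (1 / 2) ^ e.top)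
  have hself := (integrable_inner_lp (e.fluxLp hB n) n).const_mul (((N + 1) / lo) ^ 2 * δ ^ 2)
  rw [norm_lp_rpow, innerPairing_eq_integral, innerPairing_eq_integral, ← integral_const_mul,
    ← integral_const_mul, ← integral_sub hpow hself]
  refine integral_mono_ae (hpow.sub hself) (integrable_inner_lp _ _) ?_
  filter_upwards [hδ, hA.admissible, hB.admissible, e.coeFn_fluxLp hA m, e.coeFn_fluxLp hB n,
    Lp.coeFn_sub m n, Lp.coeFn_sub (e.fluxLp hA m) (e.fluxLp hB n)] with x hx ha hb hm hn hsub hflux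
  rw [hflux, hsub, Pi.sub_apply, Pi.sub_apply, hm, hn]
  exact e.rpow_norm_sub_le_inner_flux_sub hA.lo_pos ha hb hx _ _

theorem innerPairing_fluxLp_self_nonneg (hA : AdmissibleField lo up μ A) (m : Lp E e.s μ) :
    0 ≤ innerPairing μ E e.sStar e.s (e.fluxLp hA m) m := by
  rw [innerPairing_eq_integral]
  refine integral_nonneg_of_ae ?_
  filter_upwards [hA.admissible, e.coeFn_fluxLp hA m] with x hx hm
  rw [hm]
  exact e.inner_flux_self_nonneg hA.lo_pos hx _

theorem energy_add_innerPairing_le (hA : AdmissibleField lo up μ A) (m n : Lp E e.s μ) :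
    e.energy A m + innerPairing μ E e.sStar e.s (e.fluxLp hA m) (n - m) ≤ e.energy A n := by
  have hm := hA.integrable_potential e m
  have hinner := integrable_inner_lp (e.fluxLp hA m) (n - m)
  rw [innerPairing_eq_integral, energy, ← integral_add hm hinner]
  refine integral_mono_ae (hm.add hinner) (hA.integrable_potential e n) ?_
  filter_upwards [hA.admissible, e.coeFn_fluxLp hA m, Lp.coeFn_sub n m] with x hx hflux hsub
  rw [hflux, hsub]
  exact e.potential_add_inner_le hx _ _

theorem energy_midpoint_le (hA : AdmissibleField lo up μ A) (m n : Lp E e.s μ) :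
    e.energy A ((1 / 2 : ℝ) • (m + n))
        + lo / (e.top + 2) * ‖(1 / 2 : ℝ) • (m - n)‖ ^ (e.top + 2) ≤
      (e.energy A m + e.energy A n) / 2 := by
  have hmid := hA.integrable_potential e ((1 / 2 : ℝ) • (m + n))
  have hpow := (e.integrable_norm_rpow ((1 / 2 : ℝ) • (m - n))).const_mul (lo / (e.top + 2))
  have hm := hA.integrable_potential e m
  have hn := hA.integrable_potential e n
  rw [energy, energy, energy, norm_lp_rpow, ← integral_const_mul, ← integral_add hmid hpow,
    ← integral_add hm hn, ← integral_div]
  refine integral_mono_ae (hmid.add hpow) ((hm.add hn).div_const 2) ?_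
  filter_upwards [hA.admissible, Lp.coeFn_smul (1 / 2 : ℝ) (m + n), Lp.coeFn_add m n,
    Lp.coeFn_smul (1 / 2 : ℝ) (m - n), Lp.coeFn_sub m n] with x hx hsmul hadd hsmul' hsub
  rw [hsmul, hsmul', Pi.smul_apply, Pi.smul_apply, hadd, hsub]
  exact e.potential_midpoint_le hA.lo_pos hx _ _

end Nemytskii

end ForchheimerExponents

section Resolvent

theorem cauchySeq_of_mul_rpow_le {V : Type*} [SeminormedAddCommGroup V] {x : ℕ → V} {c r : ℝ}
    (hc : 0 < c) (hr : 0 < r) {b : ℕ × ℕ → ℝ} (hb : Tendsto b atTop (𝓝 0))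
    (h : ∀ k l, c * ‖x k - x l‖ ^ r ≤ b (k, l)) : CauchySeq x := by
  rw [cauchySeq_iff_tendsto_dist_atTop_0]
  have hroot : Tendsto (fun n => (b n / c) ^ r⁻¹) atTop (𝓝 0) := by
    have := (hb.div_const c).rpow_const (p := r⁻¹) (Or.inr (inv_pos.2 hr).le)
    rwa [zero_div, Real.zero_rpow (inv_pos.2 hr).ne'] at this
  refine squeeze_zero (fun _ => dist_nonneg) (fun n => ?_) hroot
  have hpow : ‖x n.1 - x n.2‖ ^ r ≤ b n / c := (le_div_iff₀' hc).2 (h n.1 n.2)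
  rw [dist_eq_norm]
  exact (Real.le_rpow_inv_iff_of_pos (norm_nonneg _)
    ((Real.rpow_nonneg (norm_nonneg _) _).trans hpow) hr).2 hpow

theorem half_norm_sq_add_inner_le {H : Type*} [NormedAddCommGroup H] [InnerProductSpace ℝ H]
    (x y : H) : ‖x‖ ^ 2 / 2 + inner ℝ x (y - x) ≤ ‖y‖ ^ 2 / 2 := by
  have h := norm_sub_sq_real y x
  rw [inner_sub_right, real_inner_self_eq_norm_sq, real_inner_comm]
  nlinarith [sq_nonneg ‖y - x‖]

variable {d N : ℕ} {Ω : Opens (Euc d)} {e : ForchheimerExponents N} {lo up : ℝ}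
  {A : Fin (N + 1) → Euc d → ℝ} {Q : Lp ℝ 2 (volOn Ω) →L[ℝ] Lp ℝ 2 (volOn Ω)} {τ I : ℝ}
  {h : Lp ℝ 2 (volOn Ω)}

variable (e A Q τ h) in
/-- The functional whose Euler–Lagrange equation is the mixed form of the resolvent equation
`u + τ Q (div m) = h`. -/
noncomputable def resolventEnergy (w : Wdiv Ω e.s) : ℝ :=
  e.energy A w.1.1 + τ * (‖Q w.1.2 - τ⁻¹ • h‖ ^ 2 / 2)

variable [IsFiniteMeasure (volOn Ω)]
  (hA : ForchheimerExponents.AdmissibleField lo up (volOn Ω) A)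
include hA

theorem resolventEnergy_add_le (hτ : 0 < τ) (w z : Wdiv Ω e.s) :
    resolventEnergy e A Q τ h w
      + (innerPairing (volOn Ω) (Euc d) e.sStar e.s (e.fluxLp hA w.1.1) (z - w).1.1
        + τ * inner ℝ (Q w.1.2 - τ⁻¹ • h) (Q (z - w).1.2)) ≤ resolventEnergy e A Q τ h z := by
  have henergy := e.energy_add_innerPairing_le hA w.1.1 z.1.1
  have hsq := mul_le_mul_of_nonneg_left
    (half_norm_sq_add_inner_le (Q w.1.2 - τ⁻¹ • h) (Q z.1.2 - τ⁻¹ • h)) hτ.le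
  rw [sub_sub_sub_cancel_right, ← map_sub] at hsq
  simp only [resolventEnergy, Submodule.coe_sub, Prod.fst_sub, Prod.snd_sub]
  linarith

theorem resolventEnergy_midpoint_le (w z : Wdiv Ω e.s) :
    resolventEnergy e A Q τ h ((1 / 2 : ℝ) • (w + z))
      + (lo / (e.top + 2) * (1 / 2) ^ (e.top + 2) * ‖w.1.1 - z.1.1‖ ^ (e.top + 2)
        + τ / 8 * ‖Q w.1.2 - Q z.1.2‖ ^ 2) ≤
      (resolventEnergy e A Q τ h w + resolventEnergy e A Q τ h z) / 2 := by
  have henergy := e.energy_midpoint_le hA w.1.1 z.1.1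
  rw [norm_smul (1 / 2 : ℝ) (w.1.1 - z.1.1), Real.mul_rpow (norm_nonneg _) (norm_nonneg _),
    Real.norm_of_nonneg one_half_pos.le] at henergy
  have hparallelogram := parallelogram_law_with_norm ℝ (Q w.1.2 - τ⁻¹ • h) (Q z.1.2 - τ⁻¹ • h)
  rw [sub_sub_sub_cancel_right] at hparallelogram
  have hmid : ‖Q ((1 / 2 : ℝ) • (w + z)).1.2 - τ⁻¹ • h‖ ^ 2 =
      ‖(Q w.1.2 - τ⁻¹ • h) + (Q z.1.2 - τ⁻¹ • h)‖ ^ 2 / 4 := by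
    have : Q ((1 / 2 : ℝ) • (w + z)).1.2 - τ⁻¹ • h =
        (1 / 2 : ℝ) • ((Q w.1.2 - τ⁻¹ • h) + (Q z.1.2 - τ⁻¹ • h)) := by
      simp only [Submodule.coe_smul, Submodule.coe_add, Prod.smul_snd, Prod.snd_add, map_smul,
        map_add]
      module
    rw [this, norm_smul, mul_pow, Real.norm_of_nonneg one_half_pos.le]
    ring
  simp only [resolventEnergy, hmid]
  simp only [Submodule.coe_smul, Submodule.coe_add, Prod.smul_fst, Prod.fst_add]
  linear_combination henergy + τ / 8 * hparallelogram

omit [IsFiniteMeasure (volOn Ω)] in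
theorem resolventEnergy_nonneg (hτ : 0 < τ) (w : Wdiv Ω e.s) : 0 ≤ resolventEnergy e A Q τ h w :=
  add_nonneg (e.energy_nonneg hA _) (by positivity)

theorem cauchySeq_of_resolventEnergy_le {c : ℝ≥0} (hQ : AntilipschitzWith c Q) (hτ : 0 < τ)
    (hI : ∀ w, I ≤ resolventEnergy e A Q τ h w) {m : ℕ → Wdiv Ω e.s} {b : ℕ → ℝ}
    (hm : ∀ k, resolventEnergy e A Q τ h (m k) ≤ I + b k) (hb : Tendsto b atTop (𝓝 0)) :
    CauchySeq m := by
  have hlo := hA.lo_pos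
  have htop := e.top_pos
  set κ := lo / (e.top + 2) * (1 / 2) ^ (e.top + 2)
  have hκ : 0 < κ := by positivity
  have hbound : ∀ k l, κ * ‖(m k).1.1 - (m l).1.1‖ ^ (e.top + 2)
      + τ / 8 * ‖Q (m k).1.2 - Q (m l).1.2‖ ^ 2 ≤ (b k + b l) / 2 := fun k l => by
    linarith [resolventEnergy_midpoint_le (Q := Q) (τ := τ) (h := h) hA (m k) (m l),
      hI ((1 / 2 : ℝ) • (m k + m l)), hm k, hm l]
  have hlim : Tendsto (fun n : ℕ × ℕ => (b n.1 + b n.2) / 2) atTop (𝓝 0) := by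
    rw [← prod_atTop_atTop_eq]
    simpa using ((hb.comp tendsto_fst).add (hb.comp tendsto_snd)).div_const (2 : ℝ)
  have hfield : CauchySeq fun k => (m k).1.1 :=
    cauchySeq_of_mul_rpow_le hκ (by positivity) hlim fun k l =>
      (le_add_of_nonneg_right (by positivity)).trans (hbound k l)
  have hQdiv : CauchySeq fun k => Q (m k).1.2 := by
    refine cauchySeq_of_mul_rpow_le (c := τ / 8) (by positivity) two_pos hlim fun k l => ?_
    rw [Real.rpow_two]
    exact (le_add_of_nonneg_left (by positivity)).trans (hbound k l)
  have hdiv : CauchySeq fun k => (m k).1.2 :=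
    (hQ.isUniformInducing Q.uniformContinuous).cauchy_map_iff.1 hQdiv
  exact isUniformEmbedding_subtype_val.isUniformInducing.cauchy_map_iff.1 (hfield.prodMk hdiv)

theorem resolventEnergy_le_of_tendsto (hτ : 0 < τ) {m : ℕ → Wdiv Ω e.s} {m₀ : Wdiv Ω e.s}
    (hm : Tendsto m atTop (𝓝 m₀)) {b : ℕ → ℝ}
    (hJ : ∀ k, resolventEnergy e A Q τ h (m k) ≤ b k) (hb : Tendsto b atTop (𝓝 I)) :
    resolventEnergy e A Q τ h m₀ ≤ I := by
  have hcont : Continuous fun w : Wdiv Ω e.s => resolventEnergy e A Q τ h m₀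
      + (innerPairing (volOn Ω) (Euc d) e.sStar e.s (e.fluxLp hA m₀.1.1) (w - m₀).1.1
        + τ * inner ℝ (Q m₀.1.2 - τ⁻¹ • h) (Q (w - m₀).1.2)) := by
    fun_prop
  have hlim := (hcont.tendsto m₀).comp hm
  simp only [sub_self, Submodule.coe_zero, Prod.fst_zero, Prod.snd_zero, map_zero,
    inner_zero_right, mul_zero, add_zero] at hlim
  exact le_of_tendsto_of_tendsto' hlim hb fun k =>
    (resolventEnergy_add_le hA hτ m₀ (m k)).trans (hJ k)

theorem exists_forall_resolventEnergy_le {c : ℝ≥0} (hQ : AntilipschitzWith c Q) (hτ : 0 < τ) :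
    ∃ m : Wdiv Ω e.s, ∀ w, resolventEnergy e A Q τ h m ≤ resolventEnergy e A Q τ h w := by
  have hI : ∀ w, ⨅ w, resolventEnergy e A Q τ h w ≤ resolventEnergy e A Q τ h w :=
    ciInf_le ⟨0, forall_mem_range.2 (resolventEnergy_nonneg hA hτ)⟩
  have hb := tendsto_one_div_add_atTop_nhds_zero_nat (𝕜 := ℝ)
  choose m hm using fun k : ℕ => exists_lt_of_ciInf_lt
    (lt_add_of_pos_right (⨅ w, resolventEnergy e A Q τ h w) (Nat.one_div_pos_of_nat (n := k)))
  have : CompleteSpace (Wdiv Ω e.s) := (isClosed_Wdiv e.sStar).completeSpace_coe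
  obtain ⟨m₀, hm₀⟩ := cauchySeq_tendsto_of_complete
    (cauchySeq_of_resolventEnergy_le hA hQ hτ hI (fun k => (hm k).le) hb)
  refine ⟨m₀, fun w => le_trans ?_ (hI w)⟩
  exact resolventEnergy_le_of_tendsto hA hτ hm₀ (fun k => (hm k).le)
    (by simpa using hb.const_add (⨅ w, resolventEnergy e A Q τ h w))

theorem firstVariation_resolventEnergy_nonneg (hτ : 0 < τ) {m : Wdiv Ω e.s}
    (hm : ∀ w, resolventEnergy e A Q τ h m ≤ resolventEnergy e A Q τ h w) (v : Wdiv Ω e.s) :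
    0 ≤ innerPairing (volOn Ω) (Euc d) e.sStar e.s (e.fluxLp hA m.1.1) v.1.1
      + τ * inner ℝ (Q m.1.2 - τ⁻¹ • h) (Q v.1.2) := by
  have hflux : Continuous fun t : ℝ => e.fluxLp hA (m.1.1 + t • v.1.1) :=
    (e.continuous_fluxLp hA).comp (by fun_prop)
  have hcont : Continuous fun t : ℝ => innerPairing (volOn Ω) (Euc d) e.sStar e.s
      (e.fluxLp hA (m.1.1 + t • v.1.1)) v.1.1
        + τ * inner ℝ (Q (m.1.2 + t • v.1.2) - τ⁻¹ • h) (Q v.1.2) := by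
    fun_prop
  have hlim := (hcont.tendsto 0).mono_left (nhdsWithin_le_nhds (s := Ioi 0))
  simp only [zero_smul, add_zero] at hlim
  refine ge_of_tendsto hlim (eventually_mem_nhdsWithin.mono fun t ht => ?_)
  have hle := (resolventEnergy_add_le hA hτ (m + t • v) m).trans (hm (m + t • v))
  have hsub : m - (m + t • v) = -(t • v) := by abel
  simp only [hsub, Submodule.coe_neg, Submodule.coe_smul, Prod.fst_neg, Prod.snd_neg,
    Prod.smul_fst, Prod.smul_snd, Submodule.coe_add, Prod.fst_add, Prod.snd_add, map_neg,
    map_smul, inner_neg_right, inner_smul_right,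
    smul_eq_mul] at hle
  refine nonneg_of_mul_nonneg_right ?_ ht
  linarith

theorem exists_resolvent {c : ℝ≥0} (hQ : AntilipschitzWith c Q) (hQs : Q.toLinearMap.IsSymmetric)
    (hτ : 0 < τ) (h : Lp ℝ 2 (volOn Ω)) :
    ∃ m : Wdiv Ω e.s, ∀ v : Wdiv Ω e.s,
      innerPairing (volOn Ω) (Euc d) e.sStar e.s (e.fluxLp hA m.1.1) v.1.1 =
        inner ℝ (Q (h - τ • Q m.1.2)) v.1.2 := by
  obtain ⟨m, hm⟩ := exists_forall_resolventEnergy_le (h := h) hA hQ hτ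
  refine ⟨m, fun v => ?_⟩
  have hpos := firstVariation_resolventEnergy_nonneg hA hτ hm v
  have hneg := firstVariation_resolventEnergy_nonneg hA hτ hm (-v)
  simp only [Submodule.coe_neg, Prod.fst_neg, Prod.snd_neg, map_neg, inner_neg_right] at hneg
  have hscale : inner ℝ (Q (h - τ • Q m.1.2)) v.1.2 =
      -(τ * inner ℝ (Q m.1.2 - τ⁻¹ • h) (Q v.1.2)) := by
    rw [hQs.apply_clm, ← real_inner_smul_left, smul_sub, smul_inv_smul₀ hτ.ne', ← inner_neg_left,
      neg_sub]
  rw [hscale]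
  linarith

end Resolvent

section Flow

variable {d N : ℕ} {Ω : Opens (Euc d)} {e : ForchheimerExponents N} {lo up : ℝ} {L : ℝ≥0}
  {A : ℝ → Fin (N + 1) → Euc d → ℝ} {Q : Lp ℝ 2 (volOn Ω) →L[ℝ] Lp ℝ 2 (volOn Ω)}

/-- A family of admissible coefficient fields that is `L`-Lipschitz in time with respect to the
essential supremum norm. -/
structure AdmissibleEvolution (lo up : ℝ) (L : ℝ≥0) (Ω : Opens (Euc d))
    (A : ℝ → Fin (N + 1) → Euc d → ℝ) : Prop where
  admissible : ∀ t, ForchheimerExponents.AdmissibleField lo up (volOn Ω) (A t)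
  lipschitz : ∀ t r, ∀ᵐ x ∂volOn Ω, ∀ i, |A t i x - A r i x| ≤ L * |t - r|

variable [IsFiniteMeasure (volOn Ω)]

/-- The field `m` and the density `ρ` satisfy the momentum equation `F(·, t, |m|) m = -∇ρ` at
time `t`, in weak form. -/
def IsMomentum (hA : AdmissibleEvolution lo up L Ω A) (t : ℝ) (ρ : Lp ℝ 2 (volOn Ω))
    (m : Wdiv Ω e.s) : Prop :=
  ∀ v : Wdiv Ω e.s, innerPairing (volOn Ω) (Euc d) e.sStar e.s
    (e.fluxLp (hA.admissible t) m.1.1) v.1.1 = inner ℝ ρ v.1.2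

variable (e) in
/-- The operator `u ↦ Q (div m)`, where the field `m` is determined by the density `Q u` through
the momentum equation. -/
def FlowRel (hA : AdmissibleEvolution lo up L Ω A)
    (Q : Lp ℝ 2 (volOn Ω) →L[ℝ] Lp ℝ 2 (volOn Ω)) (t : ℝ) (u a : Lp ℝ 2 (volOn Ω)) : Prop :=
  ∃ m : Wdiv Ω e.s, a = Q m.1.2 ∧ IsMomentum hA t (Q u) m

variable {hA : AdmissibleEvolution lo up L Ω A}

theorem isMomentum_of_ae_flux_eq_neg_grad {t : ℝ} (ρ : L2W0 Ω e.sStar) (m : Wdiv Ω e.s)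
    (h : ∀ᵐ x ∂volOn Ω, e.flux (fun i => A t i x) (m.1.1 x) = -ρ.1.2 x) :
    IsMomentum hA t ρ.1.1 m := by
  intro v
  have htrace := inner_div_add_innerPairing_grad ρ v
  rw [real_inner_comm, add_eq_zero_iff_eq_neg, innerPairing_eq_integral, ← integral_neg] at htrace
  rw [htrace, innerPairing_eq_integral]
  refine integral_congr_ae ?_
  filter_upwards [h, e.coeFn_fluxLp (hA.admissible t) m.1.1] with x hx hflux
  rw [hflux, hx, inner_neg_left, real_inner_comm]

namespace IsMomentum

variable {t r : ℝ} {ρ σ : Lp ℝ 2 (volOn Ω)} {m n : Wdiv Ω e.s}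

theorem mem_L2W0 (hm : IsMomentum hA t ρ m) :
    (ρ, -e.fluxLp (hA.admissible t) m.1.1) ∈ L2W0 Ω e.sStar := by
  refine mem_L2W0_of_forall_Wdiv (q := e.s) e.sStar_le_two e.s_ne_top fun w => ?_
  have hw := hm w
  rw [innerPairing_eq_integral] at hw
  rw [real_inner_comm, ← hw, map_neg, add_neg_eq_zero, innerPairing_eq_integral]
  exact integral_congr_ae (ae_of_all _ fun x => real_inner_comm _ _)

theorem inner_div_nonneg (hm : IsMomentum hA t ρ m) : 0 ≤ inner ℝ m.1.2 ρ := by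
  rw [real_inner_comm, ← hm m]
  exact e.innerPairing_fluxLp_self_nonneg (hA.admissible t) m.1.1

theorem rpow_norm_sub_le_inner (hm : IsMomentum hA t ρ m) (hn : IsMomentum hA r σ n) :
    lo / 4 * (1 / 2) ^ e.top * ‖m.1.1 - n.1.1‖ ^ (e.top + 2)
        - ((N + 1) / lo * L) ^ 2 * (t - r) ^ 2 * inner ℝ n.1.2 σ ≤
      inner ℝ (m.1.2 - n.1.2) (ρ - σ) := by
  have hmono := e.rpow_norm_sub_le_innerPairing_fluxLp_sub (hA.admissible t) (hA.admissible r)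
    (hA.lipschitz t r) m.1.1 n.1.1
  have hm' := hm (m - n)
  have hn' := hn (m - n)
  simp only [Submodule.coe_sub, Prod.fst_sub, Prod.snd_sub] at hm' hn'
  rw [map_sub (innerPairing (volOn Ω) (Euc d) e.sStar e.s), sub_apply, hm', hn', hn n,
    ← inner_sub_left, real_inner_comm (m.1.2 - n.1.2), real_inner_comm n.1.2, mul_pow (L : ℝ),
    sq_abs, ← mul_assoc, ← mul_pow] at hmono
  exact hmono

theorem unique (hm : IsMomentum hA t ρ m) (hn : IsMomentum hA t ρ n) : m = n := by
  have hlo := (hA.admissible t).lo_pos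
  refine Wdiv.ext_field (by_contra fun hne => ?_)
  have hpos : 0 < ‖m.1.1 - n.1.1‖ := norm_pos_iff.2 (sub_ne_zero.2 hne)
  have hpow : 0 < lo / 4 * (1 / 2) ^ e.top * ‖m.1.1 - n.1.1‖ ^ (e.top + 2) := by positivity
  have hle := hm.rpow_norm_sub_le_inner hn
  rw [sub_self t, sub_self ρ, inner_zero_right, zero_pow two_ne_zero, mul_zero, zero_mul,
    sub_zero] at hle
  exact hpow.not_ge hle

variable {t : ℕ → ℝ} {t₀ : ℝ} {ρ : ℕ → Lp ℝ 2 (volOn Ω)} {ρ₀ : Lp ℝ 2 (volOn Ω)}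
  {m : ℕ → Wdiv Ω e.s} {M : ℝ}

theorem cauchySeq_field (hm : ∀ k, IsMomentum hA (t k) (ρ k) (m k)) (ht : Tendsto t atTop (𝓝 t₀))
    (hρ : Tendsto ρ atTop (𝓝 ρ₀)) (hM : ∀ k, ‖(m k).1.2‖ ≤ M) :
    CauchySeq fun k => (m k).1.1 := by
  have hlo := (hA.admissible 0).lo_pos
  have htop := e.top_pos
  set κ := ((N + 1) / lo * L) ^ 2
  have hlim : Tendsto (fun n : ℕ × ℕ => 2 * M * ‖ρ n.1 - ρ n.2‖
      + κ * (t n.1 - t n.2) ^ 2 * (M * ‖ρ n.2‖)) atTop (𝓝 0) := by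
    rw [← prod_atTop_atTop_eq]
    have ht₁ := ht.comp (tendsto_fst (g := (atTop : Filter ℕ)))
    have ht₂ := ht.comp (tendsto_snd (f := (atTop : Filter ℕ)))
    have hρ₁ := hρ.comp (tendsto_fst (g := (atTop : Filter ℕ)))
    have hρ₂ := hρ.comp (tendsto_snd (f := (atTop : Filter ℕ)))
    simpa using (((hρ₁.sub hρ₂).norm.const_mul (2 * M))).add
      ((((ht₁.sub ht₂).pow 2).const_mul κ).mul (hρ₂.norm.const_mul M))
  refine cauchySeq_of_mul_rpow_le (c := lo / 4 * (1 / 2) ^ e.top) (r := e.top + 2) (by positivity)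
    (by positivity) hlim fun k l => ?_
  have hinner : inner ℝ ((m k).1.2 - (m l).1.2) (ρ k - ρ l) ≤ 2 * M * ‖ρ k - ρ l‖ := by
    refine (real_inner_le_norm _ _).trans ?_
    gcongr
    exact (norm_sub_le _ _).trans (by linarith [hM k, hM l])
  have hself : κ * (t k - t l) ^ 2 * inner ℝ (m l).1.2 (ρ l) ≤
      κ * (t k - t l) ^ 2 * (M * ‖ρ l‖) := by
    gcongr
    exact (real_inner_le_norm _ _).trans (by gcongr; exact hM l)
  linarith [(hm k).rpow_norm_sub_le_inner (hm l)]

theorem exists_tendsto (hm : ∀ k, IsMomentum hA (t k) (ρ k) (m k)) (ht : Tendsto t atTop (𝓝 t₀))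
    (hρ : Tendsto ρ atTop (𝓝 ρ₀)) (hM : ∀ k, ‖(m k).1.2‖ ≤ M) :
    ∃ m₀ : Wdiv Ω e.s, IsMomentum hA t₀ ρ₀ m₀ ∧
      Tendsto (fun k => (m k).1.1) atTop (𝓝 m₀.1.1) ∧
      Tendsto (fun k => e.fluxLp (hA.admissible (t k)) (m k).1.1) atTop
        (𝓝 (e.fluxLp (hA.admissible t₀) m₀.1.1)) ∧
      ∀ h, Tendsto (fun k => inner ℝ (m k).1.2 h) atTop (𝓝 (inner ℝ m₀.1.2 h)) := by
  obtain ⟨v, hv⟩ := cauchySeq_tendsto_of_complete (cauchySeq_field hm ht hρ hM)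
  obtain ⟨m₀, rfl, hdiv⟩ := exists_weak_limit_div e.sStar hv hM
  have hδ : Tendsto (fun k => L * |t k - t₀|) atTop (𝓝 0) := by
    simpa using ((ht.sub_const t₀).abs).const_mul (L : ℝ)
  have hflux := e.tendsto_fluxLp (fun k => hA.admissible (t k)) (hA.admissible t₀)
    (fun k => by positivity) (fun k => hA.lipschitz (t k) t₀) hδ hv
  refine ⟨m₀, fun w => ?_, hv, hflux, hdiv⟩
  have hleft := ((continuous_innerPairing_left e.s w.1.1).tendsto _).comp hflux
  exact tendsto_nhds_unique hleft
    ((hρ.inner tendsto_const_nhds).congr fun k => (hm k w).symm)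

theorem continuousOn {S : Set ℝ} {ρ : ℝ → Lp ℝ 2 (volOn Ω)} {m : ℝ → Wdiv Ω e.s}
    (hm : ∀ t ∈ S, IsMomentum hA t (ρ t) (m t)) (hρ : ContinuousOn ρ S)
    (hM : ∀ t ∈ S, ‖(m t).1.2‖ ≤ M) :
    ContinuousOn (fun t => (m t).1.1) S ∧
      ContinuousOn (fun t => e.fluxLp (hA.admissible t) (m t).1.1) S ∧
      ∀ h, ContinuousOn (fun t => inner ℝ (m t).1.2 h) S := by
  have hlim : ∀ (t : ℕ → S) (t₀ : S), Tendsto t atTop (𝓝 t₀) →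
      Tendsto (fun k => (m (t k)).1.1) atTop (𝓝 (m t₀).1.1) ∧
      Tendsto (fun k => e.fluxLp (hA.admissible (t k)) (m (t k)).1.1) atTop
        (𝓝 (e.fluxLp (hA.admissible t₀) (m t₀).1.1)) ∧
      ∀ h, Tendsto (fun k => inner ℝ (m (t k)).1.2 h) atTop (𝓝 (inner ℝ (m t₀).1.2 h)) := by
    intro t t₀ ht
    obtain ⟨n, hn, htendsto⟩ := exists_tendsto (fun k => hm (t k) (t k).2)
      ((continuous_subtype_val.tendsto t₀).comp ht) ((hρ.domRestrict.tendsto t₀).comp ht)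
      (fun k => hM (t k) (t k).2)
    rwa [(hm t₀ t₀.2).unique hn]
  simp only [continuousOn_iff_continuous_domRestrict, continuous_iff_seqContinuous]
  exact ⟨fun t t₀ ht => (hlim t t₀ ht).1, fun t t₀ ht => (hlim t t₀ ht).2.1,
    fun h t t₀ ht => (hlim t t₀ ht).2.2 h⟩

end IsMomentum

namespace FlowRel

theorem isMaximalMonotoneFamily {c : ℝ≥0} (hQ : AntilipschitzWith c Q)
    (hQs : Q.toLinearMap.IsSymmetric) :
    ∃ K, IsMaximalMonotoneFamily (FlowRel e hA Q) K := by
  have hlo := (hA.admissible 0).lo_pos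
  refine ⟨(((N + 1) / lo * L) ^ 2).toNNReal, ?_, ?_, ?_⟩
  · rintro t u a ⟨m, rfl, hm⟩
    rw [hQs.apply_clm]
    exact hm.inner_div_nonneg
  · rintro t r u a w b ⟨m, rfl, hm⟩ ⟨n, rfl, hn⟩
    have hpow : 0 ≤ lo / 4 * (1 / 2) ^ e.top * ‖m.1.1 - n.1.1‖ ^ (e.top + 2) := by positivity
    rw [← map_sub, hQs.apply_clm, hQs.apply_clm, map_sub,
      Real.coe_toNNReal _ (sq_nonneg _)]
    linarith [hm.rpow_norm_sub_le_inner hn]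
  · intro t τ h hτ
    obtain ⟨m, hm⟩ := exists_resolvent (hA.admissible t) hQ hQs hτ h
    exact ⟨h - τ • Q m.1.2, Q m.1.2, ⟨m, rfl, hm⟩, sub_add_cancel _ _⟩

theorem isDemiclosed {c : ℝ≥0} (hQ : AntilipschitzWith c Q) (hQs : Q.toLinearMap.IsSymmetric) :
    IsDemiclosed (FlowRel e hA Q) := by
  intro t u a t₀ u₀ M ht hu hM hG
  choose m hQm hm using hG
  have hbound : ∀ k, ‖(m k).1.2‖ ≤ c * M := fun k =>
    (Q.bound_of_antilipschitz hQ _).trans (by gcongr; exact hQm k ▸ hM k)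
  obtain ⟨m₀, hm₀, -, -, hdiv⟩ :=
    IsMomentum.exists_tendsto hm ht ((Q.continuous.tendsto _).comp hu) hbound
  refine ⟨Q m₀.1.2, ⟨m₀, rfl, hm₀⟩, fun w => ?_⟩
  rw [hQs.apply_clm]
  refine (hdiv (Q w)).congr fun k => ?_
  rw [hQm k, hQs.apply_clm]

end FlowRel

end Flow

section WeakTimeDerivative

variable {X H : Type*} [MeasurableSpace X] {μ : Measure X} [NormedAddCommGroup H]
  [InnerProductSpace ℝ H] {T : ℝ}

-- Pettis' theorem: `a` is the limit of its projections onto an exhausting sequence of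
-- finite dimensional subspaces.
theorem aestronglyMeasurable_of_inner [SeparableSpace H] {a : X → H}
    (ha : ∀ w, AEStronglyMeasurable (fun x => (inner ℝ w (a x) : ℝ)) μ) :
    AEStronglyMeasurable a μ := by
  set U : ℕ → Submodule ℝ H := fun n => Submodule.span ℝ (denseSeq H '' Iic n)
  have hfin : ∀ n, FiniteDimensional ℝ (U n) := fun n =>
    FiniteDimensional.span_of_finite ℝ ((finite_Iic n).image _)
  have hmono : Monotone U := fun i j hij =>
    Submodule.span_mono (image_mono (Iic_subset_Iic.2 hij))
  have htop : ⊤ ≤ (⨆ n, U n).topologicalClosure := by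
    intro x _
    refine closure_mono ?_ (denseRange_denseSeq H x)
    rintro _ ⟨n, rfl⟩
    exact le_iSup U n (Submodule.subset_span (mem_image_of_mem _ self_mem_Iic))
  refine aestronglyMeasurable_of_tendsto_ae atTop (f := fun n x => (U n).starProjection (a x))
    (fun n => ?_) (ae_of_all _ fun x => Submodule.starProjection_tendsto_self U hmono (a x) htop)
  set b := stdOrthonormalBasis ℝ (U n)
  have hsum : ∀ x, (U n).starProjection (a x) = ∑ i, (inner ℝ (b i : H) (a x) : ℝ) • (b i : H) :=
    fun x => by simp [b.starProjection_eq_sum_rankOne]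
  simp_rw [hsum]
  exact Finset.aestronglyMeasurable_fun_sum _ fun i _ => (ha _).smul_const _

theorem memLp_top_of_continuousOn_Icc {V : Type*} [NormedAddCommGroup V] {g : ℝ → V}
    (hg : ContinuousOn g (Icc 0 T)) : MemLp g ∞ (timeMeas T) := by
  obtain ⟨C, hC⟩ := isCompact_Icc.exists_bound_of_continuousOn hg
  refine memLp_top_of_bound ((hg.aestronglyMeasurable_of_isCompact isCompact_Icc
    measurableSet_Icc).mono_measure (Measure.restrict_mono Ioo_subset_Icc_self le_rfl)) C ?_
  filter_upwards [ae_restrict_mem measurableSet_Ioo] with t ht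
  exact hC t (Ioo_subset_Icc_self ht)

theorem memLp_top_subtype_prod {V W : Type*} [NormedAddCommGroup V] [NormedAddCommGroup W]
    [NormedSpace ℝ V] [NormedSpace ℝ W] {S : Submodule ℝ (V × W)} {g : X → S}
    (h₁ : MemLp (fun t => (g t).1.1) ∞ μ) (h₂ : MemLp (fun t => (g t).1.2) ∞ μ) :
    MemLp g ∞ μ := by
  have hpair : MemLp (fun t => ((g t : S) : V × W)) ∞ μ := by
    refine (h₁.norm.add h₂.norm).mono (h₁.1.prodMk h₂.1) (ae_of_all _ fun t => ?_)
    rw [Pi.add_apply, Real.norm_of_nonneg (by positivity), Prod.norm_def]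
    exact max_le (le_add_of_nonneg_right (norm_nonneg _)) (le_add_of_nonneg_left (norm_nonneg _))
  exact hpair.mono (Topology.IsEmbedding.subtypeVal.aestronglyMeasurable_comp_iff.1 hpair.1)
    (ae_of_all _ fun t => le_rfl)

theorem memLp_subtype_snd {V W : Type*} [NormedAddCommGroup V] [NormedAddCommGroup W]
    [NormedSpace ℝ V] [NormedSpace ℝ W] {S : Submodule ℝ (V × W)} {p : ℝ≥0∞} {g : X → S}
    (hg : MemLp g p μ) : MemLp (fun t => (g t).1.2) p μ :=
  ((ContinuousLinearMap.snd ℝ V W).comp S.subtypeL).comp_memLp' hg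

theorem hasDerivAt_of_sub_eq_integral {y y' : ℝ → ℝ} (hy' : ContinuousOn y' (Icc 0 T))
    (h : ∀ t ∈ Icc 0 T, y t - y 0 = ∫ r in (0 : ℝ)..t, y' r) {t : ℝ} (ht : t ∈ Ioo 0 T) :
    HasDerivAt y (y' t) t := by
  have hinteg : IntervalIntegrable y' volume 0 t := by
    refine ContinuousOn.intervalIntegrable (hy'.mono ?_)
    rw [uIcc_of_le ht.1.le]
    exact Icc_subset_Icc le_rfl ht.2.le
  have hprim : HasDerivAt (fun t => ∫ r in (0 : ℝ)..t, y' r) (y' t) t :=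
    have hIoo := hy'.mono Ioo_subset_Icc_self
    intervalIntegral.integral_hasDerivAt_right hinteg
      (hIoo.stronglyMeasurableAtFilter isOpen_Ioo t ht) (hIoo.continuousAt (isOpen_Ioo.mem_nhds ht))
  refine (hprim.add_const (y 0)).congr_of_eventuallyEq ?_
  filter_upwards [isOpen_Ioo.mem_nhds ht] with r hr
  rw [← h r (Ioo_subset_Icc_self hr), sub_add_cancel]

theorem hasWeakTimeDeriv_of_sub_eq_integral (hT : 0 ≤ T) {y y' : ℝ → ℝ}
    (hy : ContinuousOn y (Icc 0 T)) (hy' : ContinuousOn y' (Icc 0 T))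
    (h : ∀ t ∈ Icc 0 T, y t - y 0 = ∫ r in (0 : ℝ)..t, y' r) : HasWeakTimeDeriv T y y' := by
  intro θ
  have hθ : ∀ t, t ∉ Ioo 0 T → θ t = 0 := fun t ht =>
    image_eq_zero_of_notMem_tsupport fun hmem => ht (θ.tsupport_subset hmem)
  rw [← uIcc_of_le hT] at hy hy'
  have hparts := intervalIntegral.integral_mul_deriv_eq_deriv_mul_of_hasDerivAt (a := 0) (b := T)
    θ.continuous.continuousOn hy (fun t _ => (θ.contDiff.differentiable (by simp) t).hasDerivAt)
    (fun t ht => hasDerivAt_of_sub_eq_integral (uIcc_of_le hT ▸ hy') h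
      (by rwa [min_eq_left hT, max_eq_right hT] at ht))
    ((θ.contDiff.continuous_deriv (by simp)).intervalIntegrable _ _) hy'.intervalIntegrable
  simpa only [hθ 0 (by simp), hθ T (by simp), zero_mul, sub_self, zero_sub, smul_eq_mul,
    intervalIntegral.integral_of_le hT, integral_Ioc_eq_integral_Ioo] using hparts

theorem hasWeakTimeDeriv_of_inner [CompleteSpace H] {u g : ℝ → H} (hu : MemLp u ∞ (timeMeas T))
    (hg : MemLp g ∞ (timeMeas T))
    (h : ∀ w, HasWeakTimeDeriv T (fun t => inner ℝ (u t) w) (fun t => inner ℝ (g t) w)) :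
    HasWeakTimeDeriv T u g := by
  intro θ
  have hθ : MemLp θ ∞ (timeMeas T) := θ.continuous.memLp_of_hasCompactSupport θ.hasCompactSupport
  have hθ' : MemLp (deriv θ) ∞ (timeMeas T) :=
    (θ.contDiff.continuous_deriv (by simp)).memLp_of_hasCompactSupport θ.hasCompactSupport.deriv
  have hθg : Integrable (fun t => θ t • g t) (timeMeas T) :=
    (hg.smul (r := ∞) hθ).integrable (by simp)
  have hθu : Integrable (fun t => deriv θ t • u t) (timeMeas T) :=
    (hu.smul (r := ∞) hθ').integrable (by simp)
  refine ext_inner_left ℝ fun w => ?_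
  rw [inner_neg_right, ← integral_inner hθg, ← integral_inner hθu]
  simpa only [real_inner_smul_right, real_inner_comm, smul_eq_mul] using h w θ

end WeakTimeDerivative

section MulOp

variable {X : Type*} [MeasurableSpace X] {μ : Measure X} {g h φ : X → ℝ}

/-- The operator of multiplication by a bounded function on `L²`. -/
noncomputable def mulOp (hg : MemLp g ∞ μ) : Lp ℝ 2 μ →L[ℝ] Lp ℝ 2 μ :=
  (ContinuousLinearMap.mul ℝ ℝ).holderL μ ∞ 2 2 (hg.toLp g)

theorem coeFn_mulOp (hg : MemLp g ∞ μ) (u : Lp ℝ 2 μ) : mulOp hg u =ᵐ[μ] fun x => g x * u x := by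
  have hcoe := (ContinuousLinearMap.mul ℝ ℝ).coeFn_holder (r := 2) (hg.toLp g) u
  filter_upwards [hcoe, hg.coeFn_toLp] with x hx hgx
  exact hx.trans (by rw [hgx, ContinuousLinearMap.mul_apply'])

theorem isSymmetric_mulOp (hg : MemLp g ∞ μ) : (mulOp hg).toLinearMap.IsSymmetric := by
  intro u v
  rw [ContinuousLinearMap.coe_coe, L2.inner_def, L2.inner_def]
  refine integral_congr_ae ?_
  filter_upwards [coeFn_mulOp hg u, coeFn_mulOp hg v] with x hu hv
  rw [hu, hv, ← smul_eq_mul, ← smul_eq_mul, real_inner_smul_left, real_inner_smul_right]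

theorem mulOp_mulOp_of_mul_eq_one (hg : MemLp g ∞ μ) (hh : MemLp h ∞ μ)
    (hgh : ∀ᵐ x ∂μ, g x * h x = 1) (u : Lp ℝ 2 μ) : mulOp hg (mulOp hh u) = u := by
  refine Lp.ext ?_
  filter_upwards [coeFn_mulOp hg (mulOp hh u), coeFn_mulOp hh u, hgh] with x hgx hhx hx
  rw [hgx, hhx, ← mul_assoc, hx, one_mul]

theorem exists_isSymmetric_mul_apply_apply_eq (hφm : AEStronglyMeasurable φ μ) {a b : ℝ}
    (ha : 0 < a) (hφ : ∀ᵐ x ∂μ, a ≤ φ x ∧ φ x ≤ b) :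
    ∃ Q : Lp ℝ 2 μ ≃L[ℝ] Lp ℝ 2 μ, (Q : Lp ℝ 2 μ →L[ℝ] Lp ℝ 2 μ).toLinearMap.IsSymmetric ∧
      ∀ u, (fun x => φ x * Q (Q u) x) =ᵐ[μ] u := by
  have hsqrtm : AEStronglyMeasurable (fun x => √(φ x)) μ :=
    Real.continuous_sqrt.comp_aestronglyMeasurable hφm
  have hsqrt : MemLp (fun x => √(φ x)) ∞ μ := by
    refine memLp_top_of_bound hsqrtm (√b) ?_
    filter_upwards [hφ] with x hx
    rw [Real.norm_of_nonneg (Real.sqrt_nonneg _)]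
    exact Real.sqrt_le_sqrt hx.2
  have hinv : MemLp (fun x => (√(φ x))⁻¹) ∞ μ := by
    refine memLp_top_of_bound hsqrtm.aemeasurable.inv.aestronglyMeasurable (√a)⁻¹ ?_
    filter_upwards [hφ] with x hx
    rw [Real.norm_of_nonneg (inv_nonneg.2 (Real.sqrt_nonneg _))]
    exact inv_anti₀ (Real.sqrt_pos.2 ha) (Real.sqrt_le_sqrt hx.1)
  have hone : ∀ᵐ x ∂μ, (√(φ x))⁻¹ * √(φ x) = 1 := by
    filter_upwards [hφ] with x hx
    exact inv_mul_cancel₀ (Real.sqrt_pos.2 (ha.trans_le hx.1)).ne'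
  refine ⟨.equivOfInverse (mulOp hinv) (mulOp hsqrt)
    (mulOp_mulOp_of_mul_eq_one _ _ (by simpa only [mul_comm] using hone))
    (mulOp_mulOp_of_mul_eq_one _ _ hone), isSymmetric_mulOp hinv, fun u => ?_⟩
  filter_upwards [coeFn_mulOp hinv (mulOp hinv u), coeFn_mulOp hinv u, hφ] with x hQQ hQ hx
  have hpos := ha.trans_le hx.1
  rw [ContinuousLinearEquiv.equivOfInverse_apply, ContinuousLinearEquiv.equivOfInverse_apply, hQQ,
    hQ, ← mul_assoc (√(φ x))⁻¹, ← mul_inv, Real.mul_self_sqrt hpos.le,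
    mul_inv_cancel_left₀ hpos.ne']

end MulOp

section FlowExistence

variable {d N : ℕ} {Ω : Opens (Euc d)} [IsFiniteMeasure (volOn Ω)] {e : ForchheimerExponents N}
  {lo up : ℝ} {L : ℝ≥0} {A : ℝ → Fin (N + 1) → Euc d → ℝ} {hA : AdmissibleEvolution lo up L Ω A}
  {Q : Lp ℝ 2 (volOn Ω) →L[ℝ] Lp ℝ 2 (volOn Ω)} {f : ℝ → Lp ℝ 2 (volOn Ω)} {T : ℝ}

namespace IsMomentum

variable {ρ : ℝ → Lp ℝ 2 (volOn Ω)} {m : ℝ → Wdiv Ω e.s}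

theorem memLp_top_field (hm : ∀ t ∈ Icc 0 T, IsMomentum hA t (ρ t) (m t))
    (hρ : ContinuousOn ρ (Icc 0 T)) {M : ℝ} (hM : ∀ t ∈ Icc 0 T, ‖(m t).1.2‖ ≤ M) :
    MemLp m ∞ (timeMeas T) := by
  obtain ⟨hfield, -, hdiv⟩ := IsMomentum.continuousOn hm hρ hM
  refine memLp_top_subtype_prod (memLp_top_of_continuousOn_Icc hfield) ?_
  have : Fact ((2 : ℝ≥0∞) ≠ ∞) := ⟨ENNReal.ofNat_ne_top⟩
  refine memLp_top_of_bound (aestronglyMeasurable_of_inner fun w => ?_) M ?_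
  · simp_rw [real_inner_comm _ w]
    exact (memLp_top_of_continuousOn_Icc (hdiv w)).1
  · filter_upwards [ae_restrict_mem measurableSet_Ioo] with t ht
    exact hM t (Ioo_subset_Icc_self ht)

theorem exists_density (hm : ∀ t ∈ Icc 0 T, IsMomentum hA t (ρ t) (m t))
    (hρ : ContinuousOn ρ (Icc 0 T)) {M : ℝ} (hM : ∀ t ∈ Icc 0 T, ‖(m t).1.2‖ ≤ M) :
    ∃ r : ℝ → L2W0 Ω e.sStar, MemLp r ∞ (timeMeas T) ∧
      ∀ t ∈ Icc 0 T, L2W0.toL2 (r t) = ρ t := by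
  have hexists : ∀ t ∈ Icc 0 T, ∃ r : L2W0 Ω e.sStar,
      r.1 = (ρ t, -e.fluxLp (hA.admissible t) (m t).1.1) :=
    fun t ht => ⟨⟨_, (hm t ht).mem_L2W0⟩, rfl⟩
  choose! r hr using hexists
  have hρr : EqOn (fun t => (r t).1.1) ρ (Icc 0 T) := fun t ht => congrArg Prod.fst (hr t ht)
  refine ⟨r, memLp_top_subtype_prod (memLp_top_of_continuousOn_Icc (hρ.congr hρr))
    (memLp_top_of_continuousOn_Icc ?_), hρr⟩
  exact (IsMomentum.continuousOn hm hρ hM).2.1.neg.congr fun t ht => congrArg Prod.snd (hr t ht)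

end IsMomentum

/-- `(m, ρ)` solves the flow problem on `[0, T]` with the momentum equation satisfied at every
time and `∂ₜρ = Q (Q (f - div m))`; here `Q` stands for the multiplication by `φ ^ (-1/2)`. -/
structure IsFlow (hA : AdmissibleEvolution lo up L Ω A)
    (Q : Lp ℝ 2 (volOn Ω) →L[ℝ] Lp ℝ 2 (volOn Ω)) (f : ℝ → Lp ℝ 2 (volOn Ω)) (T : ℝ)
    (m : ℝ → Wdiv Ω e.s) (ρ : ℝ → L2W0 Ω e.sStar) : Prop where
  memLp_field : MemLp m ∞ (timeMeas T)
  memLp_density : MemLp ρ ∞ (timeMeas T)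
  memLp_deriv : MemLp (fun t => Q (Q (f t - (m t).1.2))) ∞ (timeMeas T)
  hasWeakTimeDeriv : HasWeakTimeDeriv T (fun t => L2W0.toL2 (ρ t)) fun t => Q (Q (f t - (m t).1.2))
  isMomentum : ∀ t ∈ Icc 0 T, IsMomentum hA t (L2W0.toL2 (ρ t)) (m t)
  continuousOn : ContinuousOn (fun t => L2W0.toL2 (ρ t)) (Icc 0 T)

theorem IsStrongSolution.exists_isFlow {c : ℝ≥0} (hQ : AntilipschitzWith c Q)
    (hQs : Q.toLinearMap.IsSymmetric) (hT : 0 ≤ T) (hf : Continuous f) {M : ℝ}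
    {u a : ℝ → Lp ℝ 2 (volOn Ω)}
    (hu : IsStrongSolution (FlowRel e hA Q) (fun t => Q (f t)) T M u a) :
    ∃ m ρ, IsFlow (e := e) hA Q f T m ρ ∧ L2W0.toL2 (ρ 0) = Q (u 0) := by
  have h0 : (0 : ℝ) ∈ Icc 0 T := ⟨le_rfl, hT⟩
  choose! m hma hm using hu.mem
  have hρ : ContinuousOn (fun t => Q (u t)) (Icc 0 T) :=
    Q.continuous.comp_continuousOn hu.continuousOn
  have hdiv : ∀ t ∈ Icc 0 T, ‖(m t).1.2‖ ≤ c * M := fun t ht =>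
    (Q.bound_of_antilipschitz hQ _).trans
      (by gcongr; exact hma t ht ▸ hu.norm_selection_le t ht)
  obtain ⟨ρ, hρL, hρu⟩ := IsMomentum.exists_density hm hρ hdiv
  have hρc : ContinuousOn (fun t => L2W0.toL2 (ρ t)) (Icc 0 T) := hρ.congr hρu
  have hmL := IsMomentum.memLp_top_field hm hρ hdiv
  have hderiv : MemLp (fun t => Q (Q (f t - (m t).1.2))) ∞ (timeMeas T) :=
    (Q.comp Q).comp_memLp'
      ((memLp_top_of_continuousOn_Icc hf.continuousOn).sub (memLp_subtype_snd hmL))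
  refine ⟨m, ρ, ⟨hmL, hρL, hderiv, hasWeakTimeDeriv_of_inner (memLp_top_of_continuousOn_Icc hρc)
    hderiv fun w => hasWeakTimeDeriv_of_sub_eq_integral hT (hρc.inner continuousOn_const) ?_ ?_,
    fun t ht => hρu t ht ▸ hm t ht, hρc⟩, hρu 0 h0⟩
  · simp_rw [hQs.apply_clm, inner_sub_left]
    exact (hf.inner continuous_const).continuousOn.sub
      ((IsMomentum.continuousOn hm hρ hdiv).2.2 _)
  · intro t ht
    rw [← inner_sub_left, hρu t ht, hρu 0 h0, ← map_sub, hQs.apply_clm,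
      hu.inner_sub_eq_integral t ht]
    refine intervalIntegral.integral_congr fun r hr => ?_
    rw [uIcc_of_le ht.1] at hr
    simp only [hma r ⟨hr.1, hr.2.trans ht.2⟩, ← map_sub, hQs.apply_clm]

theorem exists_isFlow {c : ℝ≥0} (hQ : AntilipschitzWith c Q) (hQs : Q.toLinearMap.IsSymmetric)
    (hT : 0 < T) {F : ℝ} (hF : ∀ t, ‖f t‖ ≤ F) {L' : ℝ≥0} (hf : LipschitzWith L' f)
    {u₀ : Lp ℝ 2 (volOn Ω)} {m₀ : Wdiv Ω e.s} (hm₀ : IsMomentum hA 0 (Q u₀) m₀) :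
    ∃ m ρ, IsFlow (e := e) hA Q f T m ρ ∧ L2W0.toL2 (ρ 0) = Q u₀ := by
  obtain ⟨K, hG⟩ := FlowRel.isMaximalMonotoneFamily (e := e) (hA := hA) hQ hQs
  obtain ⟨u, a, M, rfl, hu⟩ := hG.exists_isStrongSolution (FlowRel.isDemiclosed hQ hQs) hT
    (fun t => (Q.le_opNorm (f t)).trans (mul_le_mul_of_nonneg_left (hF t) (norm_nonneg _)))
    (Q.lipschitz.comp hf) ⟨m₀, rfl, hm₀⟩
  exact hu.exists_isFlow hQ hQs hT.le hf.continuous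

end FlowExistence

section WeakSolution

variable {X : Type*} [MeasurableSpace X] {μ : Measure X}

theorem ae_norm_le_norm_Lp_top {V : Type*} [NormedAddCommGroup V] (g : Lp V ∞ μ) :
    ∀ᵐ x ∂μ, ‖g x‖ ≤ ‖g‖ := by
  filter_upwards [enorm_ae_le_eLpNormEssSup g μ] with x hx
  rw [Lp.norm_def, ← toReal_enorm]
  exact ENNReal.toReal_mono (Lp.eLpNorm_ne_top g) (by rwa [eLpNorm_exponent_top])

theorem integral_mul_eq_inner (u v : Lp ℝ 2 μ) : ∫ x, u x * v x ∂μ = inner ℝ u v := by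
  simp_rw [L2.inner_def, RCLike.inner_apply, conj_trivial, mul_comm]

theorem integrable_inner_of_memLp_top {H : Type*} [NormedAddCommGroup H] [InnerProductSpace ℝ H]
    {u v : X → H} (hu : MemLp u ∞ μ) (hv : MemLp v 1 μ) :
    Integrable (fun t => inner ℝ (u t) (v t)) μ :=
  memLp_one_iff_integrable.1 ((innerSL ℝ).memLp_of_bilin 1 hu hv)

theorem lipschitzWith_IccExtend_domRestrict {V : Type*} [PseudoEMetricSpace V] {a b : ℝ}
    {g : ℝ → V} {K : ℝ≥0} (h : a ≤ b) (hg : LipschitzOnWith K g (Icc a b)) :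
    LipschitzWith K (IccExtend h ((Icc a b).domRestrict g)) :=
  mul_one K ▸ hg.to_restrict.comp (LipschitzWith.projIcc h)

variable {d N : ℕ} {Ω : Opens (Euc d)} {e : ForchheimerExponents N} {φ : Euc d → ℝ}
  {A B : ℝ → Fin (N + 1) → Euc d → ℝ} {f g : ℝ → Lp ℝ 2 (volOn Ω)} {T : ℝ}
  {m : ℝ → Wdiv Ω e.s} {ρ : ℝ → L2W0 Ω e.sStar} {ρ' : ℝ → Lp ℝ 2 (volOn Ω)}

/-- `(m, ρ)` is a weak solution on `(0, T)` of the Forchheimer system with coefficients `A`,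
porosity `φ` and source `f`, and `ρ'` is the time derivative of `ρ`. -/
structure IsWeakSolution (φ : Euc d → ℝ) (A : ℝ → Fin (N + 1) → Euc d → ℝ)
    (f : ℝ → Lp ℝ 2 (volOn Ω)) (T : ℝ) (m : ℝ → Wdiv Ω e.s) (ρ : ℝ → L2W0 Ω e.sStar)
    (ρ' : ℝ → Lp ℝ 2 (volOn Ω)) : Prop where
  memLp_field : MemLp m ∞ (timeMeas T)
  memLp_density : MemLp ρ ∞ (timeMeas T)
  memLp_deriv : MemLp ρ' ∞ (timeMeas T)
  hasWeakTimeDeriv : HasWeakTimeDeriv T (fun t => L2W0.toL2 (ρ t)) ρ'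
  momentum : ∀ v : ℝ → Wdiv Ω e.s, MemLp v 1 (timeMeas T) →
    (∫ t in Ioo 0 T, ∫ x in Ω, e.poly (fun i => A t i x) ‖Wdiv.field (m t) x‖ *
        inner ℝ (Wdiv.field (m t) x) (Wdiv.field (v t) x)) -
      (∫ t in Ioo 0 T, ∫ x in Ω, Wdiv.div (v t) x * L2W0.toL2 (ρ t) x) = 0
  mass : ∀ q : ℝ → Lp ℝ 2 (volOn Ω), MemLp q 1 (timeMeas T) →
    (∫ t in Ioo 0 T, ∫ x in Ω, φ x * ρ' t x * q t x) +
      (∫ t in Ioo 0 T, ∫ x in Ω, Wdiv.div (m t) x * q t x) =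
        ∫ t in Ioo 0 T, ∫ x in Ω, f t x * q t x

theorem IsWeakSolution.congr (h : IsWeakSolution φ A f T m ρ ρ') (hA : EqOn A B (Ioo 0 T))
    (hf : EqOn f g (Ioo 0 T)) : IsWeakSolution φ B g T m ρ ρ' where
  __ := h
  momentum v hv := by
    refine (congrArg (· - _) ?_).trans (h.momentum v hv)
    exact setIntegral_congr_fun measurableSet_Ioo fun t ht => by simp only [hA ht]
  mass q hq := by
    rw [h.mass q hq]
    exact setIntegral_congr_fun measurableSet_Ioo fun t ht => by simp only [hf ht]

variable {lo up : ℝ} {L : ℝ≥0}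

theorem admissibleEvolution_of_lipschitzWith {a : Fin (N + 1) → ℝ → Lp ℝ ∞ (volOn Ω)}
    (hlo : 0 < lo) (hzero : ∀ t, ∀ᵐ x ∂volOn Ω, lo ≤ a 0 t x)
    (hlast : ∀ t, ∀ᵐ x ∂volOn Ω, lo ≤ a (Fin.last N) t x)
    (ha : ∀ i t, ∀ᵐ x ∂volOn Ω, 0 ≤ a i t x ∧ a i t x ≤ up) (hlip : ∀ i, LipschitzWith L (a i)) :
    AdmissibleEvolution lo (max up 0) L Ω fun t i => a i t where
  admissible t := by
    refine ⟨hlo, le_max_right _ _, fun i => Lp.aestronglyMeasurable _, ?_⟩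
    filter_upwards [hzero t, hlast t, ae_all_iff.2 fun i => ha i t] with x hx₀ hxN hx
    exact ⟨fun i => (hx i).1, fun i => (hx i).2.trans (le_max_left _ _), hx₀, hxN⟩
  lipschitz t r := by
    refine ae_all_iff.2 fun i => ?_
    filter_upwards [ae_norm_le_norm_Lp_top (a i t - a i r), Lp.coeFn_sub (a i t) (a i r)]
      with x hx hsub
    rw [hsub, Pi.sub_apply, Real.norm_eq_abs, ← dist_eq_norm] at hx
    exact hx.trans ((hlip i).dist_le_mul t r)

variable [IsFiniteMeasure (volOn Ω)] {hA : AdmissibleEvolution lo up L Ω A}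
  {Q : Lp ℝ 2 (volOn Ω) →L[ℝ] Lp ℝ 2 (volOn Ω)}

theorem IsMomentum.integral_poly_mul_inner_eq {t : ℝ} {σ : Lp ℝ 2 (volOn Ω)} {n : Wdiv Ω e.s}
    (hn : IsMomentum hA t σ n) (v : Wdiv Ω e.s) :
    ∫ x in Ω, e.poly (fun i => A t i x) ‖Wdiv.field n x‖ *
      inner ℝ (Wdiv.field n x) (Wdiv.field v x) = ∫ x in Ω, Wdiv.div v x * σ x := by
  have hv := hn v
  rw [innerPairing_eq_integral, real_inner_comm, ← integral_mul_eq_inner] at hv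
  refine Eq.trans (integral_congr_ae ?_) hv
  filter_upwards [e.coeFn_fluxLp (hA.admissible t) n.1.1] with x hx
  rw [hx, ForchheimerExponents.flux, real_inner_smul_left, Wdiv.field, Wdiv.field]

theorem IsFlow.isWeakSolution (h : IsFlow hA Q f T m ρ) (hf : MemLp f ∞ (timeMeas T))
    (hφ : ∀ u, (fun x => φ x * Q (Q u) x) =ᵐ[volOn Ω] u) :
    IsWeakSolution φ A f T m ρ fun t => Q (Q (f t - (m t).1.2)) where
  memLp_field := h.memLp_field
  memLp_density := h.memLp_density
  memLp_deriv := h.memLp_deriv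
  hasWeakTimeDeriv := h.hasWeakTimeDeriv
  momentum v _ := sub_eq_zero.2 <| setIntegral_congr_fun measurableSet_Ioo fun t ht =>
    (h.isMomentum t (Ioo_subset_Icc_self ht)).integral_poly_mul_inner_eq (v t)
  mass q hq := by
    have hdiv := memLp_subtype_snd h.memLp_field
    have hporosity (t : ℝ) : ∫ x in Ω, φ x * Q (Q (f t - (m t).1.2)) x * q t x =
        inner ℝ (f t - (m t).1.2) (q t) := by
      rw [← integral_mul_eq_inner]
      refine integral_congr_ae ?_
      filter_upwards [hφ (f t - (m t).1.2)] with x hx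
      rw [hx]
    simp_rw [hporosity, Wdiv.div, integral_mul_eq_inner]
    refine (integral_add (integrable_inner_of_memLp_top (hf.sub hdiv) hq)
      (integrable_inner_of_memLp_top hdiv hq)).symm.trans ?_
    simp only [Pi.sub_apply, ← inner_add_left, sub_add_cancel]

theorem isMomentum_zero (t : ℝ) : IsMomentum hA t 0 (0 : Wdiv Ω e.s) := by
  refine isMomentum_of_ae_flux_eq_neg_grad (0 : L2W0 Ω e.sStar) 0 ?_
  filter_upwards [Lp.coeFn_zero (Euc d) e.s (volOn Ω), Lp.coeFn_zero (Euc d) e.sStar (volOn Ω)]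
    with x hs hsStar
  change e.flux _ ((0 : Lp (Euc d) e.s (volOn Ω)) x) = -(0 : Lp (Euc d) e.sStar (volOn Ω)) x
  rw [hs, hsStar, ForchheimerExponents.flux]
  exact (smul_zero _).trans neg_zero.symm

theorem exists_isMomentum_of_compatible {t : ℝ} {c : Fin (N + 1) → Euc d → ℝ} (hc : A t = c)
    (ρ₀ : L2W0 Ω e.sStar) :
    ∃ (ρ₁ : Lp ℝ 2 (volOn Ω)) (m₁ : Wdiv Ω e.s), IsMomentum hA t ρ₁ m₁ ∧
      ((∃ m₀ : Wdiv Ω e.s, ∀ᵐ x ∂volOn Ω,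
        e.poly (fun i => c i x) ‖Wdiv.field m₀ x‖ • Wdiv.field m₀ x = -L2W0.grad ρ₀ x) →
        ρ₁ = L2W0.toL2 ρ₀) := by
  subst hc
  by_cases hcompat : ∃ m₀ : Wdiv Ω e.s, ∀ᵐ x ∂volOn Ω,
    e.poly (fun i => A t i x) ‖Wdiv.field m₀ x‖ • Wdiv.field m₀ x = -L2W0.grad ρ₀ x
  · obtain ⟨m₀, hm₀⟩ := hcompat
    exact ⟨_, m₀, isMomentum_of_ae_flux_eq_neg_grad ρ₀ m₀ hm₀, fun _ => rfl⟩
  · exact ⟨0, 0, isMomentum_zero t, fun h => absurd h hcompat⟩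

theorem exists_isWeakSolution (hT : 0 < T) (hφm : AEStronglyMeasurable φ (volOn Ω))
    {φLow φUp : ℝ} (hφLow : 0 < φLow) (hφ : ∀ᵐ x ∂volOn Ω, φLow ≤ φ x ∧ φ x ≤ φUp)
    {C : ℝ} (hC : ∀ t, ‖f t‖ ≤ C) {K : ℝ≥0} (hf : LipschitzWith K f) {ρ₁ : Lp ℝ 2 (volOn Ω)}
    {m₁ : Wdiv Ω e.s} (hm₁ : IsMomentum hA 0 ρ₁ m₁) :
    ∃ (m : ℝ → Wdiv Ω e.s) (ρ : ℝ → L2W0 Ω e.sStar) (ρ' : ℝ → Lp ℝ 2 (volOn Ω)),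
      IsWeakSolution φ A f T m ρ ρ' ∧ HasInitialValue T (fun t => L2W0.toL2 (ρ t)) ρ₁ := by
  obtain ⟨Q, hQs, hQφ⟩ := exists_isSymmetric_mul_apply_apply_eq hφm hφLow hφ
  have hm₁' : IsMomentum hA 0 (Q (Q.symm ρ₁)) m₁ := by rwa [Q.apply_symm_apply]
  obtain ⟨m, ρ, hflow, hρ₁⟩ :=
    exists_isFlow (Q := (Q : Lp ℝ 2 (volOn Ω) →L[ℝ] Lp ℝ 2 (volOn Ω))) Q.antilipschitz hQs hT hC
      hf hm₁'
  exact ⟨m, ρ, _, hflow.isWeakSolution (memLp_top_of_continuousOn_Icc hf.continuous.continuousOn)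
    hQφ, _, hflow.continuousOn, ae_eq_refl _, hρ₁.trans (Q.apply_symm_apply ρ₁)⟩

theorem theorem4p1_general (hT : 0 < T)
    (a : Fin (N + 1) → ℝ → Lp ℝ ∞ (volOn Ω)) {aLow aUp : ℝ} (haLow : 0 < aLow)
    (ha_zero : ∀ t ∈ Icc 0 T, ∀ᵐ x ∂volOn Ω, aLow ≤ a 0 t x)
    (ha_last : ∀ t ∈ Icc 0 T, ∀ᵐ x ∂volOn Ω, aLow ≤ a (Fin.last N) t x)
    (ha : ∀ i, ∀ t ∈ Icc 0 T, ∀ᵐ x ∂volOn Ω, 0 ≤ a i t x ∧ a i t x ≤ aUp)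
    (hφm : AEStronglyMeasurable φ (volOn Ω)) {φLow φUp : ℝ} (hφLow : 0 < φLow)
    (hφ : ∀ᵐ x ∂volOn Ω, φLow ≤ φ x ∧ φ x ≤ φUp)
    (ha_lip : ∀ i, LipschitzOnWith L (a i) (Icc 0 T)) (hf_lip : LipschitzOnWith L f (Icc 0 T))
    (ρ₀ : L2W0 Ω e.sStar) :
    ∃ (m : ℝ → Wdiv Ω e.s) (ρ : ℝ → L2W0 Ω e.sStar) (ρ' : ℝ → Lp ℝ 2 (volOn Ω)),
      IsWeakSolution φ (fun t i => a i t) f T m ρ ρ' ∧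
      ((∃ m₀ : Wdiv Ω e.s, ∀ᵐ x ∂volOn Ω,
          e.poly (fun i => a i 0 x) ‖Wdiv.field m₀ x‖ • Wdiv.field m₀ x = -L2W0.grad ρ₀ x) →
        HasInitialValue T (fun t => L2W0.toL2 (ρ t)) (L2W0.toL2 ρ₀)) := by
  let b (i : Fin (N + 1)) := IccExtend hT.le ((Icc 0 T).domRestrict (a i))
  let g := IccExtend hT.le ((Icc 0 T).domRestrict f)
  have hmem (t : ℝ) := (projIcc 0 T hT.le t).2
  have hA : AdmissibleEvolution aLow (max aUp 0) L Ω fun t i => b i t :=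
    admissibleEvolution_of_lipschitzWith haLow (fun t => ha_zero _ (hmem t))
      (fun t => ha_last _ (hmem t)) (fun i t => ha i _ (hmem t))
      fun i => lipschitzWith_IccExtend_domRestrict hT.le (ha_lip i)
  have hb : EqOn (fun t i => (b i t : Euc d → ℝ)) (fun t i => a i t) (Icc 0 T) := fun t ht =>
    funext fun i => by simp only [b, IccExtend_of_mem hT.le _ ht, domRestrict_apply]
  have hg : EqOn g f (Icc 0 T) := fun t ht => IccExtend_of_mem hT.le _ ht
  obtain ⟨C, hC⟩ := isCompact_Icc.exists_bound_of_continuousOn hf_lip.continuousOn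
  obtain ⟨ρ₁, m₁, hm₁, hρ₁⟩ :=
    exists_isMomentum_of_compatible (hA := hA) (hb ⟨le_rfl, hT.le⟩) ρ₀
  obtain ⟨m, ρ, ρ', hsol, hinitial⟩ := exists_isWeakSolution hT hφm hφLow hφ
    (fun t => hC _ (hmem t)) (lipschitzWith_IccExtend_domRestrict hT.le hf_lip) hm₁
  exact ⟨m, ρ, ρ', hsol.congr (hb.mono Ioo_subset_Icc_self) (hg.mono Ioo_subset_Icc_self),
    fun hcompat => hρ₁ hcompat ▸ hinitial⟩

end WeakSolution

theorem theorem4p1 {d N : ℕ} (hd : 2 ≤ d)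
    (Ω : Opens (Euc d)) (hΩ : Bornology.IsBounded (Ω : Set (Euc d)))
    (T : ℝ) (hT : 0 < T)
    (e : ForchheimerExponents N)
    -- the coefficients `a i t = a_i(·,t)`
    (a : Fin (N + 1) → ℝ → Lp ℝ ∞ (volOn Ω)) (aLow aUp : ℝ) (haLow : 0 < aLow)
    (ha_zero : ∀ t ∈ Icc 0 T, ∀ᵐ x ∂volOn Ω, aLow ≤ a 0 t x)
    (ha_last : ∀ t ∈ Icc 0 T, ∀ᵐ x ∂volOn Ω, aLow ≤ a (Fin.last N) t x)
    (ha : ∀ i, ∀ t ∈ Icc 0 T, ∀ᵐ x ∂volOn Ω, 0 ≤ a i t x ∧ a i t x ≤ aUp)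
    -- the porosity
    (φ : Euc d → ℝ) (hφm : AEStronglyMeasurable φ (volOn Ω))
    (φLow φUp : ℝ) (hφLow : 0 < φLow)
    (hφ : ∀ᵐ x ∂volOn Ω, φLow ≤ φ x ∧ φ x ≤ φUp)
    -- the source term
    (f : ℝ → Lp ℝ 2 (volOn Ω)) (hf : MemLp f ∞ (timeMeas T))
    -- Lipschitz continuity in time
    (L : ℝ≥0) (ha_lip : ∀ i, LipschitzOnWith L (a i) (Icc 0 T))
    (hf_lip : LipschitzOnWith L f (Icc 0 T))
    -- the initial density
    (ρ₀ : L2W0 Ω e.sStar) :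
    ∃ (m : ℝ → Wdiv Ω e.s) (ρ : ℝ → L2W0 Ω e.sStar) (ρ' : ℝ → Lp ℝ 2 (volOn Ω)),
      MemLp m ∞ (timeMeas T) ∧
      MemLp ρ ∞ (timeMeas T) ∧
      MemLp ρ' ∞ (timeMeas T) ∧
      HasWeakTimeDeriv T (fun t => L2W0.toL2 (ρ t)) ρ' ∧
      (∀ v : ℝ → Wdiv Ω e.s, MemLp v 1 (timeMeas T) →
        (∫ t in Ioo 0 T, ∫ x in Ω,
            e.poly (fun i => a i t x) ‖Wdiv.field (m t) x‖ * inner ℝ (Wdiv.field (m t) x) (Wdiv.field (v t) x))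
          - (∫ t in Ioo 0 T, ∫ x in Ω, Wdiv.div (v t) x * L2W0.toL2 (ρ t) x) = 0) ∧
      (∀ q : ℝ → Lp ℝ 2 (volOn Ω), MemLp q 1 (timeMeas T) →
        (∫ t in Ioo 0 T, ∫ x in Ω, φ x * ρ' t x * q t x)
          + (∫ t in Ioo 0 T, ∫ x in Ω, Wdiv.div (m t) x * q t x)
          = ∫ t in Ioo 0 T, ∫ x in Ω, f t x * q t x) ∧
      ((∃ m₀ : Wdiv Ω e.s, ∀ᵐ x ∂volOn Ω,
          e.poly (fun i => a i 0 x) ‖Wdiv.field m₀ x‖ • Wdiv.field m₀ x = - L2W0.grad ρ₀ x) →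
        HasInitialValue T (fun t => L2W0.toL2 (ρ t)) (L2W0.toL2 ρ₀)) := by
  have : IsFiniteMeasure (volOn Ω) :=
    ⟨by rw [Measure.restrict_apply_univ]; exact hΩ.measure_lt_top⟩
  obtain ⟨m, ρ, ρ', h, hinitial⟩ := theorem4p1_general hT a haLow ha_zero ha_last ha hφm hφLow hφ
    ha_lip hf_lip ρ₀
  exact ⟨m, ρ, ρ', h.memLp_field, h.memLp_density, h.memLp_deriv, h.hasWeakTimeDeriv,
    h.momentum, h.mass, hinitial⟩
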